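/- **Theorem.** Consider weighted set cover: sets $S_1,\dots,S_n\subseteq[m]$ with $\bigcup_\ell S_\ell=[m]$ and weights $w_1,\dots,w_n>0$. Put $\Phi=\sum_\ell|S_\ell|$, $\Delta=\max_\ell|S_\ell|$, $w_{\max}=\max_\ell w_\ell$, $w_{\min}=\min_\ell w_\ell$, $H_\Delta=\sum_{i=1}^{\Delta}\frac1i$, and let $N=\sum_\ell(|S_\ell|+2)$ be the input size in words. In the MapReduce model, $M$ machines hold the input, each set (with its index, weight and elements) being stored on one machine. In every round each machine runs a randomized local computation, taking time polynomial in $N$, on its memory and the messages it has received, and sends messages that are delivered before the next round. Memory is measured in words; a word holds an integer of $O(\log N)$ bits or one of the real numbers given in the input (which can be copied and compared after scaling, but not computed with otherwise). There is a randomized MapReduce algorithm with the following property. Let $m\ge2$, $\varepsilon>0$, $\mu>0$, suppose that $\Phi\ge m^{1+\mu}$, that there are $M=O(n)$ machines, and that the sets are distributed over the machines arbitrarily, subject to each machine initially holding $O(m^{1+\mu}\log n)$ words. The algorithm knows $m,n,M,\varepsilon$ and $\lceil m^\mu\rceil$. Then: 1. in every execution each machine uses $O(m^{1+\mu}\log n)$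 words of memory at all times (stored data, received and sent messages, and working memory); 2. the algorithm halts almost surely, and whenever it halts it returns a cover $X\subseteq[n]$ with $\sum_{\ell\in X}w_\ell\le(1+\varepsilon)H_\Delta\sum_{\ell\in Y}w_\ell$ for every cover $Y$; 3. it halts within $$O\!\left(\frac{\ln(\Phi)\,\bigl(1+\log_{1+\varepsilon}(\Delta\,w_{\max}/w_{\min})\bigr)\,\ln(n)}{\mu^2\ln^2(m)}\right)$$ rounds with probability at least $1-O\!\left(\frac m\mu\right)\exp\!\left(-m^{\mu/4}/2\right)$. The constants hidden in the conclusions (and the degree of the polynomial bounding the local computation) depend only on the constants in the assumptions "$O(n)$ machines" and "initially $O(m^{1+\mu}\log n)$ words", and not on $m,n,M,\varepsilon,\mu$ or the instance. -/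

import Mathlib

open Filter Topology

noncomputable section

namespace MapReduce

/-! ### Local computation: a small randomized word machine with explicit cost -/

/-- Data types of a machine: machine words, atomic real numbers, pairs and lists. -/
inductive Ty : Type
  | nat : Ty
  | real : Ty
  | prod : Ty → Ty → Ty
  | list : Ty → Ty

namespace Ty

/-- The values of a data type. -/
@[reducible] def Val : Ty → Type
  | nat => ℕ
  | real => ℝ
  | prod a b => a.Val × b.Val
  | list a => List a.Val

/-- The number of memory words occupied by a value.  A natural number and a real number take one
word each; a list takes one word plus the words of its entries. -/
def words : (a : Ty) → a.Val → ℕ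
  | nat, _ => 1
  | real, _ => 1
  | prod a b, x => words a x.1 + words b x.2
  | list a, l => 1 + (l.map (words a)).sum

end Ty

/-- Programs with input type `a` and output type `b`.  Real numbers are atomic: a program can move
and copy the ones it has been given, and compare them through `leReal`, but it cannot create new
ones, so that no information can be packed into a real number. -/
inductive Prog : Ty → Ty → Type
  | id {a : Ty} : Prog a a
  | comp {a b c : Ty} (f : Prog a b) (g : Prog b c) : Prog a c
  | pair {a b c : Ty} (f : Prog a b) (g : Prog a c) : Prog a (.prod b c)
  | fst {a b : Ty} : Prog (.prod a b) a
  | snd {a b : Ty} : Prog (.prod a b) b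
  | const {a : Ty} (k : ℕ) : Prog a .nat
  | one {a : Ty} : Prog a .real
  | add : Prog (.prod .nat .nat) .nat
  | sub : Prog (.prod .nat .nat) .nat
  | mul : Prog (.prod .nat .nat) .nat
  | div : Prog (.prod .nat .nat) .nat
  /-- On `(k, l)`: the test `k ≤ l`. -/
  | le : Prog (.prod .nat .nat) .nat
  /-- On `((k, x), (l, (y, z)))`: the test `k * x ≤ l * (y * z)`. -/
  | leReal : Prog (.prod (.prod .nat .real) (.prod .nat (.prod .real .real))) .nat
  /-- On `k`: a uniformly random element of `{0, …, k}`. -/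
  | rand : Prog .nat .nat
  | nil {a b : Ty} : Prog a (.list b)
  | cons {b : Ty} : Prog (.prod b (.list b)) (.list b)
  /-- On `(x, l)`: run `f` on `x` if `l` is empty, and `g` on `(x, (h, t))` if `l = h :: t`. -/
  | casesList {a b h : Ty} (f : Prog a b) (g : Prog (.prod a (.prod h (.list h))) b) :
      Prog (.prod a (.list h)) b
  /-- Run `f` if the test `t` returns a nonzero word, and `g` otherwise. -/
  | ite {a b : Ty} (t : Prog a .nat) (f g : Prog a b) : Prog a b
  /-- On `((e, s), l)`: for each entry `h` of `l`, in order, replace `s` by `f ((e, s), h)`. -/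
  | fold {e s h : Ty} (f : Prog (.prod (.prod e s) h) s) :
      Prog (.prod (.prod e s) (.list h)) s
  /-- On `((e, s), k)`: for `i = 0, …, k - 1`, in order, replace `s` by `f ((e, s), i)`. -/
  | loop {e s : Ty} (f : Prog (.prod (.prod e s) .nat) s) :
      Prog (.prod (.prod e s) .nat) s

/-- The outcome of one execution: the result, the number of steps, and the largest number of words
held in memory at any time. -/
structure Outcome (β : Type) where
  val : β
  time : ℕ
  space : ℕ

/-- An elementary operation with input `x` and result `y`; its cost is the number of words that it
reads and writes. -/
def elementary (a b : Ty) (x : a.Val) (y : b.Val) : PMF (Outcome b.Val) :=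
  PMF.pure ⟨y, a.words x + b.words y, a.words x + b.words y⟩

/-- Sequential iteration of a randomized step over a list, with the costs collected. -/
def iterate (s : Ty) {η : Type} (f : s.Val → η → PMF (Outcome s.Val)) :
    List η → s.Val → PMF (Outcome s.Val)
  | [], x => PMF.pure ⟨x, s.words x, s.words x⟩
  | h :: t, x => (f x h).bind fun o => (iterate s f t o.val).bind fun o' =>
      PMF.pure ⟨o'.val, o.time + o'.time, max o.space o'.space⟩

/-- Truth values as machine words. -/
def bit (p : Prop) : ℕ := open Classical in if p then 1 else 0

/-- Execution of a program on a machine whose words range over `{0, …, W - 1}` (arithmetic is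
modulo `W`): the joint distribution of the result, the number of steps and the memory used. -/
def Prog.run (W : ℕ) : {a b : Ty} → Prog a b → a.Val → PMF (Outcome b.Val)
  | a, _, .id, x => elementary a a x x
  | _, _, .comp f g, x => (f.run W x).bind fun o => (g.run W o.val).bind fun o' =>
      PMF.pure ⟨o'.val, o.time + o'.time, max o.space o'.space⟩
  | a, .prod b _, .pair f g, x => (f.run W x).bind fun o => (g.run W x).bind fun o' =>
      PMF.pure ⟨(o.val, o'.val), o.time + o'.time,
        max (a.words x + o.space) (b.words o.val + o'.space)⟩
  | .prod a b, _, .fst, x => elementary (.prod a b) a x x.1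
  | .prod a b, _, .snd, x => elementary (.prod a b) b x x.2
  | a, _, .const k, x => elementary a .nat x (k % W)
  | a, _, .one, x => elementary a .real x (1 : ℝ)
  | _, _, .add, x => elementary (.prod .nat .nat) .nat x ((x.1 + x.2) % W)
  | _, _, .sub, x => elementary (.prod .nat .nat) .nat x (x.1 - x.2)
  | _, _, .mul, x => elementary (.prod .nat .nat) .nat x ((x.1 * x.2) % W)
  | _, _, .div, x => elementary (.prod .nat .nat) .nat x (x.1 / x.2)
  | _, _, .le, x => elementary (.prod .nat .nat) .nat x (bit (x.1 ≤ x.2))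
  | _, _, .leReal, x =>
      elementary (.prod (.prod .nat .real) (.prod .nat (.prod .real .real))) .nat x
        (bit ((x.1.1 : ℝ) * x.1.2 ≤ (x.2.1 : ℝ) * (x.2.2.1 * x.2.2.2)))
  | _, _, .rand, k =>
      (PMF.uniformOfFinset (Finset.range (k + 1)) (by simp)).bind fun y =>
        elementary .nat .nat k y
  | a, .list b, .nil, x => elementary a (.list b) x []
  | _, .list b, .cons, x => elementary (.prod b (.list b)) (.list b) x (x.1 :: x.2)
  | .prod _ (.list _), _, .casesList f _, (x, []) =>
      (f.run W x).map fun o => ⟨o.val, o.time + 1, o.space + 1⟩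
  | .prod _ (.list _), _, .casesList _ g, (x, h :: t) =>
      (g.run W (x, (h, t))).map fun o => ⟨o.val, o.time + 1, o.space + 1⟩
  | a, _, .ite t f g, x => (t.run W x).bind fun o =>
      (if o.val ≠ 0 then f.run W x else g.run W x).bind fun o' =>
        PMF.pure ⟨o'.val, o.time + o'.time, max (a.words x + o.space) o'.space⟩
  | .prod (.prod e _) (.list h), s, .fold f, x =>
      (iterate s (fun y z => f.run W ((x.1.1, y), z)) x.2 x.1.2).map fun o =>
        let c := (Ty.prod (.prod e s) (.list h)).words x
        ⟨o.val, c + o.time, c + o.space⟩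
  | .prod (.prod e _) .nat, s, .loop f, x =>
      (iterate s (fun y i => f.run W ((x.1.1, y), i)) (List.range x.2) x.1.2).map fun o =>
        let c := (Ty.prod (.prod e s) .nat).words x
        ⟨o.val, c + o.time, c + o.space⟩

/-! ### Weighted set cover -/

/-- An instance of weighted set cover: sets `S_1, …, S_n` with union the ground set of `m`
elements, and positive real weights. -/
structure SetCover (m n : ℕ) where
  sets : Fin n → Finset (Fin m)
  weight : Fin n → ℝ
  weight_pos : ∀ l, 0 < weight l
  exists_mem : ∀ j, ∃ l, j ∈ sets l

namespace SetCover

variable {m n : ℕ} (I : SetCover m n)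

/-- A family of sets, given by its indices, covers the ground set. -/
def IsCover (X : Finset (Fin n)) : Prop := ∀ j, ∃ l ∈ X, j ∈ I.sets l

/-- The weight of a family of sets. -/
def cost (X : Finset (Fin n)) : ℝ := ∑ l ∈ X, I.weight l

/-- The family `X` is a cover whose weight is at most `ρ` times the weight of every cover. -/
def IsApproxMinCover (ρ : ℝ) (X : Finset (Fin n)) : Prop :=
  I.IsCover X ∧ ∀ Y, I.IsCover Y → I.cost X ≤ ρ * I.cost Y

/-- `Δ`, the size of the largest set. -/
def maxCard : ℕ := Finset.univ.sup fun l => (I.sets l).card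

/-- `Φ`, the sum of the sizes of the sets. -/
def totalCard : ℕ := ∑ l, (I.sets l).card

/-- The largest weight. -/
def maxWeight : ℝ := ⨆ l, I.weight l

/-- The smallest weight. -/
def minWeight : ℝ := ⨅ l, I.weight l

/-- The input size in words: every set comes with its index, its weight and its elements. -/
def inputSize : ℕ := ∑ l, ((I.sets l).card + 2)

end SetCover

/-! ### MapReduce algorithms -/

/-- What a machine holds at the start: `(i, M, m, n, d)`, where `i` is its own index, `M` is the
number of machines and `d` describes the memory available; then the number `1 + ε`; and then the
list of the sets stored on this machine, as triples (index, weight, list of the elements). -/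
abbrev inputTy : Ty :=
  .prod (.prod .nat (.prod .nat (.prod .nat (.prod .nat .nat))))
    (.prod .real (.list (.prod .nat (.prod .real (.list .nat)))))

/-- What a machine keeps between rounds: a halting flag, an output list, and further data. -/
abbrev stateTy (σ : Ty) : Ty := .prod (.prod .nat (.list .nat)) σ

/-- A MapReduce algorithm for set cover: the program that turns the initial data of a machine into
its first state, and the program that a machine runs in each round, which turns its state and the
list of the messages received into its next state and a list of (addressee, message). -/
structure Algorithm where
  σ : Ty
  τ : Ty
  init : Prog inputTy (stateTy σ)
  step : Prog (.prod (stateTy σ) (.list τ)) (.prod (stateTy σ) (.list (.prod .nat τ)))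

/-- The initial data of machine `i` when set `l` is stored on machine `loc l`. -/
def input {m n M : ℕ} (I : SetCover m n) (loc : Fin n → Fin M) (d : ℕ) (ε : ℝ) (i : Fin M) :
    inputTy.Val :=
  ((i.val, M, m, n, d), (1 + ε,
    ((List.finRange n).filter fun l => loc l = i).map fun l =>
      (l.val, (I.weight l, ((I.sets l).sort (· ≤ ·)).map Fin.val))))

/-- The joint distribution of independent random variables with given distributions. -/
def independent {β : Type} : {M : ℕ} → (Fin M → PMF β) → PMF (Fin M → β)
  | 0, _ => PMF.pure Fin.elim0
  | _ + 1, p => (p 0).bind fun y => (independent fun i => p i.succ).map (Fin.cons y)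

namespace Algorithm

variable (A : Algorithm) {M : ℕ}

/-- A configuration: for each machine, its state and the messages that it has just received. -/
abbrev Config (M : ℕ) : Type := Fin M → (Ty.prod (stateTy A.σ) (.list A.τ)).Val

/-- The computation has ended: the central machine, machine `0`, has set its halting flag. -/
def Halted [NeZero M] (c : A.Config M) : Prop := (c 0).1.1.1 ≠ 0

/-- The indices listed in the output of the central machine. -/
def output [NeZero M] (c : A.Config M) : List ℕ := (c 0).1.1.2

/-- Delivery of the messages `out j` sent by the machines `j` to machine `i`. -/
def deliver (out : Fin M → List (ℕ × A.τ.Val)) (i : Fin M) : List A.τ.Val :=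
  (List.finRange M).flatMap fun j =>
    ((out j).filter fun msg => msg.1 = i.val).map Prod.snd

/-- One round: all machines run the program `step`, with independent randomness, and the messages
are delivered.  Nothing happens after the computation has ended. -/
def round [NeZero M] (W : ℕ) (c : A.Config M) : PMF (A.Config M) :=
  open Classical in
  if A.Halted c then PMF.pure c
  else (independent fun i => (A.step.run W (c i)).map Outcome.val).map fun o i =>
    ((o i).1, A.deliver (fun j => (o j).2) i)

/-- The distribution of the configuration after `r` rounds, from initial data `x`. -/
def runRounds [NeZero M] (W : ℕ) (x : Fin M → inputTy.Val) : ℕ → PMF (A.Config M)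
  | 0 => (independent fun i => (A.init.run W (x i)).map Outcome.val).map fun s i => (s i, [])
  | r + 1 => (runRounds W x r).bind (A.round W)

/-- The probability that the computation ends within `r` rounds. -/
def haltProb [NeZero M] (W : ℕ) (x : Fin M → inputTy.Val) (r : ℕ) : ℝ :=
  ((A.runRounds W x r).toOuterMeasure {c | A.Halted c}).toReal

/-- In every possible execution, every machine holds at most `s` words at any time, and its local
computation in each round takes at most `t` steps. -/
def RunsWithin [NeZero M] (W : ℕ) (x : Fin M → inputTy.Val) (s : ℝ) (t : ℕ) : Prop :=
  (∀ i, ∀ o ∈ (A.init.run W (x i)).support, (o.space : ℝ) ≤ s ∧ o.time ≤ t) ∧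
  ∀ r, ∀ c ∈ (A.runRounds W x r).support, ∀ i,
    ((Ty.prod (stateTy A.σ) (.list A.τ)).words (c i) : ℝ) ≤ s ∧
    (¬ A.Halted c → ∀ o ∈ (A.step.run W (c i)).support, (o.space : ℝ) ≤ s ∧ o.time ≤ t)

end Algorithm

end MapReduce

end

open Filter Topology
namespace MapReduce

/-! ### Deterministic semantics -/

/-! The algorithm is the greedy algorithm with ratios rounded by the factor `e = 1 + ε`, accelerated
by sampling. A reference ratio `c / v` bounds all residual ratios `|S_l \ U| / w_l` from above,
where `U` is the covered part (`RefBound`). A set is active if its residual ratio is at least `c /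
(e v)`; only active sets are picked. When no set is active, the largest residual ratio becomes the
new reference ratio.

Quality of the output is dual fitting. When a set with `D₀` new elements is picked, each of them is
charged `w / (e D₀)`, which is at most `v / c` because the set is active, and `v / c` is at most
`w_l / |S_l \ U|` for every `l` by `RefBound`. Hence a set `l` is charged at most `w_l` times a
harmonic number in total (`Charged.gstep`). Since `e` times all charges pays for the cover, its
weight is at most `e H_Δ` times that of any cover (`Charged.isApproxMinCover`).

Progress is measured by the potential `pot`, the sum of the residual sizes of the active sets. With
`q = ⌊d^(1/4)⌋`, `d = ⌈m^μ⌉` and `s = 4 q² ⌈log₂ n⌉ m`, every active set is sampled with probability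
`min (1, s / pot)`, and the central machine runs the greedy rule on the sample alone. Two
exponential moment arguments show that, except with probability `2 exp (-q ⌈log₂ n⌉)`, the sample
has total size at most `3 s` and the potential falls by the factor `q / 2` (`greedy_tail`,
`overflow_tail`, combined in `exists_exceptional_set`). The first works because a set that still has
a `1 / q` part of its elements uncovered when it is sampled covers that part, and only `m` elements
can be covered altogether.

Communication uses a tree of machines of arity `q + 1` and depth `T`, in which machine `i` has the
parent `i / a`. An epoch consists of `2 T + 1` rounds: the parameters go down, coins are drawn,
messages are merged on the way up, and the root updates the parameters. A message holds the largest
ratio, the potential and a truncated sample (`Summ`), and the whole protocol implements one abstract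
transition `Next` (`DownInv.epoch`, `finishP_spec`). As `q³ ≤ d`, the messages of all children of a
machine fit into its memory. Epochs with sampling alternate with epochs that only measure the
potential.

The number of epochs is controlled by `horizon`: the reference ratio drops by more than the factor
`e` at each change, so it changes about `log_e (Δ w_max / w_min)` times, and in between there are
about `log Φ / log q` reductions of the potential. The failure probability is controlled by `risk`,
the number of epochs with sampling. It is at most `m` times the number of reductions, independently
of the weights, because exhausting a level covers at least one new element. Together this is
`survive_le_of_horizon_le`. For almost sure termination it suffices that each sampling epoch covers
something with probability at least `1 / Φ` (`survive_le_of_fuel_le`).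

The model is handled by two abstractions. The calculus `LinOn` bounds the space of a program
linearly in its input and its time polynomially. Apart from the drawing of coins the programs are
deterministic, so they are identified with the functions `Prog.ev`, and the distribution of an epoch
is an image of the joint distribution `allCoins`. -/

theorem Ty.one_le_words : ∀ (a : Ty) (x : a.Val), 1 ≤ a.words x
  | .nat, _ => le_rfl
  | .real, _ => le_rfl
  | .prod a b, x => by
      have := Ty.one_le_words a x.1
      simp only [Ty.words]; omega
  | .list a, l => by simp only [Ty.words]; omega

/-- The first value if the test `k` is nonzero, and the second otherwise. -/
def select {α : Type*} (k : ℕ) (x y : α) : α := if k = 0 then y else x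

/-- The value computed by a program when all random draws return `0`. -/
noncomputable def Prog.ev (W : ℕ) : {a b : Ty} → Prog a b → a.Val → b.Val
  | _, _, .id, x => x
  | _, _, .comp f g, x => g.ev W (f.ev W x)
  | _, .prod _ _, .pair f g, x => (f.ev W x, g.ev W x)
  | .prod _ _, _, .fst, x => x.1
  | .prod _ _, _, .snd, x => x.2
  | _, _, .const k, _ => (k % W : ℕ)
  | _, _, .one, _ => (1 : ℝ)
  | _, _, .add, x => ((x.1 + x.2) % W : ℕ)
  | _, _, .sub, x => (x.1 - x.2 : ℕ)
  | _, _, .mul, x => ((x.1 * x.2) % W : ℕ)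
  | _, _, .div, x => (x.1 / x.2 : ℕ)
  | _, _, .le, x => bit (x.1 ≤ x.2)
  | _, _, .leReal, x => bit ((x.1.1 : ℝ) * x.1.2 ≤ (x.2.1 : ℝ) * (x.2.2.1 * x.2.2.2))
  | _, _, .rand, _ => (0 : ℕ)
  | _, .list _, .nil, _ => []
  | _, .list _, .cons, x => x.1 :: x.2
  | .prod _ (.list _), _, .casesList f g, x =>
      match x.2 with
      | [] => f.ev W x.1
      | h :: t => g.ev W (x.1, (h, t))
  | _, _, .ite t f g, x => select (t.ev W x) (f.ev W x) (g.ev W x)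
  | .prod (.prod _ _) (.list _), _, .fold f, x =>
      x.2.foldl (fun y z => f.ev W ((x.1.1, y), z)) x.1.2
  | .prod (.prod _ _) .nat, _, .loop f, x =>
      (List.range x.2).foldl (fun y z => f.ev W ((x.1.1, y), z)) x.1.2

/-- The program makes no random draws. -/
def Prog.det : {a b : Ty} → Prog a b → Bool
  | _, _, .comp f g => f.det && g.det
  | _, _, .pair f g => f.det && g.det
  | _, _, .rand => false
  | _, _, .casesList f g => f.det && g.det
  | _, _, .ite t f g => t.det && f.det && g.det
  | _, _, .fold f => f.det
  | _, _, .loop f => f.det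
  | _, _, _ => true

theorem val_of_mem_support_iterate {s : Ty} {η : Type} {f : s.Val → η → PMF (Outcome s.Val)}
    {F : s.Val → η → s.Val} (h : ∀ y z, ∀ o ∈ (f y z).support, o.val = F y z) :
    ∀ (l : List η) (x : s.Val), ∀ o ∈ (iterate s f l x).support, o.val = l.foldl F x
  | [], x, o, ho => by
      simp only [iterate, PMF.support_pure, Set.mem_singleton_iff] at ho
      simp [ho]
  | z :: l, x, o, ho => by
      simp only [iterate, PMF.mem_support_bind_iff, PMF.support_pure,
        Set.mem_singleton_iff] at ho
      obtain ⟨o₁, h₁, o₂, h₂, rfl⟩ := ho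
      have e := val_of_mem_support_iterate h l _ o₂ h₂
      simp only [List.foldl_cons, e, h _ _ _ h₁]

/-- Without draws every outcome in the support carries the same value. All programs except those
that contain `drawP` can therefore be studied as plain functions, and probability enters in one
place only. -/
theorem Prog.val_eq_ev (W : ℕ) : ∀ {a b : Ty} (f : Prog a b), f.det = true → ∀ x,
    ∀ o ∈ (f.run W x).support, o.val = f.ev W x := by
  intro a b f
  induction f with
  | id | fst | snd | const | one | add | sub | mul | div | le | leReal | nil | cons =>
      intro _ x o ho
      simp only [Prog.run, elementary, PMF.support_pure, Set.mem_singleton_iff] at ho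
      subst ho; simp [Prog.ev]
  | rand => intro h; simp [Prog.det] at h
  | comp f g hf hg =>
      intro h x o ho
      simp only [Prog.det, Bool.and_eq_true] at h
      simp only [Prog.run, PMF.mem_support_bind_iff, PMF.support_pure,
        Set.mem_singleton_iff] at ho
      obtain ⟨o₁, h₁, o₂, h₂, rfl⟩ := ho
      have := hg h.2 _ _ h₂
      rw [hf h.1 _ _ h₁] at this
      simpa [Prog.ev] using this
  | pair f g hf hg =>
      intro h x o ho
      simp only [Prog.det, Bool.and_eq_true] at h
      simp only [Prog.run, PMF.mem_support_bind_iff, PMF.support_pure,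
        Set.mem_singleton_iff] at ho
      obtain ⟨o₁, h₁, o₂, h₂, rfl⟩ := ho
      simp [Prog.ev, hf h.1 _ _ h₁, hg h.2 _ _ h₂]
  | casesList f g hf hg =>
      rintro h ⟨x, l⟩ o ho
      simp only [Prog.det, Bool.and_eq_true] at h
      cases l with
      | nil =>
        simp only [Prog.run, PMF.mem_support_map_iff] at ho
        obtain ⟨o₁, h₁, rfl⟩ := ho
        simpa [Prog.ev] using hf h.1 _ _ h₁
      | cons y l =>
        simp only [Prog.run, PMF.mem_support_map_iff] at ho
        obtain ⟨o₁, h₁, rfl⟩ := ho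
        simpa [Prog.ev] using hg h.2 _ _ h₁
  | ite t f g ht hf hg =>
      intro h x o ho
      simp only [Prog.det, Bool.and_eq_true] at h
      simp only [Prog.run, PMF.mem_support_bind_iff, PMF.support_pure,
        Set.mem_singleton_iff] at ho
      obtain ⟨o₁, h₁, o₂, h₂, rfl⟩ := ho
      rw [ht h.1.1 _ _ h₁] at h₂
      by_cases h0 : t.ev W x ≠ 0
      · rw [if_pos h0] at h₂
        simpa [Prog.ev, select, h0] using hf h.1.2 _ _ h₂
      · rw [if_neg h0] at h₂
        simp only [Prog.ev, select, if_pos (not_not.1 h0)]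
        exact hg h.2 _ _ h₂
  | fold f hf =>
      intro h x o ho
      simp only [Prog.run, PMF.mem_support_map_iff] at ho
      obtain ⟨o₁, h₁, rfl⟩ := ho
      simp only [Prog.ev]
      exact val_of_mem_support_iterate (F := fun y z => f.ev W ((x.1.1, y), z))
        (fun y z => hf h _) _ _ _ h₁
  | loop f hf =>
      intro h x o ho
      simp only [Prog.run, PMF.mem_support_map_iff] at ho
      obtain ⟨o₁, h₁, rfl⟩ := ho
      simp only [Prog.ev]
      exact val_of_mem_support_iterate (F := fun y z => f.ev W ((x.1.1, y), z))
        (fun y z => hf h _) _ _ _ h₁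

theorem PMF.map_eq_pure {α β : Type*} (p : PMF α) (f : α → β) (b : β)
    (h : ∀ x ∈ p.support, f x = b) : p.map f = PMF.pure b := by
  have : p.map f = p.bind fun _ => PMF.pure b := by
    ext c
    rw [PMF.map, PMF.bind_apply, PMF.bind_apply]
    refine tsum_congr fun x => ?_
    by_cases hx : p x = 0
    · simp [hx]
    · rw [Function.comp, h x ((PMF.mem_support_iff _ _).2 hx)]
  rw [this, PMF.bind_const]

/-- The distribution of the result of a program. -/
noncomputable def Prog.vals (W : ℕ) {a b : Ty} (f : Prog a b) (x : a.Val) : PMF b.Val :=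
  (f.run W x).map Outcome.val

theorem Prog.vals_det (W : ℕ) {a b : Ty} (f : Prog a b) (h : f.det = true) (x : a.Val) :
    f.vals W x = PMF.pure (f.ev W x) :=
  PMF.map_eq_pure _ _ _ fun o ho => f.val_eq_ev W h x o ho

theorem Prog.vals_comp (W : ℕ) {a b c : Ty} (f : Prog a b) (g : Prog b c) (x : a.Val) :
    (f.comp g).vals W x = (f.vals W x).bind (g.vals W) := by
  simp only [Prog.vals, Prog.run, PMF.map_bind, PMF.bind_map, PMF.pure_map]
  rfl

theorem Prog.vals_pair (W : ℕ) {a b c : Ty} (f : Prog a b) (g : Prog a c) (x : a.Val) :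
    (f.pair g).vals W x = (f.vals W x).bind fun y => (g.vals W x).map fun z => (y, z) := by
  simp only [Prog.vals, Prog.run, PMF.map_bind, PMF.bind_map, PMF.pure_map, PMF.map_comp,
    Function.comp_def]
  rfl

theorem Prog.vals_ite (W : ℕ) {a b : Ty} (t : Prog a .nat) (f g : Prog a b) (x : a.Val)
    (ht : t.det = true) :
    (t.ite f g).vals W x = if t.ev W x ≠ 0 then f.vals W x else g.vals W x := by
  have : (t.ite f g).vals W x =
      (t.vals W x).bind fun y => if y ≠ 0 then f.vals W x else g.vals W x := by
    simp only [Prog.vals, Prog.run, PMF.map_bind, PMF.bind_map, PMF.pure_map]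
    congr 1
    funext o
    by_cases h : o.val = 0
    · simp [h, PMF.map]; rfl
    · simp [h, PMF.map]; rfl
  rw [this, Prog.vals_det W t ht, PMF.pure_bind]

theorem Prog.vals_det_comp (W : ℕ) {a b c : Ty} (f : Prog a b) (g : Prog b c)
    (hg : g.det = true) (x : a.Val) :
    (f.comp g).vals W x = (f.vals W x).map (g.ev W) := by
  rw [Prog.vals_comp, PMF.map]
  congr 1
  funext y
  rw [Prog.vals_det W g hg]; rfl

/-! ### Cost bounds -/

/-- The result and the cost of an execution are bounded, the size and the space linearly in `B`. -/
def Outcome.Bounded (b : Ty) (c B V : ℕ) (o : Outcome b.Val) : Prop :=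
  b.words o.val ≤ c * B ∧ o.space ≤ c * B ∧ o.time ≤ c * (B + V) ^ c

theorem Outcome.Bounded.mono {b : Ty} {c c' B B' V V' : ℕ} {o : Outcome b.Val}
    (h : o.Bounded b c B V) (hc : c ≤ c') (hB : B ≤ B') (hV : V ≤ V') (h1 : 1 ≤ B) :
    o.Bounded b c' B' V' := by
  refine ⟨h.1.trans (Nat.mul_le_mul hc hB), h.2.1.trans (Nat.mul_le_mul hc hB),
    h.2.2.trans (Nat.mul_le_mul hc ?_)⟩
  exact (Nat.pow_le_pow_left (by omega) _).trans (Nat.pow_le_pow_right (by omega) hc)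

/-- In every execution on an input of size at most `B` that satisfies the precondition, the program
needs space linear in `B` and time polynomial in `B + V`. -/
def LinOn {a b : Ty} (P : ℕ → ℕ → ℕ → a.Val → Prop) (f : Prog a b) : Prop :=
  ∃ c, ∀ W B V x, a.words x ≤ B → P W B V x → ∀ o ∈ (f.run W x).support, o.Bounded b c B V

/-- Space linear and time polynomial in the input size. -/
class Lin {a b : Ty} (f : Prog a b) : Prop where
  out : LinOn (fun _ _ _ _ => True) f

theorem LinOn.weaken {a b : Ty} {P Q : ℕ → ℕ → ℕ → a.Val → Prop} {f : Prog a b}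
    (h : LinOn P f) (hQ : ∀ W B V x, Q W B V x → P W B V x) : LinOn Q f := by
  obtain ⟨c, hc⟩ := h
  exact ⟨c, fun W B V x hx hq => hc W B V x hx (hQ _ _ _ _ hq)⟩

theorem Lin.of_elementary {a b : Ty} {f : Prog a b} (c : ℕ)
    (h : ∀ W x, ∀ o ∈ (f.run W x).support, ∃ y, o = ⟨y, a.words x + b.words y, a.words x + b.words y⟩ ∧
      b.words y ≤ c * a.words x) : Lin f := by
  refine ⟨c + 1, fun W B V x hx _ o ho => ?_⟩
  obtain ⟨y, rfl, hy⟩ := h W x o ho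
  have h1 := Ty.one_le_words a x
  have h2 : c * a.words x ≤ c * B := Nat.mul_le_mul_left _ hx
  have h3 : B + V ≤ (B + V) ^ (c + 1) := Nat.le_self_pow (by omega) _
  have h4 : (c + 1) * B ≤ (c + 1) * (B + V) ^ (c + 1) := Nat.mul_le_mul_left _ (by omega)
  refine ⟨?_, ?_, ?_⟩ <;> simp only <;> nlinarith

/-! ### Costs of the elementary operations -/

section elementary
variable {a b : Ty}

theorem mem_elementary {x : a.Val} {y : b.Val} {o : Outcome b.Val} :
    o ∈ (elementary a b x y).support ↔ o = ⟨y, a.words x + b.words y, a.words x + b.words y⟩ := by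
  simp [elementary]

instance : Lin (Prog.id : Prog a a) := .of_elementary 1 fun W x o ho =>
  ⟨_, mem_elementary.1 ho, by simp⟩
instance : Lin (Prog.fst : Prog (.prod a b) a) := .of_elementary 1 fun W x o ho =>
  ⟨_, mem_elementary.1 ho, by simp [Ty.words]⟩
instance : Lin (Prog.snd : Prog (.prod a b) b) := .of_elementary 1 fun W x o ho =>
  ⟨_, mem_elementary.1 ho, by simp [Ty.words]⟩
instance (k : ℕ) : Lin (Prog.const k : Prog a .nat) := .of_elementary 1 fun W x o ho =>
  ⟨_, mem_elementary.1 ho, by have := Ty.one_le_words a x; simp [Ty.words]; omega⟩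
instance : Lin (Prog.one : Prog a .real) := .of_elementary 1 fun W x o ho =>
  ⟨_, mem_elementary.1 ho, by have := Ty.one_le_words a x; simp [Ty.words]; omega⟩
instance : Lin Prog.add := .of_elementary 1 fun W x o ho =>
  ⟨_, mem_elementary.1 ho, by simp [Ty.words]⟩
instance : Lin Prog.sub := .of_elementary 1 fun W x o ho =>
  ⟨_, mem_elementary.1 ho, by simp [Ty.words]⟩
instance : Lin Prog.mul := .of_elementary 1 fun W x o ho =>
  ⟨_, mem_elementary.1 ho, by simp [Ty.words]⟩
instance : Lin Prog.div := .of_elementary 1 fun W x o ho =>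
  ⟨_, mem_elementary.1 ho, by simp [Ty.words]⟩
instance : Lin Prog.le := .of_elementary 1 fun W x o ho =>
  ⟨_, mem_elementary.1 ho, by simp [Ty.words]⟩
instance : Lin Prog.leReal := .of_elementary 1 fun W x o ho =>
  ⟨_, mem_elementary.1 ho, by simp [Ty.words]⟩
instance : Lin Prog.rand := .of_elementary 1 fun W x o ho => by
  simp only [Prog.run, PMF.mem_support_bind_iff] at ho
  obtain ⟨y, -, hy⟩ := ho
  exact ⟨_, mem_elementary.1 hy, by simp [Ty.words]⟩
instance : Lin (Prog.nil : Prog a (.list b)) := .of_elementary 1 fun W x o ho =>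
  ⟨_, mem_elementary.1 ho, by have := Ty.one_le_words a x; simp [Ty.words]; omega⟩
instance : Lin (Prog.cons : Prog (.prod b (.list b)) (.list b)) :=
  .of_elementary 1 fun W x o ho => ⟨_, mem_elementary.1 ho, by simp [Ty.words]; omega⟩

end elementary

/-- The second program receives an input that may be larger than `B` by a constant factor. Its
precondition must therefore survive an increase of `B`, which is what `hQ` provides. -/
theorem LinOn.comp {a b c : Ty} {P : ℕ → ℕ → ℕ → a.Val → Prop} {Q : ℕ → ℕ → ℕ → b.Val → Prop}
    {f : Prog a b} {g : Prog b c} (hf : LinOn P f) (hg : LinOn Q g)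
    (hQ : ∀ W B B' V y, B ≤ B' → Q W B V y → Q W B' V y) :
    LinOn (fun W B V x => P W B V x ∧ ∀ o ∈ (f.run W x).support, Q W B V o.val) (f.comp g) := by
  obtain ⟨c₁, h₁⟩ := hf
  obtain ⟨c₂, h₂⟩ := hg
  -- The intermediate value has size at most `(c₁ + 1) B`. The constant has to dominate the factor
  -- `c₂ (c₁ + 1)` for the space and `c₂ (c₁ + 1) ^ c₂` for the time.
  set C := (c₁ + 1) * (c₂ + 1) ^ 1 + c₂ * (c₁ + 1) ^ c₂ + c₁ + c₂ + 1 with hC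
  refine ⟨C, fun W B V x hx ⟨hP, hq⟩ o ho => ?_⟩
  have hB : 1 ≤ B := (Ty.one_le_words a x).trans hx
  simp only [Prog.run, PMF.mem_support_bind_iff, PMF.support_pure, Set.mem_singleton_iff] at ho
  obtain ⟨o₁, ho₁, o₂, ho₂, rfl⟩ := ho
  have e₁ := h₁ W B V x hx hP o₁ ho₁
  have hBB : B ≤ (c₁ + 1) * B := by nlinarith
  have e₂ := h₂ W ((c₁ + 1) * B) V o₁.val (e₁.1.trans (by nlinarith))
    (hQ _ _ _ _ _ hBB (hq o₁ ho₁)) o₂ ho₂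
  obtain ⟨a1, a2, a3⟩ := e₁
  obtain ⟨b1, b2, b3⟩ := e₂
  have hp : 0 ≤ c₂ * (c₁ + 1) ^ c₂ := Nat.zero_le _
  have k1 : c₁ ≤ C := by nlinarith
  have k2 : c₂ * (c₁ + 1) ≤ C := by nlinarith
  have k3 : c₂ * ((c₁ + 1) * B) ≤ C * B := by
    rw [← mul_assoc]; exact Nat.mul_le_mul_right _ k2
  have k4 : c₁ * B ≤ C * B := Nat.mul_le_mul_right _ k1
  have k5 : (B + V) ^ c₁ ≤ (B + V) ^ C := Nat.pow_le_pow_right (by omega) k1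
  have k6 : ((c₁ + 1) * B + V) ^ c₂ ≤ (c₁ + 1) ^ c₂ * (B + V) ^ C := by
    calc ((c₁ + 1) * B + V) ^ c₂ ≤ ((c₁ + 1) * (B + V)) ^ c₂ :=
          Nat.pow_le_pow_left (by nlinarith) _
      _ = (c₁ + 1) ^ c₂ * (B + V) ^ c₂ := mul_pow _ _ _
      _ ≤ _ := Nat.mul_le_mul_left _ (Nat.pow_le_pow_right (by omega) (by nlinarith))
  refine ⟨b1.trans k3, ?_, ?_⟩
  · exact max_le (a2.trans k4) (b2.trans k3)
  · have : o₁.time + o₂.time ≤ (c₁ + c₂ * (c₁ + 1) ^ c₂) * (B + V) ^ C := by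
      have := Nat.mul_le_mul_left c₁ k5
      have := Nat.mul_le_mul_left c₂ k6
      nlinarith
    exact this.trans (Nat.mul_le_mul_right _ (by nlinarith))

theorem LinOn.pair {a b c : Ty} {P Q : ℕ → ℕ → ℕ → a.Val → Prop}
    {f : Prog a b} {g : Prog a c} (hf : LinOn P f) (hg : LinOn Q g) :
    LinOn (fun W B V x => P W B V x ∧ Q W B V x) (f.pair g) := by
  obtain ⟨c₁, h₁⟩ := hf
  obtain ⟨c₂, h₂⟩ := hg
  refine ⟨c₁ + c₂ + 1, fun W B V x hx ⟨hP, hq⟩ o ho => ?_⟩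
  have hB : 1 ≤ B := (Ty.one_le_words a x).trans hx
  simp only [Prog.run, PMF.mem_support_bind_iff, PMF.support_pure, Set.mem_singleton_iff] at ho
  obtain ⟨o₁, ho₁, o₂, ho₂, rfl⟩ := ho
  obtain ⟨a1, a2, a3⟩ := h₁ W B V x hx hP o₁ ho₁
  obtain ⟨b1, b2, b3⟩ := h₂ W B V x hx hq o₂ ho₂
  have k5 : (B + V) ^ c₁ ≤ (B + V) ^ (c₁ + c₂ + 1) := Nat.pow_le_pow_right (by omega) (by omega)
  have k6 : (B + V) ^ c₂ ≤ (B + V) ^ (c₁ + c₂ + 1) := Nat.pow_le_pow_right (by omega) (by omega)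
  refine ⟨?_, ?_, ?_⟩
  · simp only [Ty.words]; nlinarith
  · exact max_le (by nlinarith) (by nlinarith)
  · simp only
    have := Nat.mul_le_mul_left c₁ k5
    have := Nat.mul_le_mul_left c₂ k6
    generalize (B + V) ^ (c₁ + c₂ + 1) = Z at *
    nlinarith

theorem LinOn.ite {a b : Ty} {P Q R : ℕ → ℕ → ℕ → a.Val → Prop} {t : Prog a .nat}
    {f g : Prog a b} (ht : LinOn P t) (hf : LinOn Q f) (hg : LinOn R g) :
    LinOn (fun W B V x => P W B V x ∧ ∀ o ∈ (t.run W x).support,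
      (o.val ≠ 0 → Q W B V x) ∧ (o.val = 0 → R W B V x)) (t.ite f g) := by
  obtain ⟨c₀, h₀⟩ := ht
  obtain ⟨c₁, h₁⟩ := hf
  obtain ⟨c₂, h₂⟩ := hg
  refine ⟨c₀ + c₁ + c₂ + 1, fun W B V x hx ⟨hP, hq⟩ o ho => ?_⟩
  have hB : 1 ≤ B := (Ty.one_le_words a x).trans hx
  simp only [Prog.run, PMF.mem_support_bind_iff, PMF.support_pure, Set.mem_singleton_iff] at ho
  obtain ⟨o₁, ho₁, o₂, ho₂, rfl⟩ := ho
  obtain ⟨a1, a2, a3⟩ := h₀ W B V x hx hP o₁ ho₁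
  have key : o₂.Bounded b (c₁ + c₂) B V := by
    by_cases h : o₁.val = 0
    · simp only [h, ne_eq, not_true_eq_false, if_false] at ho₂
      exact (h₂ W B V x hx ((hq _ ho₁).2 h) o₂ ho₂).mono (by omega) le_rfl le_rfl hB
    · simp only [ne_eq, h, not_false_eq_true, if_true] at ho₂
      exact (h₁ W B V x hx ((hq _ ho₁).1 h) o₂ ho₂).mono (by omega) le_rfl le_rfl hB
  obtain ⟨b1, b2, b3⟩ := key
  have k5 : (B + V) ^ c₀ ≤ (B + V) ^ (c₀ + c₁ + c₂ + 1) :=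
    Nat.pow_le_pow_right (by omega) (by omega)
  have k6 : (B + V) ^ (c₁ + c₂) ≤ (B + V) ^ (c₀ + c₁ + c₂ + 1) :=
    Nat.pow_le_pow_right (by omega) (by omega)
  refine ⟨?_, ?_, ?_⟩
  · simp only; nlinarith
  · exact max_le (by nlinarith) (by nlinarith)
  · simp only
    have := Nat.mul_le_mul_left c₀ k5
    have := Nat.mul_le_mul_left (c₁ + c₂) k6
    generalize (B + V) ^ (c₀ + c₁ + c₂ + 1) = Z at *
    nlinarith

instance Lin.comp {a b c : Ty} (f : Prog a b) (g : Prog b c) [hf : Lin f] [hg : Lin g] :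
    Lin (f.comp g) :=
  ⟨(hf.out.comp hg.out (by simp)).weaken (by simp)⟩

instance Lin.pair {a b c : Ty} (f : Prog a b) (g : Prog a c) [hf : Lin f] [hg : Lin g] :
    Lin (f.pair g) :=
  ⟨(hf.out.pair hg.out).weaken (by simp)⟩

instance Lin.ite {a b : Ty} (t : Prog a .nat) (f g : Prog a b) [ht : Lin t] [hf : Lin f]
    [hg : Lin g] : Lin (t.ite f g) :=
  ⟨(ht.out.ite hf.out hg.out).weaken (by simp)⟩

instance Lin.casesList {a b h : Ty} (f : Prog a b) (g : Prog (.prod a (.prod h (.list h))) b)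
    [hf : Lin f] [hg : Lin g] : Lin (Prog.casesList f g) := by
  obtain ⟨c₁, h₁⟩ := hf.out
  obtain ⟨c₂, h₂⟩ := hg.out
  refine ⟨c₁ + c₂ + 1, fun W B V ⟨x, l⟩ hx _ o ho => ?_⟩
  have hB : 1 ≤ B := (Ty.one_le_words _ _).trans hx
  have key : ∃ o' : Outcome b.Val, o = ⟨o'.val, o'.time + 1, o'.space + 1⟩ ∧
      o'.Bounded b (c₁ + c₂) B V := by
    cases l with
    | nil =>
      simp only [Prog.run, PMF.mem_support_map_iff] at ho
      obtain ⟨o₁, h, rfl⟩ := ho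
      refine ⟨o₁, rfl, (h₁ W B V x ?_ trivial o₁ h).mono (by omega) le_rfl le_rfl hB⟩
      simp only [Ty.words] at hx; omega
    | cons y l =>
      simp only [Prog.run, PMF.mem_support_map_iff] at ho
      obtain ⟨o₁, h, rfl⟩ := ho
      refine ⟨o₁, rfl, (h₂ W B V _ ?_ trivial o₁ h).mono (by omega) le_rfl le_rfl hB⟩
      simp only [Ty.words, List.map_cons, List.sum_cons] at hx ⊢; omega
  obtain ⟨o', rfl, a1, a2, a3⟩ := key
  have k5 : (B + V) ^ (c₁ + c₂) ≤ (B + V) ^ (c₁ + c₂ + 1) :=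
    Nat.pow_le_pow_right (by omega) (by omega)
  have k6 : 1 ≤ (B + V) ^ (c₁ + c₂ + 1) := Nat.one_le_pow _ _ (by omega)
  refine ⟨?_, ?_, ?_⟩ <;> simp only
  · nlinarith
  · nlinarith
  · have := Nat.mul_le_mul_left (c₁ + c₂) k5
    generalize (B + V) ^ (c₁ + c₂ + 1) = Z at *
    nlinarith

/-- The current size plus the growth still to come, `g` summed over the remaining entries, never
exceeds `S`. So the step has to be controlled only on states of size at most `S`. -/
theorem iterate_bound {s : Ty} {η : Type} (f : s.Val → η → PMF (Outcome s.Val)) (g : η → ℕ)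
    (S A t : ℕ) : ∀ (l : List η) (x : s.Val), s.words x + (l.map g).sum ≤ S →
    (∀ y, s.words y ≤ S → ∀ h ∈ l, ∀ o ∈ (f y h).support,
      s.words o.val ≤ s.words y + g h ∧ o.space ≤ A ∧ o.time ≤ t) →
    ∀ o ∈ (iterate s f l x).support,
      s.words o.val ≤ s.words x + (l.map g).sum ∧ o.space ≤ max S A ∧ o.time ≤ S + l.length * t
  | [], x, hS, _, o, ho => by
      simp only [iterate, PMF.support_pure, Set.mem_singleton_iff] at ho
      subst ho
      simp at hS ⊢; omega
  | h :: l, x, hS, hf, o, ho => by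
      simp only [iterate, PMF.mem_support_bind_iff, PMF.support_pure,
        Set.mem_singleton_iff] at ho
      obtain ⟨o₁, h₁, o₂, h₂, rfl⟩ := ho
      simp only [List.map_cons, List.sum_cons, List.length_cons] at hS ⊢
      obtain ⟨a1, a2, a3⟩ := hf x (by omega) h (by simp) o₁ h₁
      obtain ⟨b1, b2, b3⟩ := iterate_bound f g S A t l o₁.val (by omega)
        (fun y hy z hz => hf y hy z (by simp [hz])) o₂ h₂
      refine ⟨by omega, max_le (a2.trans (le_max_right _ _)) b2, ?_⟩
      simp only [add_mul, one_mul]; omega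

theorem length_le_words_list {a : Ty} (l : List a.Val) : l.length ≤ (l.map a.words).sum := by
  induction l with
  | nil => simp
  | cons x l ih => have := Ty.one_le_words a x; simp; omega

/-- The growth is charged to the entries of the list, which are part of the input: the state stays
below `(k + 1) B`, and the input of the body below `(k + 3) B`. The number of steps is at most `B`
because each entry occupies a word. -/
theorem Lin.fold {e s h : Ty} {f : Prog (.prod (.prod e s) h) s} (hf : Lin f) (k : ℕ)
    (hk : ∀ W E y z, ∀ o ∈ (f.run W ((E, y), z)).support,
      s.words o.val ≤ s.words y + k * h.words z) : Lin (Prog.fold f) := by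
  obtain ⟨c, hc⟩ := hf.out
  set C := (k + 3) * (c + 3) * (k + 3) ^ c + 2 * k + 4 + c with hC
  refine ⟨C, fun W B V x hx _ o ho => ?_⟩
  have hB : 1 ≤ B := (Ty.one_le_words _ _).trans hx
  simp only [Prog.run, PMF.mem_support_map_iff] at ho
  obtain ⟨o₁, h₁, rfl⟩ := ho
  simp only [Ty.words] at hx
  have hlen := length_le_words_list (a := h) x.2
  have hsum : ∀ l : List h.Val,
      (l.map fun z => k * h.words z).sum = k * (l.map h.words).sum := fun l => by
    rw [List.sum_map_mul_left]
  have hkl : k * (x.2.map h.words).sum ≤ k * B := Nat.mul_le_mul_left _ (by omega)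
  obtain ⟨a1, a2, a3⟩ := iterate_bound (fun y z => f.run W ((x.1.1, y), z))
    (fun z => k * h.words z) ((k + 1) * B) (c * ((k + 3) * B)) (c * ((k + 3) * B + V) ^ c)
    x.2 x.1.2 (by rw [hsum]; nlinarith) (fun y hy z hz o ho => by
      have hzw : h.words z ≤ (x.2.map h.words).sum :=
        List.single_le_sum (by simp) _ (List.mem_map_of_mem hz)
      obtain ⟨b1, b2, b3⟩ := hc W ((k + 3) * B) V ((x.1.1, y), z)
        (by simp only [Ty.words]; nlinarith) trivial o ho
      exact ⟨hk W _ _ _ o ho, b2, b3⟩) o₁ h₁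
  rw [hsum] at a1
  have hkc : 1 ≤ (k + 3) ^ c := Nat.one_le_pow _ _ (by omega)
  have hC1 : (k + 3) * (c + 3) + 2 * k + 4 + c ≤ C := by
    have : (k + 3) * (c + 3) * 1 ≤ (k + 3) * (c + 3) * (k + 3) ^ c := Nat.mul_le_mul_left _ hkc
    omega
  refine ⟨?_, ?_, ?_⟩
  · simp only
    calc s.words o₁.val ≤ (k + 1) * B := by nlinarith
      _ ≤ C * B := Nat.mul_le_mul_right _ (by nlinarith)
  · simp only [Ty.words]
    have h2 : o₁.space ≤ (k + 1) * B + c * ((k + 3) * B) := a2.trans (max_le (by omega) (by omega))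
    have h3 := Nat.mul_le_mul_right B hC1
    nlinarith
  · simp only [Ty.words]
    have h4 : ((k + 3) * B + V) ^ c ≤ (k + 3) ^ c * (B + V) ^ c := by
      rw [← mul_pow]; exact Nat.pow_le_pow_left (by nlinarith) _
    have h5 : x.2.length * (c * ((k + 3) * B + V) ^ c) ≤ (B + V) * (c * ((k + 3) ^ c * (B + V) ^ c)) :=
      Nat.mul_le_mul (by omega) (Nat.mul_le_mul_left _ h4)
    have h6 : (B + V) ^ (c + 1) ≤ (B + V) ^ C := Nat.pow_le_pow_right (by omega) (by nlinarith)
    have h7 : B ≤ (B + V) ^ C := (Nat.le_add_right _ _).trans (Nat.le_self_pow (by omega) _)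
    have h8 : (B + V) * (c * ((k + 3) ^ c * (B + V) ^ c)) ≤ c * (k + 3) ^ c * (B + V) ^ C := by
      calc _ = c * (k + 3) ^ c * (B + V) ^ (c + 1) := by ring
        _ ≤ _ := Nat.mul_le_mul_left _ h6
    have h9 : c * (k + 3) ^ c + (k + 2) ≤ C := by
      have : c * (k + 3) ^ c ≤ (k + 3) * (c + 3) * (k + 3) ^ c :=
        Nat.mul_le_mul_right _ (by nlinarith)
      omega
    have h10 := Nat.mul_le_mul_right ((B + V) ^ C) h9
    have h11 : (k + 2) * B ≤ (k + 2) * (B + V) ^ C := Nat.mul_le_mul_left _ h7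
    nlinarith

/-- Here the number of iterations is a value, stored in a single word, so the input size controls
neither the time nor the growth. This is the reason for the second parameter `V` and for the
condition that the whole growth is at most `B`. -/
theorem LinOn.loop {e s : Ty} {f : Prog (.prod (.prod e s) .nat) s} (hf : Lin f) (G : e.Val → ℕ)
    (hk : ∀ W E y i, ∀ o ∈ (f.run W ((E, y), i)).support, s.words o.val ≤ s.words y + G E) :
    LinOn (fun _ B V (x : (Ty.prod (.prod e s) .nat).Val) => x.2 ≤ V ∧ x.2 * G x.1.1 ≤ B)
      (Prog.loop f) := by
  obtain ⟨c, hc⟩ := hf.out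
  set C := c * 4 ^ c + 4 * c + 8 with hC
  refine ⟨C, fun W B V ⟨⟨E, y₀⟩, n⟩ hx ⟨hV, hG⟩ o ho => ?_⟩
  change ℕ at n
  change n ≤ V at hV
  change n * G E ≤ B at hG
  have hB : 1 ≤ B := (Ty.one_le_words _ _).trans hx
  simp only [Prog.run, PMF.mem_support_map_iff] at ho
  obtain ⟨o₁, h₁, rfl⟩ := ho
  simp only [Ty.words] at hx
  have hsum : ((List.range n).map fun _ => G E).sum = n * G E := by simp
  obtain ⟨a1, a2, a3⟩ := iterate_bound (fun y z => f.run W ((E, y), z))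
    (fun _ => G E) (2 * B) (c * (4 * B)) (c * (4 * B + V) ^ c)
    (List.range n) y₀ (by rw [hsum]; omega) (fun y hy z hz o ho => by
      obtain ⟨b1, b2, b3⟩ := hc W (4 * B) V ((E, y), z)
        (by simp only [Ty.words]; omega) trivial o ho
      exact ⟨hk W _ _ _ o ho, b2, b3⟩) o₁ h₁
  rw [hsum] at a1
  rw [List.length_range] at a3
  have hC1 : 4 * c + 8 ≤ C := by omega
  have h3 := Nat.mul_le_mul_right B hC1
  refine ⟨?_, ?_, ?_⟩
  · simp only; nlinarith
  · simp only [Ty.words]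
    have h2 : o₁.space ≤ 2 * B + c * (4 * B) := a2.trans (max_le (by omega) (by omega))
    nlinarith
  · simp only [Ty.words]
    have h4 : (4 * B + V) ^ c ≤ 4 ^ c * (B + V) ^ c := by
      rw [← mul_pow]; exact Nat.pow_le_pow_left (by omega) _
    have h5 : n * (c * (4 * B + V) ^ c) ≤ (B + V) * (c * (4 ^ c * (B + V) ^ c)) :=
      Nat.mul_le_mul (by omega) (Nat.mul_le_mul_left _ h4)
    have h6 : (B + V) ^ (c + 1) ≤ (B + V) ^ C := Nat.pow_le_pow_right (by omega) (by omega)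
    have h7 : B ≤ (B + V) ^ C := (Nat.le_add_right _ _).trans (Nat.le_self_pow (by omega) _)
    have h8 : (B + V) * (c * (4 ^ c * (B + V) ^ c)) ≤ c * 4 ^ c * (B + V) ^ C := by
      calc _ = c * 4 ^ c * (B + V) ^ (c + 1) := by ring
        _ ≤ _ := Nat.mul_le_mul_left _ h6
    have h9 : c * 4 ^ c + 3 ≤ C := by omega
    have h10 := Nat.mul_le_mul_right ((B + V) ^ C) h9
    nlinarith

/-- Growth of the state in a fold, for deterministic programs. -/
theorem Lin.fold_det {e s h : Ty} {f : Prog (.prod (.prod e s) h) s} (hf : Lin f)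
    (hd : f.det = true) (k : ℕ)
    (hk : ∀ W E y z, s.words (f.ev W ((E, y), z)) ≤ s.words y + k * h.words z) :
    Lin (Prog.fold f) :=
  hf.fold k fun W E y z o ho => by rw [f.val_eq_ev W hd _ o ho]; exact hk W E y z

theorem LinOn.loop_det {e s : Ty} {f : Prog (.prod (.prod e s) .nat) s} (hf : Lin f)
    (hd : f.det = true) (G : e.Val → ℕ)
    (hk : ∀ W E y i, s.words (f.ev W ((E, y), i)) ≤ s.words y + G E) :
    LinOn (fun _ B V (x : (Ty.prod (.prod e s) .nat).Val) => x.2 ≤ V ∧ x.2 * G x.1.1 ≤ B)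
      (Prog.loop f) :=
  LinOn.loop hf G fun W E y z o ho => by rw [f.val_eq_ev W hd _ o ho]; exact hk W E y z

set_option synthInstance.maxHeartbeats 400000
set_option synthInstance.maxSize 1000

/-! ### Programs -/

namespace Prog

variable {Γ a b c : Ty}

/-- Evaluate `f` in the context and append the result to the context. -/
abbrev lett (f : Prog Γ a) (g : Prog (.prod Γ a) b) : Prog Γ b := (Prog.id.pair f).comp g

abbrev addOf (f g : Prog Γ .nat) : Prog Γ .nat := (f.pair g).comp .add
abbrev subOf (f g : Prog Γ .nat) : Prog Γ .nat := (f.pair g).comp .sub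
abbrev mulOf (f g : Prog Γ .nat) : Prog Γ .nat := (f.pair g).comp .mul
abbrev divOf (f g : Prog Γ .nat) : Prog Γ .nat := (f.pair g).comp .div
abbrev leOf (f g : Prog Γ .nat) : Prog Γ .nat := (f.pair g).comp .le
abbrev consOf (f : Prog Γ a) (g : Prog Γ (.list a)) : Prog Γ (.list a) := (f.pair g).comp .cons

end Prog

/-- A number, a second number, a real number and a list of numbers. -/
abbrev Ty.cell : Ty := .prod .nat (.prod .nat (.prod .real (.list .nat)))

/-- Messages: a header and a list of cells. -/
abbrev Ty.msg : Ty := .prod Ty.cell (.list Ty.cell)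

/-- Sets: index, weight, elements. -/
abbrev Ty.wset : Ty := .prod .nat (.prod .real (.list .nat))

/-- Fixed data of a machine: its index, the arity of the tree, the depth of the tree, the sampling
threshold, the number `1 + ε` and the sets stored on the machine. -/
abbrev Ty.static : Ty :=
  .prod (.prod .nat (.prod .nat (.prod .nat .nat))) (.prod .real (.list Ty.wset))

/-- Data of a machine: the fixed data, a round counter and the current parameters. -/
abbrev Ty.mem : Ty := .prod Ty.static (.prod .nat Ty.cell)

open Prog

/-- On `(x, l)`: the test `x ∈ l`. -/
def memP : Prog (.prod .nat (.list .nat)) .nat :=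
  ((fst.pair (const 0)).pair snd).comp
    (fold (ite (leOf snd (fst.comp fst))
      (ite (leOf (fst.comp fst) snd) (const 1) (fst.comp snd)) (fst.comp snd)))

/-- On `(l, l')`: the entries of `l'` that are not in `l`, in reverse order. -/
def diffP : Prog (.prod (.list .nat) (.list .nat)) (.list .nat) :=
  ((fst.pair nil).pair snd).comp
    (fold (ite ((snd.pair (fst.comp fst)).comp memP) (fst.comp snd) (consOf snd (fst.comp snd))))

/-- The length of a list. -/
def lenP : Prog (.list .nat) .nat :=
  (((const 0 : Prog _ .nat).pair (const 0)).pair id).comp (fold (addOf (fst.comp snd) (const 1)))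

/-- The sum of the first components of a list of cells. -/
def totalP : Prog (.list .cell) .nat :=
  (((const 0 : Prog _ .nat).pair (const 0)).pair id).comp
    (fold (addOf (fst.comp snd) (snd.comp fst)))

/-- On `(l, l')`: the list `l'.reverse ++ l`. -/
def appendP : Prog (.prod (.list .nat) (.list .nat)) (.list .nat) :=
  (((const 0 : Prog _ .nat).pair fst).pair snd).comp (fold (consOf snd (fst.comp snd)))

/-- On `((s, l), z)`: put the cell `z` in front of `l` unless the total would exceed `3 s`. -/
def pushP : Prog (.prod (.prod .nat (.list .cell)) .cell) (.list .cell) :=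
  ite (leOf (addOf ((fst.comp snd).comp totalP) (snd.comp fst)) (mulOf (const 3) (fst.comp fst)))
    (consOf snd (fst.comp snd)) (fst.comp snd)

/-- On `((s, x), y)`: the union of the messages `x` and `y`. -/
def combineP : Prog (.prod (.prod .nat .msg) .msg) .msg :=
  lett
    (ite (((((fst.comp snd).comp (fst.comp fst)).pair
          (snd.comp (fst.comp (snd.comp (snd.comp fst))))).pair
        ((snd.comp (fst.comp fst)).pair
          (((fst.comp snd).comp (fst.comp (snd.comp (snd.comp fst)))).pair one))).comp leReal)
      snd (fst.comp snd))
    (((snd.comp (fst.comp fst)).pair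
        ((addOf ((fst.comp (fst.comp snd)).comp (fst.comp (snd.comp fst)))
            ((fst.comp snd).comp (fst.comp (snd.comp fst)))).pair
          ((snd.comp (fst.comp (snd.comp (snd.comp fst)))).pair nil))).pair
      ((((fst.comp (fst.comp fst)).pair ((fst.comp (fst.comp snd)).comp snd)).pair
        ((fst.comp snd).comp snd)).comp (fold pushP)))

/-- On `((1 + ε, p), (D, w))`: whether a set of weight `w` with `D` uncovered elements is active for
the parameters `p`. -/
def activeP : Prog (.prod (.prod .real .cell) (.prod .nat .real)) .nat :=
  ite (leOf (const 1) ((fst.comp snd).comp fst))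
    (((((fst.comp snd).comp fst).pair (snd.comp snd)).pair
      ((snd.comp fst).pair ((fst.comp fst).pair
        ((fst.comp snd).comp (snd.comp (snd.comp fst)))))).comp leReal)
    (const 0)

/-- The type of `(s, (1 + ε, p))`. -/
abbrev Ty.localEnv : Ty := .prod .nat (.prod .real .cell)

/-- On `((s, (1 + ε, p)), (r, S))`: the message that describes the set `S` with coin `r`. -/
def toMsgP : Prog (.prod .localEnv (.prod .nat .wset)) .msg :=
  lett (((fst.comp (snd.comp (snd.comp (snd.comp (snd.comp snd))))).pair
      (snd.comp (snd.comp (snd.comp snd)))).comp diffP) <|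
  lett (snd.comp lenP) <|
  lett ((((fst.comp fst).comp (fst.comp snd)).pair
      (snd.pair ((fst.comp fst).comp (snd.comp (snd.comp (snd.comp fst)))))).comp activeP) <|
  (((fst.comp snd).pair ((ite snd (fst.comp snd) (const 0)).pair
      (((fst.comp (fst.comp fst)).comp (snd.comp (snd.comp (snd.comp fst)))).pair nil))).pair
    (ite snd
      (ite (leOf (const 1)
          ((fst.comp (fst.comp fst)).comp (fst.comp (snd.comp (snd.comp (snd.comp fst))))))
        (ite (leOf ((fst.comp (fst.comp fst)).comp (fst.comp fst))
            ((fst.comp (fst.comp fst)).comp (snd.comp fst)))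
          nil
          (consOf ((fst.comp snd).pair
              (((fst.comp (fst.comp fst)).comp (snd.comp (snd.comp fst))).pair
              (((fst.comp (fst.comp fst)).comp (snd.comp (snd.comp (snd.comp fst)))).pair
              (fst.comp (fst.comp snd))))) nil))
        nil)
      nil))

/-- The message that describes nothing. -/
abbrev emptyP {Γ : Ty} : Prog Γ .msg :=
  ((const 0).pair ((const 0).pair (one.pair nil))).pair nil

/-- One step of `baseP`. -/
def baseStepP : Prog (.prod (.prod .localEnv .msg) (.prod .nat .wset)) .msg :=
  ((((fst.comp (fst.comp fst))).pair (fst.comp snd)).pair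
    (((fst.comp fst).pair snd).comp toMsgP)).comp combineP

/-- On `((s, (1 + ε, p)), l)`: the message that describes the list `l` of sets with coins. -/
def baseP : Prog (.prod .localEnv (.list (.prod .nat .wset))) .msg :=
  ((fst.pair emptyP).pair snd).comp (fold baseStepP)

/-- On `(k, l)`: attach to every entry of `l` a random element of `{0, …, k}`. -/
def drawP : Prog (.prod .nat (.list .wset)) (.list (.prod .nat .wset)) :=
  ((fst.pair nil).pair snd).comp
    (fold (consOf (((fst.comp fst).comp rand).pair snd) (fst.comp snd)))

/-- On `(s, l)`: the union of the messages in `l`. -/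
def gatherP : Prog (.prod .nat (.list .msg)) .msg :=
  ((fst.pair emptyP).pair snd).comp (fold combineP)

/-- One step of the greedy algorithm. -/
def pickStepP : Prog (.prod (.prod (.prod .real .cell) (.prod (.list .nat) (.list .nat))) .cell)
    (.prod (.list .nat) (.list .nat)) :=
  lett ((((fst.comp snd).comp fst).pair (snd.comp (snd.comp (snd.comp snd)))).comp diffP) <|
  lett (snd.comp lenP) <|
  ite ((((fst.comp fst).comp (fst.comp fst)).pair
      (snd.pair ((fst.comp fst).comp (snd.comp (snd.comp (snd.comp fst)))))).comp activeP)
    (((((fst.comp fst).comp ((fst.comp snd).comp fst)).pair (fst.comp snd)).comp appendP).pair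
      (consOf ((fst.comp fst).comp (snd.comp (snd.comp fst)))
        ((fst.comp fst).comp ((fst.comp snd).comp snd))))
    ((fst.comp fst).comp (fst.comp snd))

/-- The input of the step program. -/
abbrev Ty.stepIn : Ty := .prod (stateTy .mem) (.list .msg)

/-- The output of the step program. -/
abbrev Ty.stepOut : Ty := .prod (stateTy .mem) (.list (.prod .nat .msg))

namespace Prog

abbrev counter : Prog .stepIn .nat := fst.comp (snd.comp (snd.comp fst))
abbrev params : Prog .stepIn .cell := fst.comp (snd.comp (snd.comp snd))
abbrev index : Prog .stepIn .nat := fst.comp (snd.comp (fst.comp (fst.comp fst)))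
abbrev arity : Prog .stepIn .nat := fst.comp (snd.comp (fst.comp (fst.comp (snd.comp fst))))
abbrev depth : Prog .stepIn .nat :=
  fst.comp (snd.comp (fst.comp (fst.comp (snd.comp (snd.comp fst)))))
abbrev threshold : Prog .stepIn .nat :=
  fst.comp (snd.comp (fst.comp (fst.comp (snd.comp (snd.comp snd)))))
abbrev eps : Prog .stepIn .real := fst.comp (snd.comp (fst.comp (snd.comp fst)))
abbrev stored : Prog .stepIn (.list .wset) := fst.comp (snd.comp (fst.comp (snd.comp snd)))

/-- The state with the counter increased and new parameters. -/
abbrev nextState {Γ : Ty} (x : Prog Γ .stepIn) (p : Prog Γ .cell) : Prog Γ (stateTy .mem) :=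
  (x.comp (fst.comp fst)).pair
    ((x.comp (fst.comp (snd.comp fst))).pair ((addOf (x.comp counter) (const 1)).pair p))

end Prog

/-- The parameters received from the parent, if any, and the old parameters otherwise. -/
def recvP : Prog .stepIn .cell :=
  (params.pair snd).comp (casesList id (snd.comp (fst.comp fst)))

/-- On `((a, i), p)` and `k`: the message `p` for each of the machines `a * i, …, a * i + k - 1`. -/
def sendsP : Prog (.prod (.prod (.prod .nat .nat) .cell) .nat) (.list (.prod .nat .msg)) :=
  ((fst.pair nil).pair snd).comp
    (loop (consOf ((addOf (mulOf ((fst.comp fst).comp (fst.comp fst))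
      ((fst.comp fst).comp (fst.comp snd))) snd).pair
        (((fst.comp fst).comp snd).pair nil)) (fst.comp snd)))

/-- A round in which the parameters are passed on to the children. -/
def downP : Prog .stepIn .stepOut :=
  lett recvP ((nextState fst snd).pair
    (((((fst.comp arity).pair (fst.comp index)).pair snd).pair (fst.comp arity)).comp sendsP))

/-- The deterministic part of the round in which the stored sets are sampled. -/
def localP : Prog (.prod (.prod .stepIn .cell) (.list (.prod .nat .wset))) .stepOut :=
  lett ((((fst.comp (fst.comp threshold)).pair ((fst.comp (fst.comp eps)).pair
      (fst.comp snd))).pair snd).comp baseP)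
    ((nextState (fst.comp (fst.comp fst)) (fst.comp (fst.comp snd))).pair
      (consOf ((divOf ((fst.comp (fst.comp fst)).comp index)
        ((fst.comp (fst.comp fst)).comp arity)).pair snd) nil))

/-- The round in which the stored sets are sampled. -/
def sampleP : Prog .stepIn .stepOut :=
  lett recvP (lett
    (((subOf (snd.comp (snd.comp fst)) (const 1)).pair (fst.comp stored)).comp drawP) localP)

/-- A round in which messages are combined and passed on to the parent. -/
def upP : Prog .stepIn .stepOut :=
  lett ((threshold.pair snd).comp gatherP)
    ((nextState fst (fst.comp params)).pair
      (consOf ((divOf (fst.comp index) (fst.comp arity)).pair snd) nil))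

/-- The round in which the central machine updates the parameters. -/
def finishP : Prog .stepIn .stepOut :=
  lett ((threshold.pair snd).comp gatherP) <|
  lett (((((fst.comp eps).pair (fst.comp params)).pair
      ((fst.comp (params.comp (snd.comp (snd.comp snd)))).pair
        (fst.comp (fst.comp (fst.comp snd))))).pair (snd.comp snd)).comp (fold pickStepP)) <|
  lett (ite (leOf (const 1) ((fst.comp snd).comp (fst.comp (snd.comp fst))))
      ((fst.comp fst).comp params) ((fst.comp snd).comp fst)) <|
  (((leOf ((fst.comp (fst.comp snd)).comp (fst.comp fst)) (const 0)).pair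
      (fst.comp (snd.comp snd))).pair
    (((fst.comp (fst.comp fst)).comp (fst.comp (snd.comp fst))).pair
      ((const 0).pair
        ((snd.comp fst).pair
          ((subOf ((fst.comp (fst.comp snd)).comp (fst.comp (snd.comp fst)))
            ((fst.comp (fst.comp fst)).comp (params.comp (snd.comp fst)))).pair
          ((snd.comp (snd.comp (snd.comp fst))).pair (fst.comp (snd.comp fst)))))))).pair nil

/-- The program of a round. -/
def stepP : Prog .stepIn .stepOut :=
  ite (leOf (addOf counter (const 1)) depth) downP
    (ite (leOf counter depth) sampleP
      (ite (leOf (addOf counter (const 1)) (addOf depth depth)) upP finishP))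

/-- One step of `rootP`. -/
def rootStepP : Prog (.prod (.prod .nat .nat) .nat) .nat :=
  lett (addOf (fst.comp snd) (const 1)) <|
  lett (mulOf snd snd) <|
  ite (leOf (mulOf snd snd) (fst.comp (fst.comp (fst.comp fst)))) (fst.comp snd)
    (fst.comp (fst.comp (fst.comp snd)))

/-- On `(d, k)`: the integral part of the fourth root of `d`, by a search of length `k`. -/
def rootP : Prog (.prod .nat .nat) .nat :=
  ((fst.pair (const 0)).pair snd).comp (loop rootStepP)

/-- One step of `clogP`. -/
def clogStepP : Prog (.prod (.prod (.prod .nat .nat) (.prod .nat .nat)) .nat) (.prod .nat .nat) :=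
  ite (leOf (fst.comp (fst.comp snd)) (fst.comp (snd.comp fst))) (fst.comp snd)
    ((mulOf (fst.comp (snd.comp fst)) (fst.comp (fst.comp fst))).pair
      (addOf (fst.comp (snd.comp snd)) (const 1)))

/-- On `((a, M), k)`: the logarithm of `M` to the base `a`, rounded up, by a search of length `k`. -/
def clogP : Prog (.prod (.prod .nat .nat) .nat) .nat :=
  (((fst.pair ((const 1).pair (const 0))).pair snd).comp (loop clogStepP)).comp snd

/-- The last part of the initialization, on the initial data, the fourth root, the depth and the
logarithm of the number of sets. -/
def setupP : Prog (.prod (.prod (.prod inputTy .nat) .nat) .nat) (stateTy .mem) :=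
  (((const 0).pair nil)).pair
    (((((fst.comp (fst.comp fst)).comp (fst.comp fst)).pair
        ((addOf (fst.comp (fst.comp snd)) (const 1)).pair ((addOf (fst.comp snd) (const 1)).pair
          (mulOf (mulOf (const 4) (mulOf (fst.comp (fst.comp snd)) (fst.comp (fst.comp snd))))
            (mulOf snd ((fst.comp (fst.comp fst)).comp
              (fst.comp (snd.comp (snd.comp fst))))))))).pair
      ((fst.comp (fst.comp fst)).comp snd)).pair
    ((const 0).pair ((const 0).pair ((const 0).pair (one.pair nil)))))

/-- The initialization. -/
def initP : Prog inputTy (stateTy .mem) :=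
  lett (((fst.comp (snd.comp (snd.comp (snd.comp snd)))).pair
    (fst.comp (snd.comp (snd.comp (snd.comp snd))))).comp rootP) <|
  lett ((((addOf snd (const 1)).pair (fst.comp (fst.comp (snd.comp fst)))).pair
    (fst.comp (fst.comp (snd.comp fst)))).comp clogP) <|
  lett ((((const 2).pair ((fst.comp fst).comp (fst.comp (snd.comp (snd.comp (snd.comp fst)))))).pair
    ((fst.comp fst).comp (fst.comp (snd.comp (snd.comp (snd.comp fst)))))).comp clogP) setupP

/-- The algorithm. -/
abbrev coverAlgorithm : Algorithm where
  σ := .mem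
  τ := .msg
  init := initP
  step := stepP

/-! ### Costs of the programs -/

theorem Ty.words_prod {a b : Ty} (x : a.Val) (y : b.Val) :
    (Ty.prod a b).words (x, y) = a.words x + b.words y := rfl

theorem Ty.words_nil {a : Ty} : (Ty.list a).words ([] : List a.Val) = 1 := rfl

theorem Ty.words_cons {a : Ty} (x : a.Val) (l : List a.Val) :
    (Ty.list a).words (x :: l) = a.words x + (Ty.list a).words l := by
  simp [Ty.words]; omega

theorem Ty.words_reverse {a : Ty} (l : List a.Val) :
    (Ty.list a).words l.reverse = (Ty.list a).words l := by
  simp [Ty.words, List.map_reverse, List.sum_reverse]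

instance : Lin memP := by
  unfold memP
  have : Lin (fold (ite (leOf snd (fst.comp fst))
      (ite (leOf (fst.comp fst) snd) (const 1) (fst.comp snd)) (fst.comp snd)) :
        Prog (.prod (.prod .nat .nat) (.list .nat)) .nat) :=
    Lin.fold_det inferInstance rfl 0 fun W E y z => by simp [Ty.words]
  infer_instance

instance : Lin diffP := by
  unfold diffP
  have : Lin (fold (ite ((snd.pair (fst.comp fst)).comp memP) (fst.comp snd)
      (consOf snd (fst.comp snd))) :
        Prog (.prod (.prod (.list .nat) (.list .nat)) (.list .nat)) (.list .nat)) :=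
    Lin.fold_det inferInstance rfl 1 fun W E y z => by
      simp only [Prog.ev]
      simp only [select]
      split_ifs
      rotate_left
      · omega
      · rw [Ty.words_cons]; omega
  infer_instance

instance : Lin lenP := by
  unfold lenP
  have : Lin (fold (addOf (fst.comp snd) (const 1)) :
        Prog (.prod (.prod .nat .nat) (.list .nat)) .nat) :=
    Lin.fold_det inferInstance rfl 0 fun W E y z => by simp [Ty.words]
  infer_instance

instance : Lin totalP := by
  unfold totalP
  have : Lin (fold (addOf (fst.comp snd) (snd.comp fst)) :
        Prog (.prod (.prod .nat .nat) (.list .cell)) .nat) :=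
    Lin.fold_det inferInstance rfl 0 fun W E y z => by simp [Ty.words]
  infer_instance

instance : Lin appendP := by
  unfold appendP
  have : Lin (fold (consOf snd (fst.comp snd)) :
        Prog (.prod (.prod .nat (.list .nat)) (.list .nat)) (.list .nat)) :=
    Lin.fold_det inferInstance rfl 1 fun W E y z => by
      simp only [Prog.ev]; rw [Ty.words_cons]; omega
  infer_instance

instance : Lin pushP := by unfold pushP; infer_instance

theorem words_pushP (W s : ℕ) (l : List Ty.cell.Val) (z : Ty.cell.Val) :
    (Ty.list .cell).words (pushP.ev W ((s, l), z)) ≤ (Ty.list .cell).words l + Ty.cell.words z := by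
  simp only [pushP, Prog.ev]
  simp only [select]
  split_ifs
  · omega
  · rw [Ty.words_cons]; omega

instance : Lin (fold pushP) :=
  Lin.fold_det inferInstance rfl 1 fun W E y z => by
    rw [one_mul]; exact words_pushP W E y z

theorem words_foldl {a s : Ty} (f : s.Val → a.Val → s.Val)
    (h : ∀ y z, s.words (f y z) ≤ s.words y + a.words z) (l : List a.Val) (x : s.Val) :
    s.words (l.foldl f x) ≤ s.words x + (l.map a.words).sum := by
  induction l generalizing x with
  | nil => simp
  | cons z l ih =>
    have := ih (f x z)
    have := h x z
    simp only [List.foldl_cons, List.map_cons, List.sum_cons]; omega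

instance : Lin combineP := by unfold combineP; infer_instance

theorem words_combineP (W s : ℕ) (x y : Ty.msg.Val) :
    Ty.msg.words (combineP.ev W ((s, x), y)) ≤ Ty.msg.words x + Ty.msg.words y := by
  have h := words_foldl (fun l z => pushP.ev W ((s, l), z)) (words_pushP W s) y.2 x.2
  have h1 := Ty.one_le_words (.list .nat) x.1.2.2.2
  have h2 := Ty.one_le_words (.list .nat) y.1.2.2.2
  simp only [combineP, Prog.ev, Ty.words] at h h1 h2 ⊢
  simp only [List.map_nil, List.sum_nil]
  omega

instance : Lin (fold combineP) :=
  Lin.fold_det inferInstance rfl 1 fun W E y z => by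
    rw [one_mul]; exact words_combineP W E y z

instance : Lin activeP := by unfold activeP; infer_instance
instance : Lin toMsgP := by unfold toMsgP; infer_instance

theorem words_diffP (W : ℕ) (C l : List ℕ) :
    (Ty.list .nat).words (diffP.ev W (C, l)) ≤ (Ty.list .nat).words l := by
  simp only [diffP, Prog.ev]
  have := words_foldl (a := .nat) (s := .list .nat) (fun y z => select (memP.ev W (z, C)) y (z :: y))
    (fun y z => by
      simp only [select]
      split_ifs
      · rw [Ty.words_cons]; omega
      · omega) l []
  simp only [Ty.words] at this ⊢
  simpa using this

theorem words_toMsgP (W : ℕ) (E : Ty.localEnv.Val) (z : (Ty.prod .nat .wset).Val) :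
    Ty.msg.words (toMsgP.ev W (E, z)) ≤ 6 * (Ty.prod .nat .wset).words z := by
  have h := words_diffP W E.2.2.2.2.2 z.2.2.2
  have h1 := Ty.one_le_words (.list .nat) z.2.2.2
  simp only [toMsgP, Prog.ev, Ty.words] at h h1 ⊢
  simp only [select]
  split_ifs <;> simp only [List.map_nil, List.sum_nil, List.map_cons, List.sum_cons] <;> omega

instance : Lin baseStepP := by unfold baseStepP; infer_instance
instance : Lin (fold baseStepP) :=
  Lin.fold_det inferInstance rfl 6 fun W E y z => by
    have h := words_toMsgP W E z
    have := words_combineP W E.1 y (toMsgP.ev W (E, z))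
    simp only [baseStepP, Prog.ev]
    omega
instance : Lin baseP := by unfold baseP; infer_instance
instance : Lin gatherP := by unfold gatherP; infer_instance

instance : Lin drawP := by
  unfold drawP
  have : Lin (fold (consOf (((fst.comp fst).comp rand).pair snd) (fst.comp snd)) :
      Prog (.prod (.prod .nat (.list (.prod .nat .wset))) (.list .wset))
        (.list (.prod .nat .wset))) := by
    refine Lin.fold inferInstance 2 fun W E y z o ho => ?_
    simp only [Prog.run, elementary, PMF.mem_support_bind_iff, PMF.support_pure,
      Set.mem_singleton_iff] at ho
    obtain ⟨o₁, ⟨o₂, ⟨o₃, ⟨o₄, ⟨o₅, rfl, o₆, rfl, rfl⟩, o₇, ⟨r, _, rfl⟩, rfl⟩, o₈, rfl, rfl⟩,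
      o₉, ⟨o₁₀, rfl, o₁₁, rfl, rfl⟩, rfl⟩, o₁₂, rfl, rfl⟩ := ho
    have := Ty.one_le_words .wset z
    simp only
    rw [Ty.words_cons, Ty.words_prod]
    simp only [Ty.words] at *
    omega
  infer_instance

instance : Lin pickStepP := by unfold pickStepP; infer_instance

theorem appendP_ev (W : ℕ) (l l' : List ℕ) : appendP.ev W (l, l') = l'.reverse ++ l := by
  simp only [appendP, Prog.ev]
  induction l' generalizing l with
  | nil => rfl
  | cons x l' ih => simp [ih]

theorem Ty.words_append {a : Ty} (l l' : List a.Val) :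
    (Ty.list a).words (l ++ l') = (Ty.list a).words l + (l'.map a.words).sum := by
  simp [Ty.words]; omega

instance : Lin (fold pickStepP) :=
  Lin.fold_det inferInstance rfl 1 fun W E y z => by
    have h := words_diffP W y.1 z.2.2.2
    simp only [pickStepP, Prog.ev]
    simp only [select]
    split_ifs
    · omega
    · rw [appendP_ev, Ty.words_prod, Ty.words_cons, Ty.words_append, Ty.words_reverse]
      simp only [Ty.words] at h ⊢
      omega

instance : Lin recvP := by unfold recvP; infer_instance
instance : Lin localP := by unfold localP; infer_instance
instance : Lin sampleP := by unfold sampleP; infer_instance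
instance : Lin upP := by unfold upP; infer_instance
instance : Lin finishP := by unfold finishP; infer_instance
instance : Lin setupP := by unfold setupP; infer_instance
instance : Lin rootStepP := by unfold rootStepP; infer_instance
instance : Lin clogStepP := by unfold clogStepP; infer_instance

/-! ### Costs of the programs with counting loops -/

open Prog

theorem LinOn.comp_det {a b c : Ty} {Q : ℕ → ℕ → ℕ → b.Val → Prop}
    {f : Prog a b} {g : Prog b c} (hf : Lin f) (hd : f.det = true) (hg : LinOn Q g)
    (hQ : ∀ W B B' V y, B ≤ B' → Q W B V y → Q W B' V y) :
    LinOn (fun W B V x => Q W B V (f.ev W x)) (f.comp g) :=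
  (hf.out.comp hg hQ).weaken fun W B V x h =>
    ⟨trivial, fun o ho => by rw [f.val_eq_ev W hd x o ho]; exact h⟩

/-- The copies sent to the children are not paid for by the input, which contains the parameters
only once. Their total size has to be covered by `B` explicitly. -/
theorem linOn_sendsP :
    LinOn (fun _ B V (x : (Ty.prod (.prod (.prod .nat .nat) .cell) .nat).Val) =>
      x.2 ≤ V ∧ x.2 * (Ty.cell.words x.1.2 + 2) ≤ B) sendsP := by
  have h := LinOn.loop_det (f := (consOf ((addOf (mulOf ((fst.comp fst).comp (fst.comp fst))
      ((fst.comp fst).comp (fst.comp snd))) snd).pair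
        (((fst.comp fst).comp snd).pair nil)) (fst.comp snd) :
        Prog (.prod (.prod (.prod (.prod .nat .nat) .cell) (.list (.prod .nat .msg))) .nat)
          (.list (.prod .nat .msg)))) inferInstance rfl (fun E => Ty.cell.words E.2 + 2)
      fun W E y i => by
        simp only [Prog.ev]
        rw [Ty.words_cons, Ty.words_prod, Ty.words_prod]
        simp only [Ty.words, List.map_nil, List.sum_nil]
        omega
  refine (LinOn.comp_det inferInstance rfl h ?_).weaken ?_
  · rintro W B B' V y hB ⟨h1, h2⟩
    exact ⟨h1, h2.trans hB⟩
  · rintro W B V ⟨x, k⟩ ⟨h1, h2⟩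
    exact ⟨h1, h2⟩

theorem linOn_downP :
    LinOn (fun W B V (x : Ty.stepIn.Val) => arity.ev W x ≤ V ∧
      arity.ev W x * (Ty.cell.words (recvP.ev W x) + 2) ≤ B) downP := by
  unfold downP
  refine (LinOn.comp_det inferInstance rfl (LinOn.pair (Lin.out (f := nextState fst snd))
    (LinOn.comp_det inferInstance rfl linOn_sendsP ?_)) ?_).weaken ?_
  · rintro W B B' V y hB ⟨h1, h2⟩
    exact ⟨h1, h2.trans hB⟩
  · rintro W B B' V y hB ⟨-, h1, h2⟩
    exact ⟨trivial, h1, h2.trans hB⟩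
  · rintro W B V x ⟨h1, h2⟩
    exact ⟨trivial, h1, h2⟩

theorem linOn_stepP :
    LinOn (fun W B V (x : Ty.stepIn.Val) => arity.ev W x ≤ V ∧
      arity.ev W x * (Ty.cell.words (recvP.ev W x) + 2) ≤ B) stepP := by
  unfold stepP
  refine (LinOn.ite (Lin.out (f := leOf (addOf counter (const 1)) depth)) linOn_downP
    (Lin.out (f := ite (leOf counter depth) sampleP
      (ite (leOf (addOf counter (const 1)) (addOf depth depth)) upP finishP)))).weaken ?_
  intro W B V x h
  exact ⟨trivial, fun o _ => ⟨fun _ => h, fun _ => trivial⟩⟩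

theorem linOn_rootP : LinOn (fun _ _ V (x : (Ty.prod .nat .nat).Val) => x.2 ≤ V) rootP := by
  have h := LinOn.loop_det (f := rootStepP) inferInstance rfl (fun _ => 0)
      fun W E y i => by simp [Ty.words]
  refine (LinOn.comp_det inferInstance rfl h ?_).weaken ?_
  · rintro W B B' V y hB ⟨h1, h2⟩
    exact ⟨h1, h2.trans hB⟩
  · rintro W B V ⟨x, k⟩ h1
    exact ⟨h1, by simp⟩

theorem linOn_clogP :
    LinOn (fun _ _ V (x : (Ty.prod (.prod .nat .nat) .nat).Val) => x.2 ≤ V) clogP := by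
  have h := LinOn.loop_det (f := clogStepP) inferInstance rfl (fun _ => 0)
      fun W E y i => by simp [Ty.words]
  refine ((LinOn.comp_det inferInstance rfl h ?_).comp (Lin.out (f := snd)) (by simp)).weaken ?_
  · rintro W B B' V y hB ⟨h1, h2⟩
    exact ⟨h1, h2.trans hB⟩
  · rintro W B V ⟨x, k⟩ h1
    exact ⟨⟨h1, by simp⟩, by simp⟩

theorem linOn_initP :
    LinOn (fun _ _ V (x : inputTy.Val) => x.1.2.1 ≤ V ∧ x.1.2.2.2.1 ≤ V ∧ x.1.2.2.2.2 ≤ V)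
      initP := by
  unfold initP
  have h3 := LinOn.comp (LinOn.pair (Lin.out (f := (Prog.id : Prog (.prod (.prod inputTy .nat) .nat) _)))
    (LinOn.comp_det (f := ((((const 2).pair ((fst.comp fst).comp
      (fst.comp (snd.comp (snd.comp (snd.comp fst)))))).pair
      ((fst.comp fst).comp (fst.comp (snd.comp (snd.comp (snd.comp fst)))))) :
        Prog (.prod (.prod inputTy .nat) .nat) (.prod (.prod .nat .nat) .nat))) inferInstance rfl
        linOn_clogP (by intros; assumption))) (Lin.out (f := setupP)) (by simp)
  have h2 := LinOn.comp (LinOn.pair (Lin.out (f := (Prog.id : Prog (.prod inputTy .nat) _)))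
    (LinOn.comp_det (f := (((addOf snd (const 1)).pair (fst.comp (fst.comp (snd.comp fst)))).pair
      (fst.comp (fst.comp (snd.comp fst))) :
        Prog (.prod inputTy .nat) (.prod (.prod .nat .nat) .nat))) inferInstance rfl
        linOn_clogP (by intros; assumption)))
    (h3.weaken (Q := fun _ _ V (x : (Ty.prod (.prod inputTy .nat) .nat).Val) => x.1.1.1.2.2.2.1 ≤ V)
      (fun W B V x h => ⟨⟨trivial, h⟩, fun _ _ => trivial⟩)) (by intros; assumption)
  have h1 := LinOn.comp (LinOn.pair (Lin.out (f := (Prog.id : Prog inputTy _)))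
    (LinOn.comp_det (f := ((fst.comp (snd.comp (snd.comp (snd.comp snd)))).pair
      (fst.comp (snd.comp (snd.comp (snd.comp snd)))) :
        Prog inputTy (.prod .nat .nat))) inferInstance rfl
        linOn_rootP (by intros; assumption)))
    (h2.weaken (Q := fun _ _ V (x : (Ty.prod inputTy .nat).Val) => x.1.1.2.1 ≤ V ∧ x.1.1.2.2.2.1 ≤ V)
      (fun W B V x h => ⟨⟨trivial, h.1⟩, fun o ho => by
        rw [Prog.val_eq_ev W _ rfl x o ho]; exact h.2⟩)) (by intros; assumption)
  refine h1.weaken ?_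
  rintro W B V x ⟨hM, hn, hd⟩
  refine ⟨⟨trivial, hd⟩, fun o ho => ?_⟩
  rw [Prog.val_eq_ev W _ rfl x o ho]
  exact ⟨hM, hn⟩

/-! ### Values of the programs -/

theorem bit_eq_zero {p : Prop} : bit p = 0 ↔ ¬ p := by
  unfold bit; split_ifs with h <;> simp [h]

theorem select_bit {α : Type*} (p : Prop) [Decidable p] (x y : α) :
    select (bit p) x y = if p then x else y := by
  unfold select
  by_cases h : p
  · rw [if_neg (by rw [bit_eq_zero]; simp [h]), if_pos h]
  · rw [if_pos (bit_eq_zero.2 h), if_neg h]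

theorem memP_ev {W : ℕ} (hW : 1 < W) (x : ℕ) (C : List ℕ) :
    memP.ev W (x, C) = if x ∈ C then 1 else 0 := by
  have key : ∀ (C : List ℕ) (s : ℕ),
      C.foldl (fun y z => select (bit (z ≤ x)) (select (bit (x ≤ z)) (1 % W) y) y) s =
        if x ∈ C then 1 else s := by
    intro C
    induction C with
    | nil => simp
    | cons z C ih =>
      intro s
      rw [List.foldl_cons, ih, select_bit, select_bit, Nat.mod_eq_of_lt hW]
      by_cases h : x = z
      · subst h; simp
      · have : ¬ (z ≤ x ∧ x ≤ z) := by omega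
        simp only [List.mem_cons, h, false_or]
        split_ifs <;> first | rfl | omega
  simp only [memP, Prog.ev]
  rw [key, Nat.zero_mod]

theorem diffP_ev {W : ℕ} (hW : 1 < W) (C l : List ℕ) :
    diffP.ev W (C, l) = (l.filter (· ∉ C)).reverse := by
  have key : ∀ (l acc : List ℕ),
      l.foldl (fun y z => select (memP.ev W (z, C)) y (z :: y)) acc =
        (l.filter (· ∉ C)).reverse ++ acc := by
    intro l
    induction l with
    | nil => simp
    | cons z l ih =>
      intro acc
      rw [List.foldl_cons, ih, memP_ev hW]
      by_cases h : z ∈ C <;> simp [h, select]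
  simp only [diffP, Prog.ev]
  rw [key]; simp

theorem foldl_add_mod {α : Type*} {W : ℕ} (f : α → ℕ) : ∀ (l : List α) (s : ℕ),
    s + (l.map f).sum < W → l.foldl (fun y z => (y + f z) % W) s = s + (l.map f).sum
  | [], s, _ => by simp
  | z :: l, s, h => by
      simp only [List.map_cons, List.sum_cons] at h
      rw [List.foldl_cons, Nat.mod_eq_of_lt (by omega), foldl_add_mod f l _ (by omega)]
      simp; omega

theorem lenP_ev {W : ℕ} (hW : 1 < W) (l : List ℕ) (h : l.length < W) :
    lenP.ev W l = l.length := by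
  have := foldl_add_mod (W := W) (fun _ : ℕ => 1) l 0 (by simpa using h)
  simp only [lenP, Prog.ev]
  rw [Nat.mod_eq_of_lt hW, Nat.zero_mod]
  simpa using this

/-- The first component of a cell. -/
def cellSize (z : Ty.cell.Val) : ℕ := z.1

/-- The sum of the first components of a list of cells. -/
def total (l : List Ty.cell.Val) : ℕ := (l.map cellSize).sum

theorem totalP_ev {W : ℕ} (l : List Ty.cell.Val) (h : total l < W) :
    totalP.ev W l = total l := by
  have := foldl_add_mod (W := W) cellSize l 0 (by simpa [total] using h)
  simp only [totalP, Prog.ev]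
  rw [Nat.zero_mod]
  rw [zero_add] at this
  exact this

theorem pushP_ev {W s : ℕ} (l : List Ty.cell.Val) (z : Ty.cell.Val) (h3 : 3 < W) (hs : 3 * s < W)
    (h : total l + cellSize z < W) :
    pushP.ev W ((s, l), z) = if total l + cellSize z ≤ 3 * s then z :: l else l := by
  simp only [pushP, Prog.ev]
  change select (bit ((totalP.ev W l + cellSize z) % W ≤ 3 % W * s % W)) _ _ = _
  rw [select_bit, totalP_ev l (by omega), Nat.mod_eq_of_lt h, Nat.mod_eq_of_lt h3,
    Nat.mod_eq_of_lt hs]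

/-- The list `l'` is put in front of `l`, entry by entry, as far as the bound `3 s` allows. -/
noncomputable def merge (W s : ℕ) (l l' : List Ty.cell.Val) : List Ty.cell.Val :=
  l'.foldl (fun l z => pushP.ev W ((s, l), z)) l

/-- The two ratios are compared by cross multiplication, since reals can only be compared. The
factor `1` fills the second real argument on the right of `leReal`. -/
theorem combineP_ev (W s : ℕ) (x y : Ty.msg.Val) :
    combineP.ev W ((s, x), y) =
      (((select (bit ((x.1.1 : ℝ) * y.1.2.2.1 ≤ (y.1.1 : ℝ) * (x.1.2.2.1 * 1))) y x).1.1,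
        ((x.1.2.1 + y.1.2.1) % W,
          ((select (bit ((x.1.1 : ℝ) * y.1.2.2.1 ≤ (y.1.1 : ℝ) * (x.1.2.2.1 * 1))) y x).1.2.2.1,
            []))), merge W s x.2 y.2) := rfl

/-- The test for a set of weight `w` with `D` uncovered elements. -/
def IsActive (e : ℝ) (c : ℕ) (v : ℝ) (D : ℕ) (w : ℝ) : Prop :=
  1 ≤ c ∧ (c : ℝ) * w ≤ D * (e * v)

theorem activeP_ev {W : ℕ} (hW : 1 < W) (e : ℝ) (p : Ty.cell.Val) (D : ℕ) (w : ℝ) :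
    activeP.ev W ((e, p), (D, w)) = bit (IsActive e p.1 p.2.2.1 D w) := by
  simp only [activeP, Prog.ev]
  rw [Nat.mod_eq_of_lt hW, Nat.zero_mod]
  unfold IsActive
  by_cases h : 1 ≤ p.1
  · simp only [select, bit, h, true_and, if_true]; simp
  · simp [select, bit, h]

/-- The uncovered elements of a list. -/
def uncovered (C l : List ℕ) : List ℕ := (l.filter (· ∉ C)).reverse

-- The maximum of the ratios ranges over all sets, active or not: it is needed exactly when no set
-- is active, as the next reference ratio, and it shows when everything is covered.
open Classical in
theorem toMsgP_ev {W : ℕ} (hW : 1 < W) (s : ℕ) (e : ℝ) (p : Ty.cell.Val) (r k : ℕ) (w : ℝ)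
    (l : List ℕ) (hl : (uncovered p.2.2.2 l).length < W) :
    toMsgP.ev W ((s, (e, p)), (r, (k, (w, l)))) =
      (((uncovered p.2.2.2 l).length,
        (if IsActive e p.1 p.2.2.1 (uncovered p.2.2.2 l).length w then
          (uncovered p.2.2.2 l).length else 0, (w, []))),
        if IsActive e p.1 p.2.2.1 (uncovered p.2.2.2 l).length w ∧ 1 ≤ p.2.1 ∧ r < s then
          [((uncovered p.2.2.2 l).length, (k, (w, uncovered p.2.2.2 l)))] else []) := by
  have hd : diffP.ev W (p.2.2.2, l) = uncovered p.2.2.2 l := diffP_ev hW _ _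
  simp only [toMsgP, Prog.ev]
  rw [hd, lenP_ev hW _ hl, activeP_ev hW, select_bit, select_bit, select_bit, select_bit,
    Nat.zero_mod, Nat.mod_eq_of_lt hW]
  by_cases h1 : IsActive e p.1 p.2.2.1 (uncovered p.2.2.2 l).length w
  · by_cases h2 : 1 ≤ p.2.1
    · by_cases h3 : s ≤ r
      · have : ¬ r < s := by omega
        simp [h1, h2, h3]
      · have : r < s := by omega
        simp [h1, h2, h3, this]
    · simp [h1, h2]
  · simp [h1]

/-- The empty message. -/
def emptyMsg : Ty.msg.Val := (((0 : ℕ), ((0 : ℕ), ((1 : ℝ), []))), [])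

theorem gatherP_ev (W s : ℕ) (l : List Ty.msg.Val) :
    gatherP.ev W (s, l) = l.foldl (fun x y => combineP.ev W ((s, x), y)) emptyMsg := by
  simp only [gatherP, Prog.ev, Nat.zero_mod]; rfl

theorem baseP_ev (W : ℕ) (E : Ty.localEnv.Val) (l : List (Ty.prod .nat .wset).Val) :
    baseP.ev W (E, l) =
      (l.map fun z => toMsgP.ev W (E, z)).foldl (fun x y => combineP.ev W ((E.1, x), y))
        emptyMsg := by
  simp only [baseP, Prog.ev, Nat.zero_mod, List.foldl_map]; rfl

/-- A machine that has fixed data `z`, counter `t` and parameters `p`. -/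
abbrev mkState (f : ℕ) (X : List ℕ) (z : Ty.static.Val) (t : ℕ) (p : Ty.cell.Val) :
    (stateTy .mem).Val := ((f, X), (z, (t, p)))

/-- The parameters after the receipt of the messages. -/
def received (p : Ty.cell.Val) (l : List Ty.msg.Val) : Ty.cell.Val :=
  match l with
  | [] => p
  | h :: _ => h.1

theorem recvP_ev (W f : ℕ) (X : List ℕ) (z : Ty.static.Val) (t : ℕ) (p : Ty.cell.Val)
    (l : List Ty.msg.Val) : recvP.ev W (mkState f X z t p, l) = received p l := by
  simp only [recvP, Prog.ev]
  cases l <;> rfl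

theorem sendsP_ev (W a i : ℕ) (p : Ty.cell.Val) (k : ℕ) :
    sendsP.ev W (((a, i), p), k) =
      ((List.range k).map fun j => (((a * i) % W + j) % W, ((p, []) : Ty.msg.Val))).reverse := by
  have key : ∀ (l : List ℕ) (acc : List (Ty.prod .nat .msg).Val),
      l.foldl (fun y j => ((((a * i) % W + j) % W, ((p, []) : Ty.msg.Val)) : (Ty.prod .nat .msg).Val)
        :: y) acc =
        (l.map fun j => (((a * i) % W + j) % W, ((p, []) : Ty.msg.Val))).reverse ++ acc := by
    intro l
    induction l with
    | nil => simp
    | cons z l ih => intro acc; simp only [List.foldl_cons, ih]; simp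
  simp only [sendsP, Prog.ev]
  rw [key]; simp

section step
variable (W f : ℕ) (X : List ℕ) (i a T s : ℕ) (e : ℝ) (S : List Ty.wset.Val) (t : ℕ)
  (p : Ty.cell.Val) (l : List Ty.msg.Val)

theorem downP_ev :
    downP.ev W (mkState f X ((i, (a, (T, s))), (e, S)) t p, l) =
      (mkState f X ((i, (a, (T, s))), (e, S)) ((t + 1 % W) % W) (received p l),
        sendsP.ev W (((a, i), received p l), a)) := by
  rw [← recvP_ev W f X ((i, (a, (T, s))), (e, S)) t p l]; rfl

theorem upP_ev :
    upP.ev W (mkState f X ((i, (a, (T, s))), (e, S)) t p, l) =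
      (mkState f X ((i, (a, (T, s))), (e, S)) ((t + 1 % W) % W) p,
        [(i / a, gatherP.ev W (s, l))]) := rfl

theorem localP_ev (q : Ty.cell.Val) (d : List (Ty.prod .nat .wset).Val) :
    localP.ev W (((mkState f X ((i, (a, (T, s))), (e, S)) t p, l), q), d) =
      (mkState f X ((i, (a, (T, s))), (e, S)) ((t + 1 % W) % W) q,
        [(i / a, baseP.ev W ((s, (e, q)), d))]) := by
  simp only [localP, Prog.ev]

/-- The sets picked by the greedy algorithm. -/
noncomputable def picks (W : ℕ) (e : ℝ) (p : Ty.cell.Val) (X : List ℕ) (l : List Ty.cell.Val) :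
    List ℕ × List ℕ :=
  l.foldl (fun y z => pickStepP.ev W (((e, p), y), z)) (p.2.2.2, X)

/-- The sampling parameter `k` is always `0` or equal to the measured potential, so the subtraction
toggles it: a measuring epoch stores the potential, and the sampling epoch after it resets the
parameter to `0`, because the potential must be measured again. -/
theorem finishP_ev {W : ℕ} (hW : 1 < W) :
    finishP.ev W (mkState f X ((i, (a, (T, s))), (e, S)) t p, l) =
      (mkState (bit ((gatherP.ev W (s, l)).1.1 ≤ 0)) (picks W e p X (gatherP.ev W (s, l)).2).2
        ((i, (a, (T, s))), (e, S)) 0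
        (if 1 ≤ (gatherP.ev W (s, l)).1.2.1 then p.1 else (gatherP.ev W (s, l)).1.1,
          ((gatherP.ev W (s, l)).1.2.1 - p.2.1,
            (if 1 ≤ (gatherP.ev W (s, l)).1.2.1 then p.2.2.1 else (gatherP.ev W (s, l)).1.2.2.1,
              (picks W e p X (gatherP.ev W (s, l)).2).1))), []) := by
  simp only [finishP, Prog.ev]
  rw [select_bit, Nat.mod_eq_of_lt hW, Nat.zero_mod]
  unfold picks
  split_ifs <;> rfl

open Classical in
theorem pickStepP_ev {W : ℕ} (hW : 1 < W) (C : List ℕ) (D k : ℕ) (w : ℝ) (R : List ℕ)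
    (h : (uncovered C R).length < W) :
    pickStepP.ev W (((e, p), (C, X)), (D, (k, (w, R)))) =
      if IsActive e p.1 p.2.2.1 (uncovered C R).length w then
        ((uncovered C R).reverse ++ C, k :: X) else (C, X) := by
  have hd : diffP.ev W (C, R) = uncovered C R := diffP_ev hW _ _
  simp only [pickStepP, Prog.ev]
  rw [hd, lenP_ev hW _ h, activeP_ev hW, select_bit, appendP_ev]

theorem vals_stepP_down (hW : 1 < W) (ht : t + 1 < W) (h : t < T) :
    stepP.vals W (mkState f X ((i, (a, (T, s))), (e, S)) t p, l) =
      PMF.pure (mkState f X ((i, (a, (T, s))), (e, S)) (t + 1) (received p l),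
        sendsP.ev W (((a, i), received p l), a)) := by
  rw [stepP, Prog.vals_ite _ _ _ _ _ rfl, if_pos, Prog.vals_det _ _ rfl, downP_ev,
    Nat.mod_eq_of_lt hW, Nat.mod_eq_of_lt ht]
  change bit ((t + 1 % W) % W ≤ T) ≠ 0
  rw [Ne, bit_eq_zero, Nat.mod_eq_of_lt hW, Nat.mod_eq_of_lt ht]; omega

theorem vals_stepP_up (hW : 1 < W) (ht : T + T < W) (h : T < t) (h' : t < T + T) :
    stepP.vals W (mkState f X ((i, (a, (T, s))), (e, S)) t p, l) =
      PMF.pure (mkState f X ((i, (a, (T, s))), (e, S)) (t + 1) p,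
        [(i / a, gatherP.ev W (s, l))]) := by
  rw [stepP, Prog.vals_ite _ _ _ _ _ rfl, if_neg, Prog.vals_ite _ _ _ _ _ rfl, if_neg,
    Prog.vals_ite _ _ _ _ _ rfl, if_pos, Prog.vals_det _ _ rfl, upP_ev,
    Nat.mod_eq_of_lt hW, Nat.mod_eq_of_lt (by omega)]
  · change bit ((t + 1 % W) % W ≤ (T + T) % W) ≠ 0
    rw [Ne, bit_eq_zero, Nat.mod_eq_of_lt hW, Nat.mod_eq_of_lt (by omega),
      Nat.mod_eq_of_lt (by omega)]; omega
  · change ¬ bit (t ≤ T) ≠ 0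
    rw [not_not, bit_eq_zero]; omega
  · change ¬ bit ((t + 1 % W) % W ≤ T) ≠ 0
    rw [not_not, bit_eq_zero, Nat.mod_eq_of_lt hW, Nat.mod_eq_of_lt (by omega)]; omega

theorem vals_stepP_finish (hW : 1 < W) (ht : T + T + 1 < W) (hT : 1 ≤ T) :
    stepP.vals W (mkState f X ((i, (a, (T, s))), (e, S)) (T + T) p, l) =
      PMF.pure (finishP.ev W (mkState f X ((i, (a, (T, s))), (e, S)) (T + T) p, l)) := by
  rw [stepP, Prog.vals_ite _ _ _ _ _ rfl, if_neg, Prog.vals_ite _ _ _ _ _ rfl, if_neg,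
    Prog.vals_ite _ _ _ _ _ rfl, if_neg, Prog.vals_det _ _ rfl]
  · change ¬ bit ((T + T + 1 % W) % W ≤ (T + T) % W) ≠ 0
    rw [not_not, bit_eq_zero, Nat.mod_eq_of_lt hW, Nat.mod_eq_of_lt ht,
      Nat.mod_eq_of_lt (by omega)]; omega
  · change ¬ bit (T + T ≤ T) ≠ 0
    rw [not_not, bit_eq_zero]; omega
  · change ¬ bit ((T + T + 1 % W) % W ≤ T) ≠ 0
    rw [not_not, bit_eq_zero, Nat.mod_eq_of_lt hW, Nat.mod_eq_of_lt ht]; omega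

theorem vals_sampleP (x : Ty.stepIn.Val) :
    sampleP.vals W x =
      (drawP.vals W (((recvP.ev W x).2.1 - 1 % W : ℕ), stored.ev W x)).map fun d =>
        localP.ev W ((x, recvP.ev W x), d) := by
  unfold sampleP
  rw [Prog.vals_comp, Prog.vals_det _ (Prog.id.pair recvP) rfl, PMF.pure_bind,
    Prog.vals_det_comp _ _ _ rfl, Prog.vals_pair, Prog.vals_det _ Prog.id rfl, PMF.pure_bind,
    Prog.vals_comp, Prog.vals_det W (((subOf (snd.comp (snd.comp fst)) (const 1)).pair
      (fst.comp stored)) : Prog (.prod .stepIn .cell) _) rfl, PMF.pure_bind, PMF.map_comp]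
  rfl

/-- The only randomized round. The coins range over `{0, …, k - 1}`, so that comparison with the
threshold `s` gives the sampling probability `s / k`. -/
theorem vals_stepP_sample (hW : 1 < W) (ht : T + 1 < W) :
    stepP.vals W (mkState f X ((i, (a, (T, s))), (e, S)) T p, l) =
      (drawP.vals W (((received p l).2.1 - 1 : ℕ), S)).map fun d =>
        (mkState f X ((i, (a, (T, s))), (e, S)) (T + 1) (received p l),
          [(i / a, baseP.ev W ((s, (e, received p l)), d))]) := by
  have h1 : (leOf (addOf counter (const 1)) depth).ev W
      (mkState f X ((i, (a, (T, s))), (e, S)) T p, l) = 0 := by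
    change bit ((T + 1 % W) % W ≤ T) = 0
    rw [bit_eq_zero, Nat.mod_eq_of_lt hW, Nat.mod_eq_of_lt ht]; omega
  have h2 : (leOf counter depth).ev W
      (mkState f X ((i, (a, (T, s))), (e, S)) T p, l) ≠ 0 := by
    change bit (T ≤ T) ≠ 0
    rw [Ne, bit_eq_zero]; omega
  rw [stepP, Prog.vals_ite _ _ _ _ _ rfl, if_neg (not_not.2 h1), Prog.vals_ite _ _ _ _ _ rfl,
    if_pos h2, vals_sampleP, recvP_ev, Nat.mod_eq_of_lt hW]
  congr 1
  funext d
  rw [localP_ev, Nat.mod_eq_of_lt hW, Nat.mod_eq_of_lt ht]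

end step

open Prog

/-! ### The initialization -/

/-- The integral part of the fourth root. -/
def root4 (d : ℕ) : ℕ := Nat.sqrt (Nat.sqrt d)

theorem root4_pow_le (d : ℕ) : root4 d ^ 4 ≤ d := by
  have h1 := Nat.sqrt_le' (Nat.sqrt d)
  have h2 := Nat.sqrt_le' d
  calc root4 d ^ 4 = (root4 d ^ 2) ^ 2 := by ring
    _ ≤ Nat.sqrt d ^ 2 := Nat.pow_le_pow_left h1 2
    _ ≤ d := h2

theorem lt_root4_pow (d : ℕ) : d < (root4 d + 1) ^ 4 := by
  have h1 := Nat.lt_succ_sqrt' (Nat.sqrt d)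
  have h2 := Nat.lt_succ_sqrt' d
  calc d < (Nat.sqrt d + 1) ^ 2 := h2
    _ ≤ ((root4 d + 1) ^ 2) ^ 2 := Nat.pow_le_pow_left h1 2
    _ = _ := by ring

theorem eq_root4 {q d : ℕ} (h1 : q ^ 4 ≤ d) (h2 : d < (q + 1) ^ 4) : q = root4 d := by
  have h3 := root4_pow_le d
  have h4 := lt_root4_pow d
  have h5 : q < root4 d + 1 := lt_of_pow_lt_pow_left₀ 4 (by omega) (h1.trans_lt h4)
  have h6 : root4 d < q + 1 := lt_of_pow_lt_pow_left₀ 4 (by omega) (h3.trans_lt h2)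
  omega

theorem rootP_ev {W d : ℕ} (h : (d + 1) ^ 4 < W) : rootP.ev W (d, d) = root4 d := by
  have h1 : d + 1 < W := (Nat.le_self_pow (by omega) _).trans_lt h
  set g : ℕ → ℕ := fun s => select (bit (((s + 1) % W * ((s + 1) % W)) % W *
    (((s + 1) % W * ((s + 1) % W)) % W) % W ≤ d)) ((s + 1) % W) s with hg
  -- After `k` steps either every candidate has been accepted, or the search has already stopped at
  -- the root. A search of length `d` is long enough since `d < (d + 1) ^ 4`.
  have key : ∀ k, k ≤ d → (g^[k] 0) ^ 4 ≤ d ∧ g^[k] 0 ≤ k ∧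
      (g^[k] 0 = k ∨ d < (g^[k] 0 + 1) ^ 4) := by
    intro k
    induction k with
    | zero => simp
    | succ k ih =>
      intro hk
      obtain ⟨a1, a2, a3⟩ := ih (by omega)
      rw [Function.iterate_succ_apply']
      set s := g^[k] 0
      have e1 : (s + 1) % W = s + 1 := Nat.mod_eq_of_lt (by omega)
      have hs4 : (s + 1) ^ 4 < W := (Nat.pow_le_pow_left (by omega) 4).trans_lt h
      have e2 : (s + 1) * (s + 1) % W = (s + 1) * (s + 1) := by
        refine Nat.mod_eq_of_lt (lt_of_le_of_lt ?_ hs4)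
        rw [← pow_two]; exact Nat.pow_le_pow_right (by omega) (by omega)
      have e3 : (s + 1) * (s + 1) * ((s + 1) * (s + 1)) = (s + 1) ^ 4 := by ring
      have hgs : g s = if (s + 1) ^ 4 ≤ d then s + 1 else s := by
        simp only [hg]
        rw [select_bit, e1, e2, e3, Nat.mod_eq_of_lt hs4]
      rw [hgs]
      split_ifs with hc
      · refine ⟨hc, by omega, ?_⟩
        rcases a3 with a3 | a3
        · left; omega
        · omega
      · exact ⟨a1, by omega, Or.inr (by omega)⟩
  obtain ⟨a1, a2, a3⟩ := key d le_rfl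
  have : rootP.ev W (d, d) = g^[d] 0 := by
    have e : rootP.ev W (d, d) = (List.range d).foldl (fun y _ => select (bit (((y + 1 % W) % W *
      ((y + 1 % W) % W)) % W *
    (((y + 1 % W) % W * ((y + 1 % W) % W)) % W) % W ≤ d)) ((y + 1 % W) % W) y) (0 % W) := rfl
    rw [e, Nat.mod_eq_of_lt (show 1 < W by omega), Nat.zero_mod, List.foldl_const, List.length_range]
  rw [this]
  refine eq_root4 a1 ?_
  rcases a3 with h3 | h3
  · rw [h3]
    exact (Nat.lt_succ_self d).trans_le (Nat.le_self_pow (by omega) _)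
  · exact h3

theorem clogP_ev {W a M k : ℕ} (ha : 2 ≤ a) (hM : 1 ≤ M) (h : M * a < W) (hk : M ≤ k)
    (hkW : k < W) :
    clogP.ev W ((a, M), k) = Nat.clog a M := by
  have h1 : 1 < W := by nlinarith
  set g : ℕ × ℕ → ℕ × ℕ := fun s => select (bit (M ≤ s.1)) s ((s.1 * a) % W, (s.2 + 1) % W) with hg
  -- The power is multiplied by `a` only while it is below `M`, so it never exceeds `M * a` and does
  -- not wrap around. The third clause records that the last multiplication was necessary.
  have key : ∀ j, j ≤ k → (g^[j] (1, 0)).1 = a ^ (g^[j] (1, 0)).2 ∧ (g^[j] (1, 0)).2 ≤ j ∧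
      ((g^[j] (1, 0)).2 = 0 ∨ a ^ ((g^[j] (1, 0)).2 - 1) < M) ∧
      ((g^[j] (1, 0)).2 = j ∨ M ≤ (g^[j] (1, 0)).1) := by
    intro j
    induction j with
    | zero => simp
    | succ j ih =>
      intro hj
      obtain ⟨a1, a2, a3, a4⟩ := ih (by omega)
      rw [Function.iterate_succ_apply']
      set s := g^[j] (1, 0)
      have hgs : g s = if M ≤ s.1 then s else ((s.1 * a) % W, (s.2 + 1) % W) := by
        simp only [hg]; rw [select_bit]
      rw [hgs]
      split_ifs with hc
      · exact ⟨a1, by omega, a3, Or.inr hc⟩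
      · rw [Nat.mod_eq_of_lt (show s.1 * a < W by nlinarith),
          Nat.mod_eq_of_lt (show s.2 + 1 < W by omega)]
        refine ⟨by simp only [a1, pow_succ], by simp only; omega, Or.inr ?_, ?_⟩
        · simp only [Nat.add_sub_cancel]; omega
        · simp only; omega
  obtain ⟨a1, a2, a3, a4⟩ := key k le_rfl
  have hev : clogP.ev W ((a, M), k) = (g^[k] (1, 0)).2 := by
    have e : clogP.ev W ((a, M), k) = ((List.range k).foldl (fun (y : ℕ × ℕ) _ =>
      select (bit (M ≤ y.1)) y ((y.1 * a) % W, (y.2 + 1 % W) % W)) (1 % W, 0 % W)).2 := rfl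
    rw [e, Nat.mod_eq_of_lt h1, Nat.zero_mod, List.foldl_const, List.length_range]
  rw [hev]
  set c := (g^[k] (1, 0)).2
  have hc : M ≤ a ^ c := by
    rcases a4 with a4 | a4
    · rw [a4]
      exact hk.trans (Nat.lt_pow_self (show 1 < a by omega)).le
    · rwa [← a1]
  refine le_antisymm (α := ℕ) ?_ (Nat.clog_le_of_le_pow hc)
  change c ≤ Nat.clog a M
  rcases a3 with a3 | a3
  · omega
  · have := (Nat.lt_clog_iff_pow_lt (by omega)).2 a3
    omega

theorem initP_ev {W i M m n d : ℕ} (e : ℝ) (S : List Ty.wset.Val) (hM : 1 ≤ M) (hn : 1 ≤ n)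
    (hd : 1 ≤ d)
    (h1 : (d + 1) ^ 4 < W) (h2 : M * (d + 1) < W) (h3 : n * 2 < W) (h4 : 4 * d * (n * m) < W)
    (h5 : M + 1 < W) :
    initP.ev W ((i, (M, (m, (n, d)))), (e, S)) =
      mkState 0 [] ((i, (root4 d + 1, (Nat.clog (root4 d + 1) M + 1,
        4 * (root4 d * root4 d) * (Nat.clog 2 n * m)))), (e, S)) 0 (0, (0, ((1 : ℝ), []))) := by
  have hq : root4 d ^ 4 ≤ d := root4_pow_le d
  have hq1 : root4 d ≤ d := (Nat.le_self_pow (by omega) _).trans hq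
  have hq2 : root4 d * root4 d ≤ d := by
    refine le_trans ?_ hq
    rw [← pow_two]
    rcases Nat.eq_zero_or_pos (root4 d) with h | h
    · simp [h]
    · exact Nat.pow_le_pow_right h (by omega)
  have hq0 : 1 ≤ root4 d := by
    have := lt_root4_pow d
    by_contra h
    have h0 : root4 d = 0 := by omega
    rw [h0] at this; simp at this; omega
  have hdW : d + 1 < W := (Nat.le_self_pow (by omega) _).trans_lt h1
  have hW4 : 4 < W := lt_of_lt_of_le (by norm_num : 4 < 2 ^ 4)
    ((Nat.pow_le_pow_left (by omega) 4).trans h1.le)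
  have hl : Nat.clog 2 n ≤ n := Nat.clog_le_of_le_pow (Nat.lt_pow_self (by omega)).le
  have hcM : Nat.clog (root4 d + 1) M ≤ M :=
    Nat.clog_le_of_le_pow (Nat.lt_pow_self (by omega)).le
  have e1 : (root4 d + 1) % W = root4 d + 1 := Nat.mod_eq_of_lt (by omega)
  have c1 : clogP.ev W ((root4 d + 1, M), M) = Nat.clog (root4 d + 1) M :=
    clogP_ev (by omega) hM (lt_of_le_of_lt (Nat.mul_le_mul_left _ (by omega)) h2) le_rfl (by omega)
  have c2 : clogP.ev W ((2, n), n) = Nat.clog 2 n := clogP_ev le_rfl hn h3 le_rfl (by omega)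
  have e : initP.ev W ((i, (M, (m, (n, d)))), (e, S)) =
      (let q : ℕ := rootP.ev W (d, d)
       let T : ℕ := clogP.ev W (((q + 1 % W) % W, M), M)
       let b : ℕ := clogP.ev W ((2 % W, n), n)
       mkState (0 % W) [] ((i, ((q + 1 % W) % W, ((T + 1 % W) % W,
        (4 % W * (q * q % W) % W) * (b * m % W) % W))), (e, S)) (0 % W)
          (0 % W, (0 % W, ((1 : ℝ), [])))) := rfl
  have hlm : Nat.clog 2 n * m ≤ n * m := Nat.mul_le_mul_right _ hl
  rw [e, rootP_ev h1]
  simp only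
  rw [Nat.mod_eq_of_lt (show 1 < W by omega), e1, c1, Nat.mod_eq_of_lt (show 2 < W by omega), c2,
    Nat.zero_mod, Nat.mod_eq_of_lt hW4, Nat.mod_eq_of_lt (show root4 d * root4 d < W by omega),
    Nat.mod_eq_of_lt (show Nat.clog (root4 d + 1) M + 1 < W by omega)]
  have hs : 4 * (root4 d * root4 d) * (Nat.clog 2 n * m) ≤ 4 * d * (n * m) :=
    Nat.mul_le_mul (by omega) hlm
  rcases Nat.eq_zero_or_pos m with hm | hm
  · subst hm; simp
  · have hnm : 1 ≤ n * m := Nat.mul_pos hn hm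
    have hdd : 4 * d ≤ 4 * d * (n * m) := Nat.le_mul_of_pos_right _ hnm
    have hnn : n * m ≤ 4 * d * (n * m) := Nat.le_mul_of_pos_left _ (by omega)
    rw [Nat.mod_eq_of_lt (show 4 * (root4 d * root4 d) < W by omega),
      Nat.mod_eq_of_lt (show Nat.clog 2 n * m < W by omega),
      Nat.mod_eq_of_lt (lt_of_le_of_lt hs h4)]

/-! ### The greedy algorithm -/

/-- An abstract state: the covered elements, the sets chosen, the reference ratio `c / v` and the
denominator `k` of the sampling probability, which is `0` if nothing is sampled. -/
structure AState (m n : ℕ) where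
  U : Finset (Fin m)
  X : List (Fin n)
  c : ℕ
  v : ℝ
  k : ℕ

section greedy

variable {m n : ℕ} (I : SetCover m n) (e : ℝ)

/-- The number of elements of a set that are not yet covered. -/
def res (U : Finset (Fin m)) (l : Fin n) : ℕ := (I.sets l \ U).card

/-- The set `l` is active. -/
def Act (c : ℕ) (v : ℝ) (U : Finset (Fin m)) (l : Fin n) : Prop :=
  IsActive e c v (res I U l) (I.weight l)

open Classical in
/-- The number of uncovered elements of the set if it is active, and `0` otherwise. -/
noncomputable def actRes (c : ℕ) (v : ℝ) (U : Finset (Fin m)) (l : Fin n) : ℕ :=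
  if Act I e c v U l then res I U l else 0

/-- The sum of the numbers of uncovered elements of the active sets. -/
noncomputable def pot (c : ℕ) (v : ℝ) (U : Finset (Fin m)) : ℕ := ∑ l, actRes I e c v U l

open Classical in
/-- One step of the greedy algorithm. -/
noncomputable def gstep (c : ℕ) (v : ℝ) (y : Finset (Fin m) × List (Fin n)) (l : Fin n) :
    Finset (Fin m) × List (Fin n) :=
  if Act I e c v y.1 l then (y.1 ∪ I.sets l, l :: y.2) else y

variable {I e}

theorem res_anti {U U' : Finset (Fin m)} (h : U ⊆ U') (l : Fin n) : res I U' l ≤ res I U l :=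
  Finset.card_le_card (Finset.sdiff_subset_sdiff le_rfl h)

theorem res_le_card (U : Finset (Fin m)) (l : Fin n) : res I U l ≤ (I.sets l).card :=
  Finset.card_le_card Finset.sdiff_subset

theorem res_le (U : Finset (Fin m)) (l : Fin n) : res I U l ≤ m :=
  (Finset.card_le_univ _).trans (by simp)

/-- Residual sizes only shrink, so an inactive set cannot become active again at the same level.
Hence the potential of a level is monotone, and whatever the greedy rule picks was active at the
start of the epoch. -/
theorem Act.anti {c : ℕ} {v : ℝ} (he : 0 < e) (hv : 0 < v) {U U' : Finset (Fin m)} (h : U ⊆ U')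
    {l : Fin n} (ha : Act I e c v U' l) : Act I e c v U l := by
  refine ⟨ha.1, ha.2.trans ?_⟩
  have : (res I U' l : ℝ) ≤ res I U l := by exact_mod_cast res_anti h l
  have : 0 < e * v := by positivity
  gcongr

/-- This uses the requirement `1 ≤ c` in `IsActive`. Without it, sets with no new elements would be
active in the initial state, where `c = 0`. -/
theorem Act.res_pos {c : ℕ} {v : ℝ} {U : Finset (Fin m)} {l : Fin n} (h : Act I e c v U l) :
    1 ≤ res I U l := by
  by_contra h0
  have h0 : res I U l = 0 := by omega
  have h2 := h.2
  rw [h0] at h2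
  have h1 : (1 : ℝ) ≤ c := by exact_mod_cast h.1
  have := I.weight_pos l
  have : 0 < (c : ℝ) * I.weight l := by positivity
  simp at h2; linarith

theorem actRes_le_res (c : ℕ) (v : ℝ) (U : Finset (Fin m)) (l : Fin n) :
    actRes I e c v U l ≤ res I U l := by
  unfold actRes; split_ifs <;> simp

theorem pot_le_totalCard (c : ℕ) (v : ℝ) (U : Finset (Fin m)) : pot I e c v U ≤ I.totalCard :=
  Finset.sum_le_sum fun l _ => (actRes_le_res c v U l).trans (res_le_card U l)

theorem actRes_anti {c : ℕ} {v : ℝ} (he : 0 < e) (hv : 0 < v) {U U' : Finset (Fin m)} (h : U ⊆ U')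
    (l : Fin n) : actRes I e c v U' l ≤ actRes I e c v U l := by
  unfold actRes
  split_ifs with h1 h2
  · exact res_anti h l
  · exact absurd (Act.anti he hv h h1) h2
  · omega
  · omega

theorem pot_eq_zero_iff {c : ℕ} {v : ℝ} {U : Finset (Fin m)} :
    pot I e c v U = 0 ↔ ∀ l, ¬ Act I e c v U l := by
  unfold pot
  rw [Finset.sum_eq_zero_iff]
  refine ⟨fun h l hl => ?_, fun h l _ => by simp [actRes, h l]⟩
  have := h l (Finset.mem_univ _)
  have h1 := hl.res_pos
  simp only [actRes, hl, if_true] at this; omega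

/-- The difference consists of `t` terms, each at least `1 / D`. -/
theorem harmonic_sub_ge (D t : ℕ) (h : t ≤ D) :
    (t : ℝ) / D ≤ (harmonic D : ℝ) - harmonic (D - t) := by
  induction t with
  | zero => simp
  | succ t ih =>
    have ih := ih (by omega)
    have e : D - t = (D - (t + 1)) + 1 := by omega
    have h1 : (harmonic (D - t) : ℝ) = harmonic (D - (t + 1)) + ((D - (t + 1) + 1 : ℕ) : ℝ)⁻¹ := by
      rw [e, harmonic_succ]; push_cast; ring
    have h2 : ((D : ℝ))⁻¹ ≤ ((D - (t + 1) + 1 : ℕ) : ℝ)⁻¹ := by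
      apply inv_anti₀
      · positivity
      · exact_mod_cast (by omega : D - (t + 1) + 1 ≤ D)
    push_cast
    rw [add_div, one_div]
    linarith

/-- The charging invariant: the cost of the chosen sets is distributed over the covered elements, so
that every set is charged for an amount bounded by its weight times a harmonic sum. -/
def Charged (I : SetCover m n) (e : ℝ) (y : Finset (Fin m) × List (Fin n)) : Prop :=
  (∀ j, j ∈ y.1 ↔ ∃ l ∈ y.2, j ∈ I.sets l) ∧ y.2.length ≤ y.1.card ∧
  ∃ f : Fin m → ℝ, (∀ j, 0 ≤ f j) ∧ (y.2.map I.weight).sum ≤ e * ∑ j ∈ y.1, f j ∧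
    ∀ l, ∑ j ∈ I.sets l ∩ y.1, f j ≤
      I.weight l * ((harmonic (I.sets l).card : ℝ) - harmonic (res I y.1 l))

theorem charged_empty : Charged I e (∅, []) := by
  refine ⟨by simp, by simp, 0, by simp, by simp, fun l => by simp [res]⟩

/-- The reference ratio is an upper bound of the ratios of the sets. -/
def RefBound (I : SetCover m n) (c : ℕ) (v : ℝ) (U : Finset (Fin m)) : Prop :=
  ∀ l, (res I U l : ℝ) * v ≤ c * I.weight l

theorem RefBound.mono {c : ℕ} {v : ℝ} (hv : 0 < v) {U U' : Finset (Fin m)} (h : U ⊆ U')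
    (hr : RefBound I c v U) : RefBound I c v U' := fun l => by
  have : (res I U' l : ℝ) ≤ res I U l := by exact_mod_cast res_anti h l
  exact (mul_le_mul_of_nonneg_right this hv.le).trans (hr l)

theorem subset_gstep (c : ℕ) (v : ℝ) (y : Finset (Fin m) × List (Fin n)) (l : Fin n) :
    y.1 ⊆ (gstep I e c v y l).1 := by
  unfold gstep; split_ifs
  · exact Finset.subset_union_left
  · exact le_rfl

/-- The new elements receive the price `π = w / (e D₀)`. Activity of `l₀` gives `π ≤ v / c`, and
`RefBound` gives `v / c ≤ w_l / D` for the residual size `D` of any other set `l`. If `t` of its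
elements are newly covered, then `l` is charged `t π ≤ w_l t / D`, which is at most the decrease of
its harmonic sum. -/
theorem Charged.gstep {c : ℕ} {v : ℝ} (he : 0 < e)
    {y : Finset (Fin m) × List (Fin n)} (h : Charged I e y) (hr : c = 0 ∨ RefBound I c v y.1)
    (l₀ : Fin n) : Charged I e (gstep I e c v y l₀) := by
  classical
  unfold MapReduce.gstep
  split_ifs with ha
  swap
  · exact h
  replace hr := hr.resolve_left fun h0 => by have := ha.1; omega
  obtain ⟨h1, h2, f, f0, f1, f2⟩ := h
  obtain ⟨U, X⟩ := y
  simp only at *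
  have hD := ha.res_pos
  set D₀ := res I U l₀ with hD₀
  have hD0 : (0 : ℝ) < D₀ := by exact_mod_cast hD
  have hw0 := I.weight_pos l₀
  have hc : (1 : ℝ) ≤ c := by exact_mod_cast ha.1
  set R := I.sets l₀ \ U with hR
  have hRU : Disjoint U R := Finset.disjoint_sdiff
  have hUR : U ∪ I.sets l₀ = U ∪ R := by simp [hR]
  rw [hUR]
  set π := I.weight l₀ / (e * D₀) with hπ
  have hπ0 : 0 ≤ π := by positivity
  have hπc : π * c ≤ v := by
    have := ha.2
    rw [← hD₀] at this
    rw [hπ, div_mul_eq_mul_div, div_le_iff₀ (by positivity)]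
    linarith
  refine ⟨?_, ?_, fun j => if j ∈ R then π else f j, ?_, ?_, ?_⟩
  · intro j
    rw [← hUR, Finset.mem_union, h1]
    simp [or_comm]
  · rw [Finset.card_union_of_disjoint hRU]
    simp only [List.length_cons]
    have : 1 ≤ R.card := hD
    omega
  · intro j; simp only; split_ifs
    · exact hπ0
    · exact f0 j
  · rw [Finset.sum_union hRU]
    have e1 : ∑ j ∈ U, (if j ∈ R then π else f j) = ∑ j ∈ U, f j :=
      Finset.sum_congr rfl fun j hj => if_neg (Finset.disjoint_left.1 hRU hj)
    have e2 : ∑ j ∈ R, (if j ∈ R then π else f j) = D₀ * π := by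
      rw [Finset.sum_congr rfl fun j hj => if_pos hj, Finset.sum_const, nsmul_eq_mul]; rfl
    rw [e1, e2, mul_add]
    have e3 : e * (D₀ * π) = I.weight l₀ := by rw [hπ]; field_simp
    rw [e3]
    simp only [List.map_cons, List.sum_cons]
    linarith
  · intro l
    have hw := I.weight_pos l
    have hs : I.sets l ∩ (U ∪ R) = (I.sets l ∩ U) ∪ (I.sets l ∩ R) :=
      Finset.inter_union_distrib_left _ _ _
    have hd : Disjoint (I.sets l ∩ U) (I.sets l ∩ R) :=
      hRU.mono Finset.inter_subset_right Finset.inter_subset_right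
    rw [hs, Finset.sum_union hd]
    have e1 : ∑ j ∈ I.sets l ∩ U, (if j ∈ R then π else f j) = ∑ j ∈ I.sets l ∩ U, f j :=
      Finset.sum_congr rfl fun j hj =>
        if_neg (Finset.disjoint_left.1 hRU (Finset.mem_inter.1 hj).2)
    have e2 : ∑ j ∈ I.sets l ∩ R, (if j ∈ R then π else f j) = (I.sets l ∩ R).card * π := by
      rw [Finset.sum_congr rfl fun j hj => if_pos (Finset.mem_inter.1 hj).2, Finset.sum_const,
        nsmul_eq_mul]
    rw [e1, e2]
    set D := res I U l with hDl
    set t := (I.sets l ∩ R).card with ht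
    have htD : t ≤ D := Finset.card_le_card fun j hj => by
      simp only [hR, Finset.mem_inter, Finset.mem_sdiff] at hj ⊢
      exact ⟨hj.1, hj.2.2⟩
    have hres : res I (U ∪ R) l = D - t := by
      unfold res at hDl ⊢
      rw [hDl, ht, ← Finset.card_sdiff_of_subset]
      · congr 1; ext j; simp [hR]; tauto
      · intro j hj
        simp only [hR, Finset.mem_inter, Finset.mem_sdiff] at hj ⊢
        exact ⟨hj.1, hj.2.2⟩
    rw [hres]
    have key : (t : ℝ) * π ≤ I.weight l * ((harmonic D : ℝ) - harmonic (D - t)) := by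
      rcases Nat.eq_zero_or_pos D with h0 | h0
      · have : t = 0 := by omega
        simp [this]
      · have hD' : (0 : ℝ) < D := by exact_mod_cast h0
        have h3 := harmonic_sub_ge D t htD
        have h4 := hr l
        -- The reference ratio `c / v` mediates between the set that is picked and the set that is
        -- charged; `c` cancels because it is at least `1`.
        have h5 : π ≤ I.weight l / D := by
          rw [le_div_iff₀ hD']
          have h6 : (π * c) * D ≤ c * I.weight l := by
            calc (π * c) * D ≤ v * D := by gcongr
              _ = D * v := mul_comm _ _
              _ ≤ _ := h4
          have h7 : c * (π * D) ≤ c * I.weight l := by linarith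
          exact le_of_mul_le_mul_left h7 (by linarith)
        calc (t : ℝ) * π ≤ t * (I.weight l / D) := by gcongr
          _ = I.weight l * (t / D) := by ring
          _ ≤ _ := by gcongr
    have := f2 l
    linarith

theorem Charged.foldl {c : ℕ} {v : ℝ} (he : 0 < e) (hv : 0 < v) (L : List (Fin n)) :
    ∀ {y : Finset (Fin m) × List (Fin n)}, Charged I e y → (c = 0 ∨ RefBound I c v y.1) →
    Charged I e (L.foldl (MapReduce.gstep I e c v) y) := by
  induction L with
  | nil => intro y h _; exact h
  | cons l L ih =>
    intro y h hr
    exact ih (h.gstep he hr l) (hr.imp_right fun h => h.mono hv (subset_gstep c v y l))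

theorem subset_foldl_gstep (c : ℕ) (v : ℝ) (L : List (Fin n)) :
    ∀ (y : Finset (Fin m) × List (Fin n)), y.1 ⊆ (L.foldl (gstep I e c v) y).1 := by
  induction L with
  | nil => intro y; exact le_rfl
  | cons l L ih => intro y; exact (subset_gstep c v y l).trans (ih _)

/-- The charges are a feasible dual solution up to the factor `H_Δ`: every element lies in a set of
`Y`, and each set of `Y` carries at most `H_Δ` times its weight. Repetitions in the list of chosen
sets do no harm, as weights are positive. -/
theorem Charged.isApproxMinCover {y : Finset (Fin m) × List (Fin n)} (he : 0 < e)
    (h : Charged I e y) (hU : y.1 = Finset.univ) :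
    I.IsApproxMinCover (e * (harmonic I.maxCard : ℝ))
      (Finset.univ.filter fun l : Fin n => l.val ∈ y.2.map Fin.val) := by
  classical
  obtain ⟨U, X⟩ := y
  simp only at hU
  subst hU
  obtain ⟨h1, -, f, f0, f1, f2⟩ := h
  simp only at h1 f1 f2
  have hX : (Finset.univ.filter fun l : Fin n => l.val ∈ X.map Fin.val) = X.toFinset := by
    ext l; simp [Fin.val_inj]
  simp only [hX]
  refine ⟨fun j => ?_, fun Y hY => ?_⟩
  · obtain ⟨l, hl, hj⟩ := (h1 j).1 (Finset.mem_univ _)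
    exact ⟨l, by simpa using hl, hj⟩
  · have a1 : I.cost X.toFinset ≤ (X.map I.weight).sum := by
      unfold SetCover.cost
      have : ∀ X : List (Fin n), ∑ l ∈ X.toFinset, I.weight l ≤ (X.map I.weight).sum := by
        intro X
        induction X with
        | nil => simp
        | cons x X ih =>
          have hx := (I.weight_pos x).le
          rw [List.toFinset_cons, List.map_cons, List.sum_cons]
          by_cases hm : x ∈ X.toFinset
          · rw [Finset.insert_eq_of_mem hm]; linarith
          · rw [Finset.sum_insert hm]; linarith
      exact this X
    have a2 : ∑ j, f j ≤ ∑ l ∈ Y, ∑ j ∈ I.sets l, f j := by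
      have hb : ∀ j, f j ≤ ∑ l ∈ Y, if j ∈ I.sets l then f j else 0 := by
        intro j
        obtain ⟨l, hl, hj⟩ := hY j
        have := Finset.single_le_sum (f := fun l => if j ∈ I.sets l then f j else 0)
          (fun l _ => by split_ifs; exacts [f0 j, le_rfl]) hl
        simpa [hj] using this
      calc ∑ j, f j ≤ ∑ j, ∑ l ∈ Y, if j ∈ I.sets l then f j else 0 :=
            Finset.sum_le_sum fun j _ => hb j
        _ = _ := by
            rw [Finset.sum_comm]
            refine Finset.sum_congr rfl fun l _ => ?_
            rw [← Finset.sum_filter]; congr 1; ext j; simp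
    have a3 : ∀ l, ∑ j ∈ I.sets l, f j ≤ I.weight l * (harmonic I.maxCard : ℝ) := by
      intro l
      have := f2 l
      rw [Finset.inter_univ] at this
      have hr : res I Finset.univ l = 0 := by simp [res]
      rw [hr] at this
      simp only [harmonic_zero, Rat.cast_zero, sub_zero] at this
      refine this.trans (mul_le_mul_of_nonneg_left ?_ (I.weight_pos l).le)
      have hle : (I.sets l).card ≤ I.maxCard :=
        Finset.le_sup (f := fun l => (I.sets l).card) (Finset.mem_univ l)
      have : harmonic (I.sets l).card ≤ harmonic I.maxCard := by
        unfold harmonic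
        exact Finset.sum_le_sum_of_subset_of_nonneg (Finset.range_mono hle)
          fun i _ _ => by positivity
      exact_mod_cast this
    calc I.cost X.toFinset ≤ e * ∑ j, f j := a1.trans f1
      _ ≤ e * ∑ l ∈ Y, I.weight l * (harmonic I.maxCard : ℝ) := by
          gcongr
          exact a2.trans (Finset.sum_le_sum fun l _ => a3 l)
      _ = e * (harmonic I.maxCard : ℝ) * I.cost Y := by
          unfold SetCover.cost
          rw [← Finset.sum_mul]; ring

end greedy

/-! ### Messages that describe lists of sets -/

section messages

variable {m n : ℕ} (I : SetCover m n)

/-- The elements of a set, as a list of numbers. -/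
def els (l : Fin n) : List ℕ := ((I.sets l).sort (· ≤ ·)).map Fin.val

/-- A set as stored on a machine. -/
def triple (l : Fin n) : Ty.wset.Val := (l.val, (I.weight l, els I l))

/-- The list `C` enumerates the set `U`. -/
def Repr (C : List ℕ) (U : Finset (Fin m)) : Prop := C.Nodup ∧ ∀ k, k ∈ C ↔ ∃ j ∈ U, j.val = k

/-- The cell that describes a set. -/
def cellOf (C : List ℕ) (l : Fin n) : Ty.cell.Val :=
  ((uncovered C (els I l)).length, (l.val, (I.weight l, uncovered C (els I l))))

/-- The set `l` is sampled: it is active and its coin is below the threshold. -/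
def Smp (e : ℝ) (s c : ℕ) (v : ℝ) (k : ℕ) (U : Finset (Fin m)) (ω : Fin n → ℕ) (l : Fin n) :
    Prop := Act I e c v U l ∧ 1 ≤ k ∧ ω l < s

variable {I} {e : ℝ} {W s c : ℕ} {v : ℝ} {k : ℕ} {U : Finset (Fin m)} {C : List ℕ} {ω : Fin n → ℕ}

theorem mem_els {l : Fin n} {x : ℕ} : x ∈ els I l ↔ ∃ j ∈ I.sets l, j.val = x := by
  simp [els]

theorem nodup_els (l : Fin n) : (els I l).Nodup :=
  (Finset.sort_nodup _ _).map Fin.val_injective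

theorem mem_uncovered {C l : List ℕ} {x : ℕ} : x ∈ uncovered C l ↔ x ∈ l ∧ x ∉ C := by
  simp [uncovered]

theorem nodup_uncovered {C l : List ℕ} (h : l.Nodup) : (uncovered C l).Nodup :=
  List.nodup_reverse.2 (h.filter _)

theorem length_eq_card {S : Finset (Fin m)} {l : List ℕ} (h : l.Nodup)
    (hl : ∀ x, x ∈ l ↔ ∃ j ∈ S, j.val = x) : l.length = S.card := by
  rw [← List.toFinset_card_of_nodup h, ← Finset.card_map Fin.valEmbedding]
  congr 1
  ext x
  simp [hl]

/-- The list `R` may already lack some covered elements. This covers both the stored lists and the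
cells, which contain only the elements that were uncovered when the epoch began. -/
theorem Repr.length_uncovered (h : Repr C U) {R : List ℕ} (l : Fin n) (hR : R.Nodup)
    (h1 : ∀ x, x ∈ R → x ∈ els I l) (h2 : ∀ x, x ∈ els I l → x ∉ C → x ∈ R) :
    (uncovered C R).length = res I U l := by
  refine length_eq_card (nodup_uncovered hR) fun x => ?_
  rw [mem_uncovered]
  constructor
  · rintro ⟨a, b⟩
    obtain ⟨j, hj, rfl⟩ := mem_els.1 (h1 x a)
    exact ⟨j, Finset.mem_sdiff.2 ⟨hj, fun hU => b ((h.2 _).2 ⟨j, hU, rfl⟩)⟩, rfl⟩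
  · rintro ⟨j, hj, rfl⟩
    obtain ⟨a, b⟩ := Finset.mem_sdiff.1 hj
    have hC : j.val ∉ C := fun hc => by
      obtain ⟨j', hj', e⟩ := (h.2 _).1 hc
      exact b (Fin.val_injective e ▸ hj')
    exact ⟨h2 _ (mem_els.2 ⟨j, a, rfl⟩) hC, hC⟩

theorem Repr.length_uncovered_els (h : Repr C U) (l : Fin n) :
    (uncovered C (els I l)).length = res I U l :=
  h.length_uncovered l (nodup_els l) (fun _ h => h) (fun _ h _ => h)

theorem Repr.length_le (h : Repr C U) : C.length = U.card := length_eq_card h.1 h.2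

theorem repr_empty : Repr (m := m) [] ∅ := ⟨List.nodup_nil, by simp⟩

variable (I e s c v k U C ω) in
/-- The message `x` describes the list `L` of sets: it holds their largest ratio, the potential of
the active ones, and a part of the sampled ones, namely all of them if they fit. -/
structure Summ (x : Ty.msg.Val) (L : List (Fin n)) : Prop where
  nil : x.1.2.2.2 = []
  pos : (0 : ℝ) < x.1.2.2.1
  max : ∀ l ∈ L, (res I U l : ℝ) * x.1.2.2.1 ≤ (x.1.1 : ℕ) * I.weight l
  att : x.1.1 = (0 : ℕ) ∨ ∃ l, x.1.1 = res I U l ∧ x.1.2.2.1 = I.weight l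
  sum : x.1.2.1 = (L.map (actRes I e c v U)).sum
  tot : total x.2 ≤ 3 * s
  mem : ∀ z ∈ x.2, ∃ l, z = cellOf I C l ∧ Smp I e s c v k U ω l
  full : open Classical in
    ((L.filter (Smp I e s c v k U ω)).map (res I U)).sum ≤ 3 * s →
      x.2 = (L.filter (Smp I e s c v k U ω)).map (cellOf I C)
  ne : (∃ l ∈ L, Smp I e s c v k U ω l) → x.2 ≠ []

theorem summ_empty : Summ I e s c v k U C ω emptyMsg [] where
  nil := rfl
  pos := by simp [emptyMsg]
  max := by simp
  att := Or.inl rfl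
  sum := rfl
  tot := by simp [total, emptyMsg]
  mem := by simp [emptyMsg]
  full := by simp [emptyMsg]
  ne := by simp

/-- Cells that do not fit are skipped. The hypothesis `M ≤ 3 s` says that a single cell always fits
into the empty list, so a nonempty sample is never truncated to nothing. Almost sure termination
depends on this. -/
theorem merge_spec {M : ℕ} (h3 : 3 < W) (hs : 3 * s + M < W) (hM : M ≤ 3 * s) :
    ∀ (l' l : List Ty.cell.Val), total l ≤ 3 * s → (∀ z ∈ l', cellSize z ≤ M) →
      total (merge W s l l') ≤ 3 * s ∧ (∀ z ∈ merge W s l l', z ∈ l ∨ z ∈ l') ∧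
      (total l + total l' ≤ 3 * s → merge W s l l' = l'.reverse ++ l) ∧
      (l ≠ [] ∨ l' ≠ [] → merge W s l l' ≠ [])
  | [], l, h, _ => by simp [merge, h, show total [] = 0 from rfl]
  | z :: l', l, h, hz => by
      have hz1 : cellSize z ≤ M := hz z (by simp)
      have e : merge W s l (z :: l') = merge W s (if total l + cellSize z ≤ 3 * s then z :: l else l) l' := by
        rw [← pushP_ev l z h3 (by omega) (by omega)]; rfl
      have ht : ∀ l, total (z :: l) = cellSize z + total l := fun l => by simp [total]
      rw [e]
      split_ifs with hc
      · obtain ⟨a1, a2, a3, a4⟩ := merge_spec h3 hs hM l' (z :: l) (by rw [ht]; omega)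
          (fun y hy => hz y (by simp [hy]))
        refine ⟨a1, fun y hy => ?_, fun h5 => ?_, fun _ => a4 (Or.inl (by simp))⟩
        · rcases a2 y hy with h6 | h6
          · rcases List.mem_cons.1 h6 with rfl | h6
            · exact Or.inr (by simp)
            · exact Or.inl h6
          · exact Or.inr (by simp [h6])
        · rw [ht] at h5
          rw [a3 (by rw [ht]; omega)]; simp
      · obtain ⟨a1, a2, a3, a4⟩ := merge_spec h3 hs hM l' l h (fun y hy => hz y (by simp [hy]))
        refine ⟨a1, fun y hy => (a2 y hy).imp_right fun h6 => by simp [h6], fun h5 => ?_, fun _ =>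
          a4 (Or.inl ?_)⟩
        · rw [ht] at h5; omega
        -- A cell can be rejected only by a list that is not empty.
        · rintro rfl
          have : total [] = 0 := rfl
          omega

theorem total_map_cellOf (h : Repr C U) (L : List (Fin n)) :
    total (L.map (cellOf I C)) = (L.map (res I U)).sum := by
  unfold total
  rw [List.map_map]
  congr 1
  refine List.map_congr_left fun l _ => h.length_uncovered_els l

/-- If the samples of both parts fit together, then each fits alone, so both messages hold their
full samples and merging drops nothing. This makes the conditional clause `full` stable under unions
even though truncation depends on the order. -/
theorem Summ.combine {x y : Ty.msg.Val} {L L' : List (Fin n)} (hC : Repr C U) (h3 : 3 < W)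
    (hs : 3 * s + m < W) (hm : m ≤ 3 * s)
    (hW : (L.map (actRes I e c v U)).sum + (L'.map (actRes I e c v U)).sum < W)
    (hx : Summ I e s c v k U C ω x L) (hy : Summ I e s c v k U C ω y L') :
    Summ I e s c v k U C ω (combineP.ev W ((s, x), y)) (L'.reverse ++ L) := by
  classical
  have hz : ∀ z ∈ y.2, cellSize z ≤ m := fun z hz => by
    obtain ⟨l, rfl, -⟩ := hy.mem z hz
    change (uncovered C (els I l)).length ≤ m
    rw [hC.length_uncovered_els l]; exact res_le _ _
  obtain ⟨a1, a2, a3, a4⟩ := merge_spec h3 hs hm y.2 x.2 hx.tot hz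
  have hsel : ((select (bit ((x.1.1 : ℝ) * y.1.2.2.1 ≤ (y.1.1 : ℝ) * (x.1.2.2.1 * 1))) y x) = y ∧
      (x.1.1 : ℝ) * y.1.2.2.1 ≤ (y.1.1 : ℝ) * x.1.2.2.1) ∨
      ((select (bit ((x.1.1 : ℝ) * y.1.2.2.1 ≤ (y.1.1 : ℝ) * (x.1.2.2.1 * 1))) y x) = x ∧
      (y.1.1 : ℝ) * x.1.2.2.1 ≤ (x.1.1 : ℝ) * y.1.2.2.1) := by
    rw [select_bit, mul_one]
    split_ifs with h
    · exact Or.inl ⟨rfl, h⟩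
    · exact Or.inr ⟨rfl, (not_le.1 h).le⟩
  rw [combineP_ev]
  set w := select (bit ((x.1.1 : ℝ) * y.1.2.2.1 ≤ (y.1.1 : ℝ) * (x.1.2.2.1 * 1))) y x with hw
  have hmod : (x.1.2.1 + y.1.2.1 : ℕ) % W =
      (L.map (actRes I e c v U)).sum + (L'.map (actRes I e c v U)).sum := by
    rw [hx.sum, hy.sum]; exact Nat.mod_eq_of_lt hW
  have px := hx.pos
  have py := hy.pos
  -- Transitivity of `D / r ≤ a / p ≤ b / q`, with denominators cleared.
  have aux : ∀ {a b p q r D : ℝ}, 0 < p → 0 < r → 0 ≤ D → D * p ≤ a * r →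
      a * q ≤ b * p → 0 < q → D * q ≤ b * r := by
    intro a b p q r D hp hr hD h1 h2 hq
    have h4 : (D * q) * p ≤ (b * r) * p := by
      calc (D * q) * p = (D * p) * q := by ring
        _ ≤ (a * r) * q := by gcongr
        _ = (a * q) * r := by ring
        _ ≤ (b * p) * r := by gcongr
        _ = _ := by ring
    exact le_of_mul_le_mul_right h4 hp
  constructor
  · rfl
  · change (0 : ℝ) < w.1.2.2.1
    rcases hsel with ⟨h, -⟩ | ⟨h, -⟩ <;> rw [h]
    exacts [py, px]
  · intro l hl
    change (res I U l : ℝ) * w.1.2.2.1 ≤ (w.1.1 : ℕ) * I.weight l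
    have hwl := I.weight_pos l
    simp only [List.mem_append, List.mem_reverse] at hl
    rcases hsel with ⟨h, h5⟩ | ⟨h, h5⟩ <;> rw [h] <;> rcases hl with hl | hl
    · exact hy.max l hl
    · exact aux px hwl (Nat.cast_nonneg _) (hx.max l hl) h5 py
    · exact aux py hwl (Nat.cast_nonneg _) (hy.max l hl) h5 px
    · exact hx.max l hl
  · change w.1.1 = (0 : ℕ) ∨ ∃ l, w.1.1 = res I U l ∧ w.1.2.2.1 = I.weight l
    rcases hsel with ⟨h, -⟩ | ⟨h, -⟩ <;> rw [h]
    exacts [hy.att, hx.att]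
  · change (x.1.2.1 + y.1.2.1 : ℕ) % W = _
    rw [hmod]; simp [List.sum_reverse, add_comm]
  · exact a1
  · intro z hz
    rcases a2 z hz with h | h
    exacts [hx.mem z h, hy.mem z h]
  · intro hfull
    rw [List.filter_append, List.filter_reverse, List.map_append, List.map_reverse,
      List.sum_append, List.sum_reverse] at hfull
    have ex := hx.full (by omega)
    have ey := hy.full (by omega)
    have htx : total x.2 = ((L.filter (Smp I e s c v k U ω)).map (res I U)).sum := by
      rw [ex, total_map_cellOf hC]
    have hty : total y.2 = ((L'.filter (Smp I e s c v k U ω)).map (res I U)).sum := by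
      rw [ey, total_map_cellOf hC]
    change merge W s x.2 y.2 = _
    rw [a3 (by omega), List.filter_append, List.filter_reverse, List.map_append, List.map_reverse,
      ← ex, ← ey]
  · rintro ⟨l, hl, hS⟩
    refine a4 ?_
    simp only [List.mem_append, List.mem_reverse] at hl
    rcases hl with hl | hl
    · exact Or.inr (hy.ne ⟨l, hl, hS⟩)
    · exact Or.inl (hx.ne ⟨l, hl, hS⟩)

/-- The order in which combined messages describe the sets. -/
def joinLists {α : Type*} (L : List α) (Ls : List (List α)) : List α :=
  Ls.foldl (fun L L' => L'.reverse ++ L) L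

theorem joinLists_perm {α : Type*} (Ls : List (List α)) :
    ∀ L : List α, (joinLists L Ls).Perm (L ++ Ls.flatten) := by
  induction Ls with
  | nil => intro L; simp [joinLists]
  | cons L' Ls ih =>
    intro L
    refine (ih (L'.reverse ++ L)).trans ?_
    rw [List.flatten_cons, ← List.append_assoc]
    exact List.Perm.append_right _
      ((List.Perm.append_right _ (List.reverse_perm L')).trans List.perm_append_comm)

theorem Summ.foldl (hC : Repr C U) (h3 : 3 < W) (hs : 3 * s + m < W) (hm : m ≤ 3 * s) :
    ∀ (l : List Ty.msg.Val) (Ls : List (List (Fin n))) (x : Ty.msg.Val) (L : List (Fin n)),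
    List.Forall₂ (Summ I e s c v k U C ω) l Ls →
    ((L ++ Ls.flatten).map (actRes I e c v U)).sum < W →
    Summ I e s c v k U C ω x L →
    Summ I e s c v k U C ω (l.foldl (fun x y => combineP.ev W ((s, x), y)) x) (joinLists L Ls) := by
  intro l Ls x L h
  induction h generalizing x L with
  | nil => intro _ hx; exact hx
  | @cons y L' l Ls hy _ ih =>
    intro hW hx
    simp only [List.flatten_cons, List.map_append, List.sum_append] at hW
    refine ih _ _ ?_ (Summ.combine hC h3 hs hm (by omega) hx hy)
    simp only [List.map_append, List.sum_append, List.map_reverse, List.sum_reverse]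
    omega

theorem summ_toMsgP (hC : Repr C U) (h3 : 3 < W) (hs : 3 * s + m < W) (hm : m ≤ 3 * s)
    (l : Fin n) :
    Summ I e s c v k U C ω (toMsgP.ev W ((s, (e, (c, (k, (v, C))))), (ω l, triple I l))) [l] := by
  classical
  have hr : (uncovered C (els I l)).length = res I U l := hC.length_uncovered_els l
  have hrm : res I U l ≤ m := res_le _ _
  have e1 := toMsgP_ev (W := W) (by omega) s e (c, (k, (v, C))) (ω l) l.val (I.weight l) (els I l)
    (by change (uncovered C (els I l)).length < W; omega)
  simp only [hr] at e1
  have hact : ∀ {p : Prop} [Decidable p], (p ↔ Smp I e s c v k U ω l) →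
      ((if p then [(res I U l, (l.val, (I.weight l, uncovered C (els I l))))] else [] :
        List Ty.cell.Val) = ([l].filter (Smp I e s c v k U ω)).map (cellOf I C)) := by
    intro p _ hp
    by_cases h : p
    · have h' := hp.1 h
      simp only [h, h', if_true, List.filter_cons, decide_true, List.filter_nil, List.map_cons,
        List.map_nil]
      unfold cellOf; rw [hr]
    · have h' : ¬ Smp I e s c v k U ω l := fun h' => h (hp.2 h')
      simp [h, h']
  have e2 : toMsgP.ev W ((s, (e, (c, (k, (v, C))))), (ω l, triple I l)) =
      ((res I U l, (actRes I e c v U l, (I.weight l, []))),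
        ([l].filter (Smp I e s c v k U ω)).map (cellOf I C)) := by
    rw [← hact (p := IsActive e c v (res I U l) (I.weight l) ∧ 1 ≤ k ∧ ω l < s) Iff.rfl]
    exact e1
  rw [e2]
  constructor
  · rfl
  · exact I.weight_pos l
  · intro l' hl'
    rw [List.mem_singleton.1 hl']
  · exact Or.inr ⟨l, rfl, rfl⟩
  · simp
  · change total (([l].filter (Smp I e s c v k U ω)).map (cellOf I C)) ≤ 3 * s
    rw [total_map_cellOf hC]
    by_cases h : Smp I e s c v k U ω l
    · simp [h]; omega
    · simp [h]
  · intro z hz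
    simp only [List.mem_map, List.mem_filter, decide_eq_true_eq] at hz
    obtain ⟨l', ⟨-, h⟩, rfl⟩ := hz
    exact ⟨l', rfl, h⟩
  · intro _; rfl
  · rintro ⟨l', hl', h⟩
    rw [List.mem_singleton.1 hl'] at h
    simp [h]

/-- The induction needs two covered sets: `C` is the one at the start of the epoch, to which the
cells refer, and `C₁` is the current one. Because `C ⊆ C₁`, removing `C₁` from a cell still leaves
exactly the uncovered elements of the set. -/
theorem picks_spec (hC : Repr C U) (hW : 1 < W) (hmW : m < W) (L : List (Fin n)) :
    ∀ (C₁ : List ℕ) (U₁ : Finset (Fin m)) (X : List (Fin n)), Repr C₁ U₁ → U ⊆ U₁ →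
    ∃ C', (L.map (cellOf I C)).foldl
        (fun y z => pickStepP.ev W (((e, (c, (k, (v, C)))), y), z)) (C₁, X.map Fin.val) =
        (C', (L.foldl (gstep I e c v) (U₁, X)).2.map Fin.val) ∧
      Repr C' (L.foldl (gstep I e c v) (U₁, X)).1 := by
  classical
  induction L with
  | nil => intro C₁ U₁ X h _; exact ⟨C₁, rfl, h⟩
  | cons l L ih =>
    intro C₁ U₁ X h1 hU
    have hsub : ∀ x, x ∈ C → x ∈ C₁ := fun x hx => by
      obtain ⟨j, hj, rfl⟩ := (hC.2 x).1 hx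
      exact (h1.2 _).2 ⟨j, hU hj, rfl⟩
    have hlen : (uncovered C₁ (uncovered C (els I l))).length = res I U₁ l :=
      h1.length_uncovered l (nodup_uncovered (nodup_els l)) (fun x hx => (mem_uncovered.1 hx).1)
        (fun x hx hc => mem_uncovered.2 ⟨hx, fun h => hc (hsub x h)⟩)
    have hrm : res I U₁ l ≤ m := res_le _ _
    have e1 := pickStepP_ev (X.map Fin.val) e (c, (k, (v, C))) hW C₁ (uncovered C (els I l)).length
      l.val (I.weight l) (uncovered C (els I l)) (by omega)
    simp only [hlen] at e1
    simp only [List.map_cons, List.foldl_cons]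
    have e2 : pickStepP.ev W (((e, (c, (k, (v, C)))), (C₁, X.map Fin.val)), cellOf I C l) =
        if Act I e c v U₁ l then
          ((uncovered C₁ (uncovered C (els I l))).reverse ++ C₁, (l :: X).map Fin.val)
        else (C₁, X.map Fin.val) := e1
    rw [e2]
    by_cases ha : Act I e c v U₁ l
    · have eg : gstep I e c v (U₁, X) l = (U₁ ∪ I.sets l, l :: X) := by
        unfold gstep; rw [if_pos ha]
      rw [if_pos ha, eg]
      refine ih _ _ _ ⟨?_, fun x => ?_⟩ (hU.trans Finset.subset_union_left)
      · refine List.nodup_append.2 ⟨List.nodup_reverse.2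
          (nodup_uncovered (nodup_uncovered (nodup_els l))), h1.1, fun a ha b hb => ?_⟩
        rintro rfl
        exact (mem_uncovered.1 (List.mem_reverse.1 ha)).2 hb
      · rw [List.mem_append, List.mem_reverse, mem_uncovered, mem_uncovered, mem_els, h1.2]
        constructor
        · rintro (⟨⟨⟨j, hj, rfl⟩, -⟩, -⟩ | ⟨j, hj, rfl⟩)
          · exact ⟨j, Finset.mem_union_right _ hj, rfl⟩
          · exact ⟨j, Finset.mem_union_left _ hj, rfl⟩
        · rintro ⟨j, hj, rfl⟩
          by_cases hjU : j.val ∈ C₁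
          · exact Or.inr ((h1.2 _).1 hjU)
          · rcases Finset.mem_union.1 hj with hj | hj
            · exact Or.inr ⟨j, hj, rfl⟩
            · exact Or.inl ⟨⟨⟨j, hj, rfl⟩, fun h => hjU (hsub _ h)⟩,
                fun h => hjU ((h1.2 _).2 h)⟩
    · have eg : gstep I e c v (U₁, X) l = (U₁, X) := by unfold gstep; rw [if_neg ha]
      rw [if_neg ha, eg]
      exact ih _ _ _ h1 hU

theorem exists_map_cellOf {P : Fin n → Prop} (l : List Ty.cell.Val)
    (h : ∀ z ∈ l, ∃ i, z = cellOf I C i ∧ P i) :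
    ∃ L : List (Fin n), l = L.map (cellOf I C) ∧ ∀ i ∈ L, P i := by
  induction l with
  | nil => exact ⟨[], rfl, by simp⟩
  | cons z l ih =>
    obtain ⟨L, rfl, hL⟩ := ih fun y hy => h y (by simp [hy])
    obtain ⟨i, rfl, hi⟩ := h z (by simp)
    exact ⟨i :: L, rfl, by simpa using ⟨hi, hL⟩⟩

theorem cellOf_injective : Function.Injective (cellOf I C) := by
  intro i j h
  have : (cellOf I C i).2.1 = (cellOf I C j).2.1 := by rw [h]
  exact Fin.val_injective this

end messages

/-! ### The transition at the end of an epoch -/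

section transition

variable {m n : ℕ} (I : SetCover m n) (e : ℝ)

/-- The invariant of the abstract states. -/
structure AInv (σ : AState m n) : Prop where
  charged : Charged I e (σ.U, σ.X)
  pos : 0 < σ.v
  ref : σ.c = 0 ∨ RefBound I σ.c σ.v σ.U
  att : σ.c = 0 ∨ ∃ l, σ.c ≤ (I.sets l).card ∧ σ.v = I.weight l
  den : σ.k = 0 ∨ σ.k = pot I e σ.c σ.v σ.U

open Classical in
/-- The abstract state `τ` may follow the state `σ` if the coins are `ω`. -/
structure Next (s : ℕ) (L : List (Fin n)) (ω : Fin n → ℕ) (σ τ : AState m n) : Prop where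
  picked : ∃ L', (∀ l ∈ L', Smp I e s σ.c σ.v σ.k σ.U ω l) ∧
    (((L.filter (Smp I e s σ.c σ.v σ.k σ.U ω)).map (res I σ.U)).sum ≤ 3 * s →
      L' = L.filter (Smp I e s σ.c σ.v σ.k σ.U ω)) ∧
    ((∃ l ∈ L, Smp I e s σ.c σ.v σ.k σ.U ω l) → L' ≠ []) ∧
    (τ.U, τ.X) = L'.foldl (gstep I e σ.c σ.v) (σ.U, σ.X)
  level : pot I e σ.c σ.v σ.U = 0 → RefBound I τ.c τ.v σ.U ∧ 0 < τ.v ∧ τ.k = 0 ∧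
    (τ.c = 0 ∨ ∃ l, τ.c = res I σ.U l ∧ τ.v = I.weight l)
  same : pot I e σ.c σ.v σ.U ≠ 0 → τ.c = σ.c ∧ τ.v = σ.v ∧ τ.k = pot I e σ.c σ.v σ.U - σ.k

variable {I e}

theorem Next.eq_of_pot_eq_zero {s : ℕ} {L : List (Fin n)} {ω : Fin n → ℕ} {σ τ : AState m n}
    (h : Next I e s L ω σ τ) (h0 : pot I e σ.c σ.v σ.U = 0 ∨ σ.k = 0) :
    τ.U = σ.U ∧ τ.X = σ.X := by
  obtain ⟨L', h1, -, -, h4⟩ := h.picked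
  have : L' = [] := by
    rw [List.eq_nil_iff_forall_not_mem]
    intro l hl
    rcases h0 with h0 | h0
    · exact pot_eq_zero_iff.1 h0 l (h1 l hl).1
    · have := (h1 l hl).2.1; omega
  rw [this] at h4
  simpa using h4

theorem Next.subset {s : ℕ} {L : List (Fin n)} {ω : Fin n → ℕ} {σ τ : AState m n}
    (h : Next I e s L ω σ τ) : σ.U ⊆ τ.U := by
  obtain ⟨L', -, -, -, h4⟩ := h.picked
  have := subset_foldl_gstep (I := I) (e := e) σ.c σ.v L' (σ.U, σ.X)
  rw [← h4] at this
  exact this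

/-- If the potential vanishes, nothing is picked, so the new reference ratio, measured for `σ.U`, is
valid for `τ.U`. Otherwise the bound survives by monotonicity. A positive `k` equals the current
potential because it was stored in an epoch in which `U` did not change. -/
theorem Next.inv (he : 0 < e) {s : ℕ} {L : List (Fin n)} {ω : Fin n → ℕ} {σ τ : AState m n}
    (hσ : AInv I e σ) (h : Next I e s L ω σ τ) : AInv I e τ := by
  have hsub := h.subset
  have hch : Charged I e (τ.U, τ.X) := by
    obtain ⟨L', -, -, -, h4⟩ := h.picked
    rw [h4]
    exact hσ.charged.foldl he hσ.pos L' hσ.ref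
  by_cases h0 : pot I e σ.c σ.v σ.U = 0
  · obtain ⟨a1, a2, a3, a4⟩ := h.level h0
    have hU := (h.eq_of_pot_eq_zero (Or.inl h0)).1
    refine ⟨hch, a2, Or.inr (hU ▸ a1), a4.imp_right ?_, Or.inl a3⟩
    rintro ⟨l, h1, h2⟩
    exact ⟨l, h1 ▸ res_le_card _ _, h2⟩
  · obtain ⟨a1, a2, a3⟩ := h.same h0
    refine ⟨hch, a2 ▸ hσ.pos, ?_, ?_, ?_⟩
    · rw [a1, a2]; exact hσ.ref.imp_right fun h => h.mono hσ.pos hsub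
    · rw [a1, a2]; exact hσ.att
    · rcases hσ.den with hk | hk
      · right
        rw [a1, a2, (h.eq_of_pot_eq_zero (Or.inr hk)).1, a3, hk, Nat.sub_zero]
      · left; rw [a3, hk, Nat.sub_self]

/-- The flag depends on the largest residual size at the beginning of the epoch, so the computation
halts one epoch after the cover has become complete. Each set has to occur exactly once in `L` for
the sum collected in the tree to be the potential. -/
theorem finishP_spec {W s : ℕ} {L : List (Fin n)} {ω : Fin n → ℕ} {σ : AState m n}
    (hW : 1 < W) (hmW : m < W) (hL : ∀ l, l ∈ L) (hnd : L.Nodup)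
    {C : List ℕ} (hC : Repr C σ.U) (i a T t f : ℕ) (S : List Ty.wset.Val) (l : List Ty.msg.Val)
    (hS : Summ I e s σ.c σ.v σ.k σ.U C ω (gatherP.ev W (s, l)) L) :
    ∃ τ C' f', Next I e s L ω σ τ ∧ Repr C' τ.U ∧
      finishP.ev W (mkState f (σ.X.map Fin.val) ((i, (a, (T, s))), (e, S)) t
        (σ.c, (σ.k, (σ.v, C))), l) =
      (mkState f' (τ.X.map Fin.val) ((i, (a, (T, s))), (e, S)) 0 (τ.c, (τ.k, (τ.v, C'))), []) ∧
      (f' ≠ 0 ↔ σ.U = Finset.univ) := by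
  classical
  set x := gatherP.ev W (s, l) with hx
  obtain ⟨L', hL', hsm⟩ := exists_map_cellOf x.2 hS.mem
  obtain ⟨C', hp, hC'⟩ := picks_spec (I := I) (e := e) (c := σ.c) (k := σ.k) (v := σ.v) hC hW hmW L'
    C σ.U σ.X hC le_rfl
  have hpot : x.1.2.1 = pot I e σ.c σ.v σ.U := by
    rw [hS.sum]
    unfold pot
    rw [← List.sum_toFinset _ hnd]
    congr 1; ext l; simp [hL]
  refine ⟨⟨(L'.foldl (gstep I e σ.c σ.v) (σ.U, σ.X)).1, (L'.foldl (gstep I e σ.c σ.v) (σ.U, σ.X)).2,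
    if 1 ≤ pot I e σ.c σ.v σ.U then σ.c else x.1.1,
    if 1 ≤ pot I e σ.c σ.v σ.U then σ.v else x.1.2.2.1, pot I e σ.c σ.v σ.U - σ.k⟩, C',
    bit (x.1.1 ≤ 0),
    ⟨?_, ?_, ?_⟩, hC', ?_, ?_⟩
  rotate_left 3
  · rw [finishP_ev (hW := hW), ← hx, hpot]
    have : picks W e (σ.c, (σ.k, (σ.v, C))) (σ.X.map Fin.val) x.2 =
        (C', (L'.foldl (gstep I e σ.c σ.v) (σ.U, σ.X)).2.map Fin.val) := by
      rw [hL']; exact hp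
    rw [this]
  · rw [Ne, bit_eq_zero, not_not]
    have hx0 : (x.1.1 : ℕ) ≤ 0 ↔ ∀ l, res I σ.U l = 0 := by
      constructor
      · intro h0 l
        have h1 := hS.max l (hL l)
        have h0' : x.1.1 = (0 : ℕ) := Nat.le_zero.1 h0
        rw [h0'] at h1
        have h2 := hS.pos
        simp only [Nat.cast_zero, zero_mul] at h1
        have h3 : (res I σ.U l : ℝ) ≤ 0 := nonpos_of_mul_nonpos_left h1 h2
        exact_mod_cast le_antisymm h3 (Nat.cast_nonneg _)
      · intro h
        rcases hS.att with h1 | ⟨l, h1, -⟩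
        · exact Nat.le_zero.2 h1
        · have e2 : x.1.1 = (0 : ℕ) := h1.trans (h l)
          exact Nat.le_zero.2 e2
    rw [hx0]
    constructor
    · intro h
      refine Finset.eq_univ_iff_forall.2 fun j => ?_
      obtain ⟨l, hl⟩ := I.exists_mem j
      have := h l
      unfold res at this
      rw [Finset.card_eq_zero, Finset.sdiff_eq_empty_iff_subset] at this
      exact this hl
    · intro h l
      simp [res, h]
  · refine ⟨L', hsm, fun h => ?_, fun h => ?_, rfl⟩
    · have := hS.full h
      rw [hL'] at this
      exact List.map_injective_iff.2 cellOf_injective this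
    · have := hS.ne h
      rintro rfl
      exact this hL'
  · intro h0
    have h1 : ¬ 1 ≤ pot I e σ.c σ.v σ.U := by omega
    simp only [h1, if_false]
    refine ⟨fun l => hS.max l (hL l), hS.pos, by omega, hS.att⟩
  · intro h0
    have h1 : 1 ≤ pot I e σ.c σ.v σ.U := by omega
    simp only [h1, if_true, and_self]

end transition

/-! ### Expectations -/

section expect

variable {α β γ : Type*}

/-- The expectation of a nonnegative function. -/
noncomputable def expect (p : PMF α) (f : α → ENNReal) : ENNReal := ∑' x, p x * f x

theorem expect_pure (x : α) (f : α → ENNReal) : expect (PMF.pure x) f = f x := by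
  unfold expect
  rw [tsum_eq_single x]
  · simp
  · intro y hy; simp [PMF.pure_apply, hy]

theorem expect_bind (p : PMF α) (g : α → PMF β) (f : β → ENNReal) :
    expect (p.bind g) f = expect p fun x => expect (g x) f := by
  unfold expect
  simp only [PMF.bind_apply, ← ENNReal.tsum_mul_right, ← ENNReal.tsum_mul_left]
  rw [ENNReal.tsum_comm]
  simp only [mul_assoc]

theorem expect_map (p : PMF α) (g : α → β) (f : β → ENNReal) :
    expect (p.map g) f = expect p fun x => f (g x) := by
  rw [PMF.map, expect_bind]
  simp only [Function.comp, expect_pure]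

theorem expect_mono {p : PMF α} {f g : α → ENNReal} (h : ∀ x ∈ p.support, f x ≤ g x) :
    expect p f ≤ expect p g := by
  refine ENNReal.tsum_le_tsum fun x => ?_
  by_cases hx : p x = 0
  · simp [hx]
  · exact mul_le_mul_right (h x ((PMF.mem_support_iff _ _).2 hx)) _

theorem expect_const (p : PMF α) (c : ENNReal) : expect p (fun _ => c) = c := by
  unfold expect
  rw [ENNReal.tsum_mul_right, p.tsum_coe, one_mul]

theorem expect_le {p : PMF α} {f : α → ENNReal} {c : ENNReal} (h : ∀ x ∈ p.support, f x ≤ c) :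
    expect p f ≤ c :=
  (expect_mono h).trans (expect_const p c).le

theorem expect_mul_left (p : PMF α) (f : α → ENNReal) (c : ENNReal) :
    expect p (fun x => c * f x) = c * expect p f := by
  unfold expect
  rw [← ENNReal.tsum_mul_left]
  exact tsum_congr fun x => by ring

theorem expect_add (p : PMF α) (f g : α → ENNReal) :
    expect p (fun x => f x + g x) = expect p f + expect p g := by
  unfold expect
  rw [← ENNReal.tsum_add]
  exact tsum_congr fun x => by ring

theorem expect_comm (p : PMF α) (q : PMF β) (f : α → β → ENNReal) :
    (expect p fun x => expect q fun y => f x y) = expect q fun y => expect p fun x => f x y := by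
  unfold expect
  simp only [← ENNReal.tsum_mul_left]
  rw [ENNReal.tsum_comm]
  exact tsum_congr fun y => tsum_congr fun x => by ring

theorem map_congr_support {p : PMF α} {f g : α → β} (h : ∀ x ∈ p.support, f x = g x) :
    p.map f = p.map g := by
  ext b
  simp only [PMF.map_apply]
  refine tsum_congr fun x => ?_
  by_cases hx : p x = 0
  · simp [hx]
  · rw [h x ((PMF.mem_support_iff _ _).2 hx)]

end expect

/-! ### Independent random variables -/

section independent

variable {β γ : Type} {M : ℕ}

theorem independent_pure : ∀ {M : ℕ} (y : Fin M → β),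
    independent (fun i => PMF.pure (y i)) = PMF.pure y
  | 0, y => by
      simp only [independent]; congr 1; funext i; exact i.elim0
  | M + 1, y => by
      simp only [independent, PMF.pure_bind]
      rw [independent_pure fun i : Fin M => y i.succ, PMF.pure_map]
      congr 1
      exact Fin.cons_self_tail y

theorem independent_map : ∀ {M : ℕ} (p : Fin M → PMF β) (g : Fin M → β → γ),
    independent (fun i => (p i).map (g i)) = (independent p).map fun f i => g i (f i)
  | 0, p, g => by
      simp only [independent, PMF.pure_map]; congr 1; funext i; exact i.elim0
  | M + 1, p, g => by
      simp only [independent]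
      rw [independent_map (fun i : Fin M => p i.succ) fun i => g i.succ]
      simp only [PMF.bind_map, PMF.map_bind, PMF.map_comp]
      congr 1
      funext y
      simp only [Function.comp]
      congr 1
      funext f
      funext i
      refine Fin.cases ?_ (fun i => ?_) i <;> simp [Function.comp]

theorem mem_support_independent : ∀ {M : ℕ} {p : Fin M → PMF β} {f : Fin M → β},
    f ∈ (independent p).support → ∀ i, f i ∈ (p i).support
  | 0, _, _, _, i => i.elim0
  | M + 1, p, f, h, i => by
      simp only [independent, PMF.mem_support_bind_iff, PMF.mem_support_map_iff] at h
      obtain ⟨y, hy, g, hg, rfl⟩ := h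
      refine Fin.cases ?_ (fun i => ?_) i
      · simpa using hy
      · simpa using mem_support_independent hg i

/-- A substitute for conditioning on the other coordinates: if redrawing coordinate `i` preserves
its own distribution, then it preserves the joint one. -/
theorem independent_resample : ∀ {M : ℕ} (p : Fin M → PMF β) (κ : β → PMF β) (i : Fin M),
    p i = (p i).bind κ → independent p =
      (independent p).bind fun f => (κ (f i)).map fun y => Function.update f i y
  | 0, _, _, i, _ => i.elim0
  | M + 1, p, κ, i, h => by
      refine Fin.cases (fun h => ?_) (fun i h => ?_) i h
      · simp only [independent, PMF.bind_bind, PMF.bind_map, Function.comp_def, Fin.cons_zero]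
        have e1 : ∀ (y : β) (f : Fin M → β) (z : β),
            Function.update (Fin.cons y f : Fin (M + 1) → β) 0 z = Fin.cons z f := fun y f z => by
          rw [Fin.update_cons_zero]
        simp only [e1]
        conv_lhs => rw [h, PMF.bind_bind]
        congr 1
        funext y
        simp only [PMF.map, Function.comp_def]
        rw [PMF.bind_comm]
      · simp only [independent, PMF.bind_bind, PMF.bind_map, Function.comp_def, Fin.cons_succ]
        congr 1
        funext y
        conv_lhs => rw [independent_resample (fun i => p i.succ) κ i h]
        simp only [PMF.map_bind, PMF.map_comp, Function.comp_def]
        congr 1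
        funext f
        congr 1
        funext z
        rw [Fin.cons_update]

end independent

/-! ### Coins -/

section coins

variable {n : ℕ}

/-- A uniformly random element of `{0, …, k}`. -/
noncomputable def unif (k : ℕ) : PMF ℕ :=
  PMF.uniformOfFinset (Finset.range (k + 1)) (by simp)

theorem mem_support_unif {k r : ℕ} : r ∈ (unif k).support ↔ r ≤ k := by
  simp [unif]

/-- Random values for the coins in a list. -/
noncomputable def coins (k : ℕ) : (Fin n → ℕ) → List (Fin n) → PMF (Fin n → ℕ)
  | ω, [] => PMF.pure ω
  | ω, l :: L => (unif k).bind fun r => coins k (Function.update ω l r) L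

theorem coins_eq_of_notMem {k : ℕ} : ∀ {L : List (Fin n)} {ω ω' : Fin n → ℕ} {l : Fin n}, l ∉ L →
    ω' ∈ (coins k ω L).support → ω' l = ω l
  | [], ω, ω', l, _, h => by
      simp only [coins, PMF.support_pure, Set.mem_singleton_iff] at h; rw [h]
  | l' :: L, ω, ω', l, hl, h => by
      simp only [coins, PMF.mem_support_bind_iff] at h
      obtain ⟨r, -, h⟩ := h
      rw [coins_eq_of_notMem (fun h => hl (by simp [h])) h,
        Function.update_of_ne (fun h => hl (by simp [h]))]

theorem coins_le {k : ℕ} : ∀ {L : List (Fin n)} {ω ω' : Fin n → ℕ}, (∀ l, ω l ≤ k) →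
    ω' ∈ (coins k ω L).support → ∀ l, ω' l ≤ k
  | [], ω, ω', hω, h => by
      simp only [coins, PMF.support_pure, Set.mem_singleton_iff] at h; rw [h]; exact hω
  | l' :: L, ω, ω', hω, h => by
      simp only [coins, PMF.mem_support_bind_iff] at h
      obtain ⟨r, hr, h⟩ := h
      refine coins_le (fun l => ?_) h
      by_cases hl : l = l'
      · subst hl; simpa using mem_support_unif.1 hr
      · rw [Function.update_of_ne hl]; exact hω l

theorem coins_map_update {k : ℕ} : ∀ {L : List (Fin n)} {ω : Fin n → ℕ} {l : Fin n} (r : ℕ),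
    l ∉ L → (coins k ω L).map (fun ω' => Function.update ω' l r) =
      coins k (Function.update ω l r) L
  | [], ω, l, r, _ => by simp [coins, PMF.pure_map]
  | l' :: L, ω, l, r, hl => by
      simp only [coins, PMF.map_bind]
      congr 1
      funext r'
      rw [coins_map_update r fun h => hl (by simp [h]),
        Function.update_comm fun h => hl (by simp [h])]

theorem coins_resample {k : ℕ} : ∀ {L : List (Fin n)} {ω : Fin n → ℕ} {l : Fin n}, L.Nodup →
    l ∈ L → coins k ω L = (coins k ω L).bind fun ω' =>
      (unif k).map fun r => Function.update ω' l r
  | [], _, _, _, h => by simp at h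
  | l' :: L, ω, l, hn, hl => by
      rw [List.nodup_cons] at hn
      simp only [coins, PMF.bind_bind]
      by_cases h : l = l'
      · subst h
        have e : ∀ r, ((coins k (Function.update ω l r) L).bind fun ω' =>
            (unif k).map fun r => Function.update ω' l r) =
            (unif k).bind fun r' => coins k (Function.update ω l r') L := by
          intro r
          simp only [PMF.map]
          rw [PMF.bind_comm]
          congr 1
          funext r'
          have := coins_map_update (k := k) (ω := Function.update ω l r) r' hn.1
          rw [Function.update_idem] at this
          exact this
        simp only [e]
        rw [PMF.bind_const]
      · have hl' : l ∈ L := by simpa [h] using hl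
        congr 1
        funext r
        exact coins_resample hn.2 hl'

open Prog in
theorem vals_drawP {m : ℕ} (I : SetCover m n) (W k : ℕ) (L : List (Fin n)) (hL : L.Nodup) :
    drawP.vals W (k, L.map (triple I)) =
      (coins k 0 L).map fun ω => L.reverse.map fun l => (ω l, triple I l) := by
  set body : Prog (.prod (.prod .nat (.list (.prod .nat .wset))) .wset)
      (.list (.prod .nat .wset)) :=
    consOf (((fst.comp fst).comp rand).pair snd) (fst.comp snd) with hbody
  have hb : ∀ (y : List (Ty.prod .nat .wset).Val) (z : Ty.wset.Val),
      (body.run W ((k, y), z)).map Outcome.val = (unif k).map fun r => (r, z) :: y := by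
    intro y z
    simp only [hbody, Prog.run, elementary, PMF.map_bind, PMF.pure_bind, PMF.bind_bind,
      PMF.pure_map]
    rfl
  have key : ∀ (L : List (Fin n)), L.Nodup → ∀ (ω : Fin n → ℕ)
      (acc : List (Ty.prod .nat .wset).Val),
      (iterate (.list (.prod .nat .wset)) (fun y z => body.run W ((k, y), z))
        (L.map (triple I)) acc).map Outcome.val =
        (coins k ω L).map fun ω' => (L.reverse.map fun l => (ω' l, triple I l)) ++ acc := by
    intro L
    induction L with
    | nil => intro _ ω acc; simp [iterate, coins, PMF.pure_map]
    | cons l L ih =>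
      intro hn ω acc
      rw [List.nodup_cons] at hn
      simp only [List.map_cons, iterate, coins, PMF.map_bind, PMF.pure_map]
      have e1 : ∀ o : Outcome (Ty.list (.prod .nat .wset)).Val,
          ((iterate (.list (.prod .nat .wset)) (fun y z => body.run W ((k, y), z))
            (L.map (triple I)) o.val).bind fun o' => PMF.pure o'.val) =
          (iterate (.list (.prod .nat .wset)) (fun y z => body.run W ((k, y), z))
            (L.map (triple I)) o.val).map Outcome.val := fun o => rfl
      simp only [e1]
      have e2 : ((body.run W ((k, acc), triple I l)).bind fun o =>
          (iterate (.list (.prod .nat .wset)) (fun y z => body.run W ((k, y), z))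
            (L.map (triple I)) o.val).map Outcome.val) =
          ((body.run W ((k, acc), triple I l)).map Outcome.val).bind fun y =>
            (iterate (.list (.prod .nat .wset)) (fun y z => body.run W ((k, y), z))
            (L.map (triple I)) y).map Outcome.val := by
        rw [PMF.bind_map]; rfl
      rw [e2, hb, PMF.bind_map]
      congr 1
      funext r
      simp only [Function.comp]
      rw [ih hn.2 (Function.update ω l r)]
      refine map_congr_support fun ω' hω' => ?_
      have := coins_eq_of_notMem hn.1 hω'
      rw [Function.update_self] at this
      simp [this]
  have h := key L hL 0 []
  simp only [List.append_nil] at h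
  rw [← h]
  unfold drawP
  rw [Prog.vals_comp, Prog.vals_det W ((fst.pair nil).pair snd : Prog (.prod .nat (.list .wset)) _)
    rfl, PMF.pure_bind]
  simp only [Prog.vals, Prog.run, PMF.map_comp]
  rfl

/-- The joint distribution of all coins, if the set `l` is stored on machine `loc l`. -/
noncomputable def allCoins {M : ℕ} (loc : Fin n → Fin M) (k : ℕ) : PMF (Fin n → ℕ) :=
  (independent fun i : Fin M =>
    coins k 0 ((List.finRange n).filter fun l => loc l = i)).map fun f l => f (loc l) l

theorem nodup_stored {M : ℕ} (loc : Fin n → Fin M) (i : Fin M) :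
    ((List.finRange n).filter fun l => loc l = i).Nodup :=
  (List.nodup_finRange n).filter _

theorem allCoins_le {M : ℕ} {loc : Fin n → Fin M} {k : ℕ} {ω : Fin n → ℕ}
    (h : ω ∈ (allCoins loc k).support) (l : Fin n) : ω l ≤ k := by
  simp only [allCoins, PMF.mem_support_map_iff] at h
  obtain ⟨f, hf, rfl⟩ := h
  exact coins_le (by simp) (mem_support_independent hf (loc l)) l

theorem allCoins_resample {M : ℕ} (loc : Fin n → Fin M) (k : ℕ) (l : Fin n) :
    allCoins loc k = (allCoins loc k).bind fun ω =>
      (unif k).map fun r => Function.update ω l r := by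
  unfold allCoins
  conv_lhs => rw [independent_resample _ (fun ω => (unif k).map fun r => Function.update ω l r)
    (loc l) (coins_resample (nodup_stored loc _) (by simp))]
  simp only [PMF.map_bind, PMF.bind_map, PMF.map_comp]
  congr 1
  funext f
  simp only [Function.comp_def]
  congr 1
  funext r l'
  by_cases h : l' = l
  · subst h; simp
  · by_cases h' : loc l' = loc l
    · rw [h']; simp [h]; rw [h']
    · simp [h, h']

/-- All that is used of the independence of the coins: any single coin may be averaged over
separately. -/
theorem expect_allCoins {M : ℕ} (loc : Fin n → Fin M) (k : ℕ) (l : Fin n)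
    (f : (Fin n → ℕ) → ENNReal) :
    expect (allCoins loc k) f =
      expect (allCoins loc k) fun ω => expect (unif k) fun r => f (Function.update ω l r) := by
  conv_lhs => rw [allCoins_resample loc k l, expect_bind]
  simp only [expect_map]

end coins

/-! ### The tree of machines -/

section lists

theorem filter_finRange_eq {M : ℕ} (i : Fin M) :
    ((List.finRange M).filter fun j => j = i) = [i] := by
  have := List.filter_eq (l := List.finRange M) i
  rw [List.count_eq_one_of_mem (List.nodup_finRange M) (List.mem_finRange i)] at this
  exact this

theorem flatMap_ite_singleton {α β : Type*} (l : List α) (p : α → Prop) [DecidablePred p]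
    (g : α → β) :
    (l.flatMap fun x => if p x then [g x] else []) = (l.filter p).map g := by
  induction l with
  | nil => rfl
  | cons x l ih =>
    rw [List.flatMap_cons, ih, List.filter_cons]
    by_cases h : p x <;> simp [h]

theorem filter_range_eq (k j : ℕ) (h : j < k) : ((List.range k).filter fun x => x = j) = [j] := by
  have := List.filter_eq (l := List.range k) j
  rw [List.count_eq_one_of_mem List.nodup_range (List.mem_range.2 h)] at this
  exact this

theorem length_filter_div {M a : ℕ} (ha : 1 ≤ a) (i : ℕ) :
    ((List.finRange M).filter fun j => j.val / a = i).length ≤ a := by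
  have h1 : (((List.finRange M).filter fun j => j.val / a = i).map Fin.val).Nodup :=
    ((List.nodup_finRange M).filter _).map Fin.val_injective
  rw [← List.length_map (f := Fin.val), ← List.toFinset_card_of_nodup h1]
  refine (Finset.card_le_card (t := Finset.Ico (a * i) (a * i + a)) fun x hx => ?_).trans
    (by simp)
  simp only [List.mem_toFinset, List.mem_map, List.mem_filter, decide_eq_true_eq] at hx
  obtain ⟨j, ⟨-, hj⟩, rfl⟩ := hx
  rw [Nat.div_eq_iff ha] at hj
  rw [Finset.mem_Ico]
  rw [mul_comm a i]
  omega

end lists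

section tree

variable {n M : ℕ}

/-- The sets stored on a machine. -/
def storedOn (loc : Fin n → Fin M) (i : Fin M) : List (Fin n) :=
  (List.finRange n).filter fun l => loc l = i

/-- The machines that send to machine `i`. -/
def children (M a i : ℕ) : List (Fin M) := (List.finRange M).filter fun j => j.val / a = i

/-- The sets described by the message that machine `i` sends after `r` upward rounds. -/
def tree (loc : Fin n → Fin M) (a : ℕ) : ℕ → Fin M → List (Fin n)
  | 0, i => joinLists [] ((storedOn loc i).reverse.map fun l => [l])
  | r + 1, i => joinLists [] ((children M a i).map (tree loc a r))

theorem count_joinLists_nil (Ls : List (List (Fin n))) (l : Fin n) :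
    (joinLists [] Ls).count l = (Ls.map (List.count l)).sum := by
  rw [(joinLists_perm Ls []).count_eq, List.nil_append, List.count_flatten]

theorem sum_map_ite_eq_count {α : Type*} [DecidableEq α] (L : List α) (x : α) :
    (L.map fun j => if j = x then 1 else 0).sum = L.count x := by
  induction L with
  | nil => rfl
  | cons y L ih => rw [List.map_cons, List.sum_cons, ih, List.count_cons, add_comm]; simp

/-- A machine passes its message to machine `i / a`, so `r` steps lead from `i` to `i / a ^ r`. The
root is its own parent, hence nothing is lost, and once `M ≤ a ^ r` every set has arrived there
exactly once. -/
theorem count_tree (loc : Fin n → Fin M) (a : ℕ) (l : Fin n) : ∀ (r : ℕ) (i : Fin M),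
    (tree loc a r i).count l = if (loc l).val / a ^ r = i.val then 1 else 0
  | 0, i => by
      rw [tree, (joinLists_perm _ []).count_eq, List.nil_append]
      have e : ((storedOn loc i).reverse.map fun l => [l]).flatten = (storedOn loc i).reverse := by
        rw [← List.flatMap_def]; simp
      rw [e, List.count_reverse, pow_zero, Nat.div_one]
      by_cases h : (loc l).val = i.val
      · rw [if_pos h]
        exact List.count_eq_one_of_mem (nodup_stored loc i) (by simp [storedOn, Fin.ext_iff, h])
      · rw [if_neg h]
        exact List.count_eq_zero.2 (by simp [storedOn, Fin.ext_iff, h])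
  | r + 1, i => by
      rw [tree, count_joinLists_nil, List.map_map]
      have e : (List.count l ∘ tree loc a r) = fun j : Fin M =>
          if (loc l).val / a ^ r = j.val then 1 else 0 := by
        funext j; exact count_tree loc a l r j
      rw [e]
      set j₀ : Fin M := ⟨(loc l).val / a ^ r, (Nat.div_le_self _ _).trans_lt (loc l).2⟩ with hj
      have e2 : (fun j : Fin M => if (loc l).val / a ^ r = j.val then 1 else 0) =
          fun j : Fin M => if j = j₀ then 1 else 0 := by
        funext j; simp [hj, Fin.ext_iff, eq_comm]
      rw [e2, sum_map_ite_eq_count, pow_succ, ← Nat.div_div_eq_div_mul]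
      by_cases h : (loc l).val / a ^ r / a = i.val
      · rw [if_pos h]
        exact List.count_eq_one_of_mem ((List.nodup_finRange M).filter _) (by simp [children, hj, h])
      · rw [if_neg h]
        exact List.count_eq_zero.2 (by simp [children, hj, h])

theorem nodup_tree (loc : Fin n → Fin M) (a r : ℕ) (i : Fin M) : (tree loc a r i).Nodup := by
  rw [List.nodup_iff_count_le_one]
  intro l
  rw [count_tree]
  split_ifs <;> omega

theorem mem_tree (loc : Fin n → Fin M) (a r : ℕ) (i : Fin M) (l : Fin n) :
    l ∈ tree loc a r i ↔ (loc l).val / a ^ r = i.val := by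
  rw [← List.count_pos_iff, count_tree]
  split_ifs <;> simp_all

theorem nodup_children_flatten (loc : Fin n → Fin M) (a r : ℕ) (i : Fin M) :
    ((children M a i).map (tree loc a r)).flatten.Nodup := by
  have := (joinLists_perm ((children M a i).map (tree loc a r)) []).nodup_iff.1
    (nodup_tree loc a (r + 1) i)
  simpa using this

theorem nodup_singletons_flatten (loc : Fin n → Fin M) (i : Fin M) :
    ((storedOn loc i).reverse.map fun l => [l]).flatten.Nodup := by
  have := (joinLists_perm ((storedOn loc i).reverse.map fun l => [l]) []).nodup_iff.1
    (nodup_tree loc 0 0 i)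
  simpa using this

theorem sum_actRes_le {m : ℕ} {I : SetCover m n} {e : ℝ} {c : ℕ} {v : ℝ} {U : Finset (Fin m)}
    {L : List (Fin n)} (h : L.Nodup) : (L.map (actRes I e c v U)).sum ≤ I.totalCard := by
  rw [← List.sum_toFinset _ h]
  refine le_trans ?_ (pot_le_totalCard (e := e) c v U)
  exact Finset.sum_le_univ_sum_of_nonneg fun _ => Nat.zero_le _

end tree

/-! ### Delivery -/

section delivery

variable {M : ℕ}

theorem deliver_up {a : ℕ} (out : Fin M → List (ℕ × Ty.msg.Val)) (g : Fin M → Ty.msg.Val)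
    (h : ∀ j, out j = [(j.val / a, g j)]) (i : Fin M) :
    coverAlgorithm.deliver out i = (children M a i).map g := by
  have e : ∀ j : Fin M, ((out j).filter fun msg => msg.1 = i.val).map Prod.snd =
      if j.val / a = i.val then [g j] else [] := by
    intro j
    rw [h]
    by_cases hj : j.val / a = i.val <;> simp [hj]
  unfold Algorithm.deliver children
  refine Eq.trans ?_ (flatMap_ite_singleton (List.finRange M) (fun j => j.val / a = i.val) g)
  congr 1
  funext j
  exact e j

/-- By division with remainder, `i` lies in the block `a j, …, a j + a - 1` for exactly one `j`,
namely `i / a`. Messages to addresses from `M` on are lost, which is harmless; `hW` prevents them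
from wrapping around to existing machines. -/
theorem deliver_down {W a : ℕ} (ha : 1 ≤ a) (hW : a * M + a < W)
    (out : Fin M → List (ℕ × Ty.msg.Val)) (g : Fin M → Ty.cell.Val)
    (h : ∀ j, out j = sendsP.ev W (((a, j.val), g j), a)) (i : Fin M) :
    coverAlgorithm.deliver out i =
      [(g ⟨i.val / a, (Nat.div_le_self _ _).trans_lt i.2⟩, [])] := by
  have e : ∀ j : Fin M, ((out j).filter fun msg => msg.1 = i.val).map Prod.snd =
      if j = ⟨i.val / a, (Nat.div_le_self _ _).trans_lt i.2⟩ then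
        [((g j, []) : Ty.msg.Val)] else [] := by
    intro j
    have hj : a * j.val + a ≤ a * M := by
      have := j.2
      calc a * j.val + a = a * (j.val + 1) := by ring
        _ ≤ _ := Nat.mul_le_mul_left _ this
    have e1 : (List.range a).map (fun k => (((a * j.val) % W + k) % W, ((g j, []) : Ty.msg.Val))) =
        (List.range a).map fun k => (a * j.val + k, ((g j, []) : Ty.msg.Val)) := by
      refine List.map_congr_left fun k hk => ?_
      have := List.mem_range.1 hk
      rw [Nat.mod_eq_of_lt (by omega : a * j.val < W), Nat.mod_eq_of_lt (by omega)]
    rw [h, sendsP_ev, e1, List.filter_reverse, List.filter_map, List.map_reverse, List.map_map]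
    by_cases hi : j = ⟨i.val / a, (Nat.div_le_self _ _).trans_lt i.2⟩
    · rw [if_pos hi]
      have h2 : j.val = i.val / a := by rw [hi]
      have e2 : ((List.range a).filter
          ((fun msg : ℕ × Ty.msg.Val => decide (msg.1 = i.val)) ∘
            fun k => (a * j.val + k, ((g j, []) : Ty.msg.Val)))) = [i.val % a] := by
        rw [← filter_range_eq a (i.val % a) (Nat.mod_lt _ ha)]
        refine List.filter_congr fun k _ => ?_
        have := Nat.div_add_mod i.val a
        simp only [Function.comp, h2, decide_eq_decide]
        omega
      rw [e2]; rfl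
    · rw [if_neg hi]
      have e2 : ((List.range a).filter
          ((fun msg : ℕ × Ty.msg.Val => decide (msg.1 = i.val)) ∘
            fun k => (a * j.val + k, ((g j, []) : Ty.msg.Val)))) = [] := by
        rw [List.filter_eq_nil_iff]
        intro k hk hk'
        have hk := List.mem_range.1 hk
        simp only [Function.comp, decide_eq_true_eq] at hk'
        apply hi
        apply Fin.ext
        change j.val = i.val / a
        rw [← hk', Nat.mul_add_div ha, Nat.div_eq_of_lt hk, add_zero]
      rw [e2]; rfl
  unfold Algorithm.deliver
  have e3 := flatMap_ite_singleton (List.finRange M)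
    (fun j => j = ⟨i.val / a, (Nat.div_le_self _ _).trans_lt i.2⟩)
    fun j => ((g j, []) : Ty.msg.Val)
  rw [filter_finRange_eq] at e3
  refine Eq.trans ?_ e3
  congr 1
  funext j
  exact e j

end delivery

/-! ### Executions of the protocol -/

section protocol

variable {m n M : ℕ} (I : SetCover m n) (loc : Fin n → Fin M) (e : ℝ) (W a T s : ℕ)

/-- The word size and the shape of the tree are as they should be. -/
structure Admissible (I : SetCover m n) (M W a T s : ℕ) : Prop where
  one_le_arity : 1 ≤ a
  one_le_depth : 1 ≤ T
  le_pow : M ≤ a ^ T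
  le_size : m ≤ 3 * s
  three_lt : 3 < W
  size_lt : 3 * s + m < W
  depth_lt : T + T + 1 < W
  arity_lt : a * M + a < W
  totalCard_lt : I.totalCard < W

/-- The fixed data of a machine. -/
def fixed (i : Fin M) : Ty.static.Val :=
  ((i.val, (a, (T, s))), (e, (storedOn loc i).map (triple I)))

/-- The parameters that describe an abstract state. -/
def par (σ : AState m n) (C : List ℕ) : Ty.cell.Val := (σ.c, (σ.k, (σ.v, C)))

/-- The output list of a machine. -/
def outputOf (σ : AState m n) (i : Fin M) : List ℕ := if i.val = 0 then σ.X.map Fin.val else []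

/-- A configuration in the first phase of an epoch, in which the parameters are distributed. -/
def DownInv (σ : AState m n) (C : List ℕ) (t : ℕ) (c : coverAlgorithm.Config M) : Prop :=
  ∀ i, ∃ f p ms, c i = (mkState f (outputOf σ i) (fixed I loc e a T s i) t p, ms) ∧
    p.2.2.2.length ≤ m ∧ (ms = [] ∨ ∃ p' : Ty.cell.Val, ms = [(p', [])] ∧ p'.2.2.2.length ≤ m) ∧
    (i.val < a ^ t → received p ms = par σ C)

/-- A configuration in the second phase of an epoch, in which the messages are combined. -/
def UpInv (σ : AState m n) (C : List ℕ) (ω : Fin n → ℕ) (r : ℕ) (c : coverAlgorithm.Config M) :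
    Prop :=
  ∃ g : Fin M → Ty.msg.Val,
    (∀ j, Summ I e s σ.c σ.v σ.k σ.U C ω (g j) (tree loc a r j)) ∧
    ∀ i, ∃ f, c i = (mkState f (outputOf σ i) (fixed I loc e a T s i) (T + 1 + r) (par σ C),
      (children M a i).map g)

variable {I loc e W a T s}

theorem summ_gatherP (hA : Admissible I M W a T s) {σ : AState m n} {C : List ℕ}
    (hC : Repr C σ.U) {ω : Fin n → ℕ} {r : ℕ} {g : Fin M → Ty.msg.Val}
    (hg : ∀ j, Summ I e s σ.c σ.v σ.k σ.U C ω (g j) (tree loc a r j)) (i : Fin M) :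
    Summ I e s σ.c σ.v σ.k σ.U C ω (gatherP.ev W (s, (children M a i).map g))
      (tree loc a (r + 1) i) := by
  rw [gatherP_ev, tree]
  refine Summ.foldl hC hA.three_lt hA.size_lt hA.le_size _ _ _ _ ?_ ?_ summ_empty
  · rw [List.forall₂_map_left_iff, List.forall₂_map_right_iff, List.forall₂_same]
    exact fun j _ => hg j
  · rw [List.nil_append]
    exact (sum_actRes_le (nodup_children_flatten loc a r i)).trans_lt hA.totalCard_lt

theorem summ_baseP (hA : Admissible I M W a T s) {σ : AState m n} {C : List ℕ}
    (hC : Repr C σ.U) (ω : Fin n → ℕ) (i : Fin M) :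
    Summ I e s σ.c σ.v σ.k σ.U C ω (baseP.ev W ((s, (e, par σ C)),
      (storedOn loc i).reverse.map fun l => (ω l, triple I l))) (tree loc a 0 i) := by
  rw [baseP_ev, tree]
  refine Summ.foldl hC hA.three_lt hA.size_lt hA.le_size _ _ _ _ ?_ ?_ summ_empty
  · rw [List.map_map, List.forall₂_map_left_iff, List.forall₂_map_right_iff, List.forall₂_same]
    exact fun l _ => summ_toMsgP hC hA.three_lt hA.size_lt hA.le_size l
  · rw [List.nil_append]
    exact (sum_actRes_le (nodup_singletons_flatten loc i)).trans_lt hA.totalCard_lt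

variable [NeZero M]

theorem halted_iff {c : coverAlgorithm.Config M} {f : ℕ} {X : List ℕ} {z : Ty.mem.Val}
    {ms : List Ty.msg.Val} (h : c 0 = (((f, X), z), ms)) : coverAlgorithm.Halted c ↔ f ≠ 0 := by
  unfold Algorithm.Halted; rw [h]

theorem round_of_halted {A : Algorithm} {c : A.Config M} (h : A.Halted c) :
    A.round W c = PMF.pure c := by
  unfold Algorithm.round; rw [if_pos h]

theorem round_of_pure {c : coverAlgorithm.Config M} (hc : ¬ coverAlgorithm.Halted c)
    (o : Fin M → Ty.stepOut.Val) (h : ∀ i, stepP.vals W (c i) = PMF.pure (o i)) :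
    coverAlgorithm.round W c =
      PMF.pure fun i => ((o i).1, coverAlgorithm.deliver (fun j => (o j).2) i) := by
  unfold Algorithm.round
  rw [if_neg hc]
  have e1 : (fun i => (coverAlgorithm.step.run W (c i)).map Outcome.val) =
      fun i => PMF.pure (o i) := funext h
  rw [e1, independent_pure, PMF.pure_map]

theorem length_received {p : Ty.cell.Val} {ms : List Ty.msg.Val} (h : p.2.2.2.length ≤ m)
    (h' : ms = [] ∨ ∃ p' : Ty.cell.Val, ms = [(p', [])] ∧ p'.2.2.2.length ≤ m) :
    (received p ms).2.2.2.length ≤ m := by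
  rcases h' with rfl | ⟨p', rfl, h'⟩
  · exact h
  · exact h'

/-- After `t` rounds the machines below `a ^ t` hold the parameters of the root, and the parent of a
machine below `a ^ (t + 1)` is one of them. The other machines pass on stale parameters, of which
only the length matters. -/
theorem DownInv.step (hA : Admissible I M W a T s) {σ : AState m n} {C : List ℕ} {t : ℕ}
    {c : coverAlgorithm.Config M} (h : DownInv I loc e a T s σ C t c) (ht : t < T)
    (hc : ¬ coverAlgorithm.Halted c) :
    ∃ c', coverAlgorithm.round W c = PMF.pure c' ∧ DownInv I loc e a T s σ C (t + 1) c' ∧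
      ¬ coverAlgorithm.Halted c' := by
  choose f p ms h1 h2 h3 h4 using h
  have hT := hA.depth_lt
  have h3W := hA.three_lt
  have hv : ∀ i, stepP.vals W (c i) = PMF.pure
      (mkState (f i) (outputOf σ i) (fixed I loc e a T s i) (t + 1) (received (p i) (ms i)),
        sendsP.ev W (((a, i.val), received (p i) (ms i)), a)) := by
    intro i
    rw [h1]
    exact vals_stepP_down W _ _ _ _ _ _ _ _ _ _ _ (by omega) (by omega) ht
  refine ⟨_, round_of_pure hc _ hv, fun i => ?_, ?_⟩
  · have hd := deliver_down hA.one_le_arity hA.arity_lt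
      (fun j : Fin M => sendsP.ev W (((a, j.val), received (p j) (ms j)), a))
      (fun j => received (p j) (ms j)) (fun j => rfl) i
    refine ⟨f i, received (p i) (ms i), [(_, [])], Prod.ext rfl hd, length_received (h2 i) (h3 i),
      Or.inr ⟨_, rfl, length_received (h2 _) (h3 _)⟩, fun hi => ?_⟩
    change received (p ⟨i.val / a, _⟩) (ms ⟨i.val / a, _⟩) = _
    refine h4 _ ?_
    change i.val / a < a ^ t
    rw [Nat.div_lt_iff_lt_mul hA.one_le_arity]
    rwa [pow_succ] at hi
  · rw [halted_iff (h1 0)] at hc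
    rw [halted_iff rfl]
    exact hc

theorem DownInv.sample (hA : Admissible I M W a T s) {σ : AState m n} {C : List ℕ}
    (hC : Repr C σ.U) {c : coverAlgorithm.Config M} (h : DownInv I loc e a T s σ C T c)
    (hc : ¬ coverAlgorithm.Halted c) :
    ∃ F, coverAlgorithm.round W c = (allCoins loc (σ.k - 1)).map F ∧
      ∀ ω, UpInv I loc e a T s σ C ω 0 (F ω) ∧ ¬ coverAlgorithm.Halted (F ω) := by
  choose f p ms h1 h2 h3 h4 using h
  have hT := hA.depth_lt
  have h3W := hA.three_lt
  have h5 : ∀ i, received (p i) (ms i) = par σ C := fun i => h4 i (i.2.trans_le hA.le_pow)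
  set g : (Fin n → ℕ) → Fin M → Ty.msg.Val := fun ω i =>
    baseP.ev W ((s, (e, par σ C)), (storedOn loc i).reverse.map fun l => (ω l, triple I l)) with hg
  set o : Fin M → (Fin n → ℕ) → Ty.stepOut.Val := fun i ω =>
    (mkState (f i) (outputOf σ i) (fixed I loc e a T s i) (T + 1) (par σ C),
      [(i.val / a, g ω i)]) with ho
  have hv : ∀ i, stepP.vals W (c i) = (coins (σ.k - 1) 0 (storedOn loc i)).map (o i) := by
    intro i
    rw [h1]
    have := vals_stepP_sample W (f i) (outputOf σ i) i.val a T s e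
      ((storedOn loc i).map (triple I)) (p i) (ms i) (by omega) (by omega)
    refine this.trans ?_
    rw [h5]
    rw [show ((par σ C).2.1 - 1 : ℕ) = σ.k - 1 from rfl, show storedOn loc i = (List.finRange n).filter (fun l => loc l = i) from rfl, vals_drawP I W _ _ (nodup_stored loc i),
      PMF.map_comp]
    rfl
  refine ⟨fun ω i => ((o i ω).1, coverAlgorithm.deliver (fun j => (o j ω).2) i), ?_, fun ω =>
    ⟨⟨g ω, fun j => summ_baseP hA hC ω j, fun i => ⟨f i, ?_⟩⟩, ?_⟩⟩
  · have e1 : (fun i => (coverAlgorithm.step.run W (c i)).map Outcome.val) =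
        fun i => (coins (σ.k - 1) 0 (storedOn loc i)).map (o i) := funext hv
    unfold Algorithm.round
    rw [if_neg hc, e1, independent_map]
    unfold allCoins
    rw [PMF.map_comp, PMF.map_comp]
    congr 1
    funext ψ
    -- A machine looks only at the coins of the sets that it stores. The coin functions of all
    -- machines can thus be glued to one function on the sets.
    have e2 : ∀ i, o i (ψ i) = o i fun l => ψ (loc l) l := by
      intro i
      simp only [ho, hg]
      have e3 : ((storedOn loc i).reverse.map fun l => (ψ i l, triple I l)) =
          (storedOn loc i).reverse.map fun l => (ψ (loc l) l, triple I l) := by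
        refine List.map_congr_left fun l hl => ?_
        have : loc l = i := by simpa [storedOn] using hl
        rw [this]
      rw [e3]
    funext i
    simp only [Function.comp, e2]
  · exact Prod.ext rfl (deliver_up (fun j => (o j ω).2) (g ω) (fun j => rfl) i)
  · rw [halted_iff (h1 0)] at hc
    rw [halted_iff rfl]
    exact hc

theorem UpInv.step (hA : Admissible I M W a T s) {σ : AState m n} {C : List ℕ}
    (hC : Repr C σ.U) {ω : Fin n → ℕ} {r : ℕ} {c : coverAlgorithm.Config M}
    (h : UpInv I loc e a T s σ C ω r c) (hr : r + 1 < T) (hc : ¬ coverAlgorithm.Halted c) :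
    ∃ c', coverAlgorithm.round W c = PMF.pure c' ∧ UpInv I loc e a T s σ C ω (r + 1) c' ∧
      ¬ coverAlgorithm.Halted c' := by
  obtain ⟨g, hg, h⟩ := h
  choose f h1 using h
  have hT := hA.depth_lt
  have h3W := hA.three_lt
  have hv : ∀ i, stepP.vals W (c i) = PMF.pure
      (mkState (f i) (outputOf σ i) (fixed I loc e a T s i) (T + 1 + (r + 1)) (par σ C),
        [(i.val / a, gatherP.ev W (s, (children M a i).map g))]) := by
    intro i
    rw [h1]
    exact vals_stepP_up W _ _ _ _ _ _ _ _ _ _ _ (by omega) (by omega) (by omega) (by omega)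
  refine ⟨_, round_of_pure hc _ hv, ⟨_, summ_gatherP hA hC hg, fun i => ⟨f i, ?_⟩⟩, ?_⟩
  · exact Prod.ext rfl (deliver_up
      (fun j : Fin M => [(j.val / a, gatherP.ev W (s, (children M a j).map g))])
      (fun j => gatherP.ev W (s, (children M a j).map g)) (fun j => rfl) i)
  · rw [halted_iff (h1 0)] at hc
    rw [halted_iff rfl]
    exact hc

/-- All machines run `finishP`, but after `T` steps upwards every set is described at the root and
the trees of the other machines are empty. These machines pick nothing and keep an empty output.
Their flags are irrelevant, and their parameters are overwritten in the next epoch. -/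
theorem UpInv.finish (hA : Admissible I M W a T s) {σ : AState m n} {C : List ℕ}
    (hC : Repr C σ.U) {ω : Fin n → ℕ} {r : ℕ} {c : coverAlgorithm.Config M}
    (h : UpInv I loc e a T s σ C ω r c) (hr : r + 1 = T) (hc : ¬ coverAlgorithm.Halted c) :
    ∃ c' τ C', coverAlgorithm.round W c = PMF.pure c' ∧ DownInv I loc e a T s τ C' 0 c' ∧
      Next I e s (tree loc a T 0) ω σ τ ∧ Repr C' τ.U ∧
      (coverAlgorithm.Halted c' ↔ σ.U = Finset.univ) := by
  obtain ⟨g, hg, h⟩ := h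
  choose f h1 using h
  have hT := hA.depth_lt
  have h3W := hA.three_lt
  have hms := hA.size_lt
  have hCm : C.length ≤ m := hC.length_le.le.trans ((Finset.card_le_univ _).trans (by simp))
  have hS : ∀ i : Fin M, Summ I e s σ.c σ.v σ.k σ.U C ω (gatherP.ev W (s, (children M a i).map g))
      (tree loc a T i) := fun i => hr ▸ summ_gatherP hA hC hg i
  have hmem : ∀ l, l ∈ tree loc a T (0 : Fin M) := fun l => by
    rw [mem_tree, Nat.div_eq_of_lt ((loc l).2.trans_le hA.le_pow)]; simp
  obtain ⟨τ, C', f', hN, hC', hτ, hf'⟩ := finishP_spec (I := I) (e := e) (σ := σ)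
    (by omega) (by omega) hmem (nodup_tree loc a T 0) hC (0 : Fin M).val a T (T + T) (f 0)
    ((storedOn loc (0 : Fin M)).map (triple I)) _ (hS 0)
  have hroot : ∀ i : Fin M, i.val = 0 → i = 0 := fun i hi => Fin.ext (by simpa using hi)
  have hp : ∀ i : Fin M, ∃ f' p', finishP.ev W (mkState (f i) (outputOf σ i)
      (fixed I loc e a T s i) (T + T) (par σ C), (children M a i).map g) =
      (mkState f' (outputOf τ i) (fixed I loc e a T s i) 0 p', []) ∧ p'.2.2.2.length ≤ m ∧
      (i.val = 0 → p' = par τ C' ∧ (f' ≠ 0 ↔ σ.U = Finset.univ)) := by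
    intro i
    by_cases hi : i.val = 0
    · obtain rfl := hroot i hi
      refine ⟨f', par τ C', ?_, ?_, fun _ => ⟨rfl, hf'⟩⟩
      · unfold outputOf
        rw [if_pos hi, if_pos hi]
        exact hτ
      · exact hC'.length_le.le.trans ((Finset.card_le_univ _).trans (by simp))
    · have htree : tree loc a T i = [] := by
        rw [List.eq_nil_iff_forall_not_mem]
        intro l
        rw [mem_tree, Nat.div_eq_of_lt ((loc l).2.trans_le hA.le_pow)]
        exact fun h => hi h.symm
      have hs := hS i
      rw [htree] at hs
      have h0 : (gatherP.ev W (s, (children M a i).map g)).2 = [] := hs.full (by simp)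
      have h := finishP_ev (f i) [] i.val a T s e ((storedOn loc i).map (triple I)) (T + T)
        (par σ C) ((children M a i).map g) (W := W) (by omega)
      rw [h0] at h
      unfold outputOf
      rw [if_neg hi, if_neg hi]
      exact ⟨_, _, h, hCm, fun h => absurd h hi⟩
  choose f₁ p₁ hp1 hp2 hp3 using hp
  have hv : ∀ i, stepP.vals W (c i) = PMF.pure
      (mkState (f₁ i) (outputOf τ i) (fixed I loc e a T s i) 0 (p₁ i), []) := by
    intro i
    rw [h1, ← hp1, show T + 1 + r = T + T by omega]
    exact vals_stepP_finish W _ _ _ _ _ _ _ _ _ _ (by omega) (by omega) hA.one_le_depth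
  refine ⟨_, τ, C', round_of_pure hc _ hv, fun i => ⟨f₁ i, p₁ i, [], Prod.ext rfl ?_, hp2 i,
    Or.inl rfl, fun hi => ?_⟩, hN, hC', ?_⟩
  · unfold Algorithm.deliver
    simp
  · exact (hp3 i (by simpa using hi)).1
  · rw [halted_iff rfl]
    exact (hp3 0 rfl).2

end protocol

/-! ### Tail bounds -/

section process

variable {n M : ℕ} {S : Type*}

/-- The state of a process that is driven by the coins. -/
def process (g : S → Fin n → ℕ → S) (ω : Fin n → ℕ) : S → List (Fin n) → S
  | y, [] => y
  | y, l :: L => process g ω (g y l (ω l)) L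

/-- The product of the weights that a process collects. -/
noncomputable def weightOf (f : S → Fin n → ℕ → ENNReal) (g : S → Fin n → ℕ → S) (ω : Fin n → ℕ) :
    S → List (Fin n) → ENNReal
  | _, [] => 1
  | y, l :: L => f y l (ω l) * weightOf f g ω (g y l (ω l)) L

theorem weightOf_update (f : S → Fin n → ℕ → ENNReal) (g : S → Fin n → ℕ → S) (ω : Fin n → ℕ)
    (l : Fin n) (r : ℕ) : ∀ (L : List (Fin n)) (y : S), l ∉ L →
      weightOf f g (Function.update ω l r) y L = weightOf f g ω y L
  | [], _, _ => rfl
  | l' :: L, y, h => by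
      have h1 : l' ≠ l := fun e => h (by simp [e])
      rw [weightOf, weightOf, Function.update_of_ne h1,
        weightOf_update f g ω l r L _ fun e => h (by simp [e])]

/-- A product of weights that are at most `1` on average is at most `1` on average. -/
theorem expect_weightOf_le (loc : Fin n → Fin M) (k : ℕ) (f : S → Fin n → ℕ → ENNReal)
    (g : S → Fin n → ℕ → S) (hf : ∀ y l, expect (unif k) (f y l) ≤ 1) :
    ∀ (L : List (Fin n)) (y : S), L.Nodup →
      expect (allCoins loc k) (fun ω => weightOf f g ω y L) ≤ 1
  | [], y, _ => (expect_const _ _).le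
  | l :: L, y, h => by
      rw [List.nodup_cons] at h
      rw [expect_allCoins loc k l]
      simp only [weightOf, Function.update_self, weightOf_update f g _ l _ L _ h.1]
      rw [expect_comm]
      simp only [expect_mul_left]
      refine (expect_mono fun r _ => ?_).trans (hf y l)
      exact (mul_le_mul_right (expect_weightOf_le loc k f g hf L _ h.2) _).trans (mul_one _).le

theorem expect_unif_ite {k s : ℕ} (hs : s ≤ k + 1) {A B : ℝ} (hA : 0 ≤ A) (hB : 0 ≤ B) :
    expect (unif k) (fun r => if r < s then ENNReal.ofReal A else ENNReal.ofReal B) =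
      ENNReal.ofReal ((s / (k + 1 : ℕ) : ℝ) * A + (1 - s / (k + 1 : ℕ)) * B) := by
  have hk : (0 : ℝ) < (k + 1 : ℕ) := by positivity
  have hs' : (s : ℝ) ≤ (k + 1 : ℕ) := by exact_mod_cast hs
  have e1 : (fun r => if r < s then ENNReal.ofReal A else ENNReal.ofReal B) =
      fun r => ENNReal.ofReal (if r < s then A else B) := by
    funext r; split_ifs <;> rfl
  have e2 : ((k + 1 : ℕ) : ENNReal)⁻¹ = ENNReal.ofReal (((k + 1 : ℕ) : ℝ)⁻¹) := by
    rw [ENNReal.ofReal_inv_of_pos hk, ENNReal.ofReal_natCast]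
  rw [e1]
  unfold expect unif
  rw [tsum_eq_sum (s := Finset.range (k + 1))]
  · have e3 : ∀ r ∈ Finset.range (k + 1),
        (PMF.uniformOfFinset (Finset.range (k + 1)) (by simp)) r *
          ENNReal.ofReal (if r < s then A else B) =
        ENNReal.ofReal (((k + 1 : ℕ) : ℝ)⁻¹ * if r < s then A else B) := by
      intro r hr
      rw [PMF.uniformOfFinset_apply, if_pos hr, Finset.card_range, e2,
        ← ENNReal.ofReal_mul (by positivity)]
    rw [Finset.sum_congr rfl e3, ← ENNReal.ofReal_sum_of_nonneg]
    · congr 1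
      rw [← Finset.mul_sum, Finset.sum_ite, Finset.sum_const, Finset.sum_const]
      have c1 : ((Finset.range (k + 1)).filter fun r => r < s).card = s := by
        have : ((Finset.range (k + 1)).filter fun r => r < s) = Finset.range s := by
          ext r; simp; omega
        rw [this, Finset.card_range]
      have c2 : ((Finset.range (k + 1)).filter fun r => ¬ r < s).card = k + 1 - s := by
        have := Finset.card_filter_add_card_filter_not (s := Finset.range (k + 1)) (p := fun r => r < s)
        rw [c1, Finset.card_range] at this
        omega
      rw [c1, c2, nsmul_eq_mul, nsmul_eq_mul, Nat.cast_sub hs]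
      field_simp
    · intro r _
      split_ifs <;> positivity
  · intro r hr
    rw [PMF.uniformOfFinset_apply, if_neg hr, zero_mul]

end process

/-! ### Exponential moments for one sampling epoch -/

section tails

theorem exp_neg_le_one_sub_half {y : ℝ} (h0 : 0 ≤ y) (h1 : y ≤ 1) :
    Real.exp (-y) ≤ 1 - y / 2 := by
  rw [Real.exp_neg, inv_le_comm₀ (Real.exp_pos _) (by linarith)]
  have h2 := Real.add_one_le_exp y
  refine le_trans ?_ h2
  rw [inv_le_iff_one_le_mul₀ (by linarith)]
  nlinarith

theorem exp_le_one_add_two_mul {y : ℝ} (h0 : 0 ≤ y) (h1 : y ≤ 1) : Real.exp y ≤ 1 + 2 * y := by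
  have h2 := (le_abs_self _).trans (Real.abs_exp_sub_one_le (x := y) (by rwa [abs_of_nonneg h0]))
  rw [abs_of_nonneg h0] at h2
  linarith

/-- The exponent loses `y` with probability `p` and gains `p y / 2` otherwise. The gain is only half
of the mean loss, and the slack absorbs the convexity of the exponential for `y ≤ 1`. -/
theorem mix_le_one {p y : ℝ} (hp : 0 ≤ p) (hp1 : p ≤ 1) (h0 : 0 ≤ y) (h1 : y ≤ 1) :
    p * Real.exp (-y) + (1 - p) * Real.exp (p * y / 2) ≤ 1 := by
  have a1 := exp_neg_le_one_sub_half h0 h1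
  have hx : p * y / 2 ≤ p / 2 := by nlinarith
  have a2 : Real.exp (p * y / 2) ≤ (1 - p * y / 2)⁻¹ := by
    rw [le_inv_comm₀ (Real.exp_pos _) (by linarith), ← Real.exp_neg]
    have := Real.add_one_le_exp (-(p * y / 2))
    linarith
  have a3 : (1 - p) * (1 - p * y / 2)⁻¹ ≤ 1 - p + p * y / 2 := by
    rw [← div_eq_mul_inv, div_le_iff₀ (by linarith)]
    nlinarith [mul_nonneg hp h0, mul_nonneg (mul_nonneg hp h0) (by linarith : 0 ≤ p - p * y / 2)]
  have a4 : p * Real.exp (-y) ≤ p * (1 - y / 2) := by gcongr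
  have a5 : (1 - p) * Real.exp (p * y / 2) ≤ (1 - p) * (1 - p * y / 2)⁻¹ :=
    mul_le_mul_of_nonneg_left a2 (by linarith)
  linarith

variable {m n M : ℕ} {I : SetCover m n} {e : ℝ}

open Classical in
/-- One step of the process of sampling the sets and picking the sampled sets greedily. -/
noncomputable def sampleStep (I : SetCover m n) (e : ℝ) (c : ℕ) (v : ℝ) (s : ℕ)
    (y : Finset (Fin m) × List (Fin n)) (l : Fin n) (r : ℕ) : Finset (Fin m) × List (Fin n) :=
  if r < s then gstep I e c v y l else y

theorem gstep_of_not_act {c : ℕ} {v : ℝ} {y : Finset (Fin m) × List (Fin n)} {l : Fin n}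
    (h : ¬ Act I e c v y.1 l) : gstep I e c v y l = y := by
  unfold gstep; rw [if_neg h]

theorem gstep_of_act {c : ℕ} {v : ℝ} {y : Finset (Fin m) × List (Fin n)} {l : Fin n}
    (h : Act I e c v y.1 l) : gstep I e c v y l = (y.1 ∪ I.sets l, l :: y.2) := by
  unfold gstep; rw [if_pos h]

theorem subset_sampleStep {c : ℕ} {v : ℝ} {s : ℕ} (y : Finset (Fin m) × List (Fin n)) (l : Fin n)
    (r : ℕ) : y.1 ⊆ (sampleStep I e c v s y l r).1 := by
  unfold sampleStep; split_ifs
  · exact subset_gstep c v y l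
  · exact le_rfl

theorem subset_process {c : ℕ} {v : ℝ} {s : ℕ} {ω : Fin n → ℕ} : ∀ (L : List (Fin n))
    (y : Finset (Fin m) × List (Fin n)), y.1 ⊆ (process (sampleStep I e c v s) ω y L).1
  | [], _ => le_rfl
  | l :: L, y => (subset_sampleStep y l (ω l)).trans (subset_process L _)

-- The protocol samples among the sets active for the initial `U`, whereas the process tests
-- activity when the turn of a set comes. The two agree because a set that is active later was
-- active at the start.
open Classical in
theorem process_eq_foldl {c : ℕ} {v : ℝ} {s k : ℕ} {ω : Fin n → ℕ} (he : 0 < e) (hv : 0 < v)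
    (hk : 1 ≤ k) (U : Finset (Fin m)) : ∀ (L : List (Fin n)) (y : Finset (Fin m) × List (Fin n)),
    U ⊆ y.1 → process (sampleStep I e c v s) ω y L =
      (L.filter (Smp I e s c v k U ω)).foldl (gstep I e c v) y
  | [], _, _ => rfl
  | l :: L, y, h => by
      rw [process, process_eq_foldl he hv hk U L _ (h.trans (subset_sampleStep y l (ω l))),
        List.filter_cons]
      by_cases hS : Smp I e s c v k U ω l
      · have : sampleStep I e c v s y l (ω l) = gstep I e c v y l := by
          unfold sampleStep; rw [if_pos hS.2.2]
        rw [this]; simp [hS]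
      · have : sampleStep I e c v s y l (ω l) = y := by
          unfold sampleStep
          split_ifs with hr
          · exact gstep_of_not_act fun ha => hS ⟨ha.anti he hv h, hk, hr⟩
          · rfl
        rw [this]; simp [hS]

open Classical in
/-- The exponential weights of the greedy process. -/
noncomputable def greedyWeight (I : SetCover m n) (e : ℝ) (c : ℕ) (v : ℝ) (s q : ℕ) (α : ℝ)
    (U : Finset (Fin m)) (y : Finset (Fin m) × List (Fin n)) (l : Fin n) (r : ℕ) : ENNReal :=
  if Act I e c v y.1 l ∧ res I y.1 l ≤ res I U l ∧ res I U l ≤ q * res I y.1 l then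
    if r < s then ENNReal.ofReal (Real.exp (-(res I U l / m)))
    else ENNReal.ofReal (Real.exp (α * res I y.1 l))
  else 1

theorem res_eq_zero_of_subset {U : Finset (Fin m)} {l : Fin n} (h : I.sets l ⊆ U) :
    res I U l = 0 := by
  unfold res; rw [Finset.sdiff_eq_empty_iff_subset.2 h, Finset.card_empty]

theorem actRes_eq_zero {c : ℕ} {v : ℝ} {U : Finset (Fin m)} {l : Fin n}
    (h : ¬ Act I e c v U l) : actRes I e c v U l = 0 := by
  unfold actRes; rw [if_neg h]

theorem actRes_eq_res {c : ℕ} {v : ℝ} {U : Finset (Fin m)} {l : Fin n}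
    (h : Act I e c v U l) : actRes I e c v U l = res I U l := by
  unfold actRes; rw [if_pos h]

/-- Call a set good if, at its turn, it is active and at least a `1 / q` part of its residual set at
the start is still uncovered. A sampled good set costs `res U / m` in the exponent and covers at
least `res U / q` new elements, so these costs are paid by the term with the number of covered
elements. A good set that is not sampled pays for its own contribution to the final potential. All
other sets contribute at most a `1 / q` part of their initial value, which has been subtracted. -/
theorem le_weightOf {c : ℕ} {v : ℝ} {s q : ℕ} {α : ℝ} {ω : Fin n → ℕ} (he : 0 < e) (hv : 0 < v)
    (hq : 1 ≤ q) (hm : 1 ≤ m) (hα : 0 ≤ α) (U : Finset (Fin m)) : ∀ (L : List (Fin n))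
    (y : Finset (Fin m) × List (Fin n)), U ⊆ y.1 →
    ENNReal.ofReal (Real.exp (α * ((L.map fun l =>
        (actRes I e c v (process (sampleStep I e c v s) ω y L).1 l : ℝ) -
          actRes I e c v U l / q).sum) -
        q * (((process (sampleStep I e c v s) ω y L).1.card : ℝ) - y.1.card) / m)) ≤
      weightOf (greedyWeight I e c v s q α U) (sampleStep I e c v s) ω y L
  | [], y, _ => by simp [process, weightOf]
  | l :: L, y, h => by
      set y' := sampleStep I e c v s y l (ω l) with hy'
      have hsub : y.1 ⊆ y'.1 := subset_sampleStep y l (ω l)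
      have ih := le_weightOf (c := c) (s := s) (ω := ω) he hv hq hm hα U L y' (h.trans hsub)
      rw [process, weightOf, ← hy']
      set z := process (sampleStep I e c v s) ω y' L with hz
      have hz' : y'.1 ⊆ z.1 := subset_process L y'
      have hm0 : (0 : ℝ) < m := by exact_mod_cast hm
      have hq0 : (0 : ℝ) < q := by exact_mod_cast hq
      rw [List.map_cons, List.sum_cons]
      have hcard : (y.1.card : ℝ) ≤ y'.1.card := by exact_mod_cast Finset.card_le_card hsub
      -- it suffices to bound the weight of the first step
      suffices hstep : ENNReal.ofReal (Real.exp (α * ((actRes I e c v z.1 l : ℝ) -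
          actRes I e c v U l / q) - q * ((y'.1.card : ℝ) - y.1.card) / m)) ≤
          greedyWeight I e c v s q α U y l (ω l) by
        refine le_trans (le_of_eq ?_) (mul_le_mul' hstep ih)
        rw [← ENNReal.ofReal_mul (Real.exp_pos _).le, ← Real.exp_add]
        congr 2
        ring
      have hanti : actRes I e c v z.1 l ≤ actRes I e c v y.1 l :=
        actRes_anti he hv (hsub.trans hz') l
      have hrest : 0 ≤ q * ((y'.1.card : ℝ) - y.1.card) / m := by
        have : 0 ≤ (y'.1.card : ℝ) - y.1.card := by linarith
        positivity
      have hU0 : (0 : ℝ) ≤ actRes I e c v U l / q := by positivity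
      unfold greedyWeight
      split_ifs with hgood hr
      · obtain ⟨ha, -, hD⟩ := hgood
        have e1 : y' = (y.1 ∪ I.sets l, l :: y.2) := by
          rw [hy']; unfold sampleStep; rw [if_pos hr, gstep_of_act ha]
        have e2 : (y'.1.card : ℝ) - y.1.card = res I y.1 l := by
          have : y'.1.card = y.1.card + res I y.1 l := by
            rw [e1]; unfold res
            rw [← Finset.card_union_of_disjoint Finset.disjoint_sdiff]
            simp
          rw [this]; push_cast; ring
        have e3 : actRes I e c v z.1 l = 0 := by
          have : res I z.1 l = 0 := res_eq_zero_of_subset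
            (Finset.subset_union_right.trans ((by rw [e1] : y.1 ∪ I.sets l ⊆ y'.1).trans hz'))
          have := actRes_le_res (I := I) (e := e) c v z.1 l
          omega
        have hD' : (res I U l : ℝ) ≤ q * res I y.1 l := by exact_mod_cast hD
        rw [e2, e3]
        refine ENNReal.ofReal_le_ofReal (Real.exp_le_exp.2 ?_)
        have : (res I U l : ℝ) / m ≤ q * res I y.1 l / m := by gcongr
        have : 0 ≤ α * (actRes I e c v U l / q) := by positivity
        push_cast
        linarith
      · obtain ⟨ha, -, hD⟩ := hgood
        rw [actRes_eq_res ha] at hanti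
        refine ENNReal.ofReal_le_ofReal (Real.exp_le_exp.2 ?_)
        have h1 : (actRes I e c v z.1 l : ℝ) - actRes I e c v U l / q ≤ res I y.1 l := by
          have : (actRes I e c v z.1 l : ℝ) ≤ res I y.1 l := by exact_mod_cast hanti
          linarith
        have := mul_le_mul_of_nonneg_left h1 hα
        linarith
      · rw [← ENNReal.ofReal_one]
        refine ENNReal.ofReal_le_ofReal ?_
        rw [Real.exp_le_one_iff]
        -- The set is inactive at its turn and stays so, or less than a `1 / q` part of it is left;
        -- in both cases the weight `1` suffices.
        have h1 : (actRes I e c v z.1 l : ℝ) - actRes I e c v U l / q ≤ 0 := by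
          by_cases ha : Act I e c v y.1 l
          · have hD : q * res I y.1 l < res I U l := not_le.1 fun hh => hgood ⟨ha, res_anti h l, hh⟩
            rw [actRes_eq_res ha] at hanti
            rw [actRes_eq_res (ha.anti he hv h), sub_nonpos, le_div_iff₀ hq0]
            have : actRes I e c v z.1 l * q ≤ res I U l := by nlinarith
            exact_mod_cast this
          · have : actRes I e c v z.1 l = 0 := by
              rw [actRes_eq_zero ha] at hanti; omega
            rw [this]; push_cast; linarith
        have := mul_le_mul_of_nonneg_left h1 hα
        linarith

/-- The bound is needed in every state `y`, reachable or not. That is why `greedyWeight` also tests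
`res I y.1 l ≤ res I U l`, which is automatic along the process. The choice `α = p / (2 m)` is the
one that fits `mix_le_one` with `y = res U / m`. -/
theorem expect_greedyWeight_le {c : ℕ} {v : ℝ} {s q k : ℕ} (hs : s ≤ k + 1) (hm : 1 ≤ m)
    (U : Finset (Fin m)) (y : Finset (Fin m) × List (Fin n)) (l : Fin n) :
    expect (unif k) (greedyWeight I e c v s q (s / (k + 1 : ℕ) / (2 * m)) U y l) ≤ 1 := by
  have hm0 : (0 : ℝ) < m := by exact_mod_cast hm
  have hk : (0 : ℝ) < (k + 1 : ℕ) := by positivity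
  have hp1 : (s : ℝ) / (k + 1 : ℕ) ≤ 1 := by
    rw [div_le_one hk]; exact_mod_cast hs
  set p : ℝ := s / (k + 1 : ℕ) with hp
  have hp0 : 0 ≤ p := by positivity
  by_cases hgood : Act I e c v y.1 l ∧ res I y.1 l ≤ res I U l ∧ res I U l ≤ q * res I y.1 l
  · have e1 : greedyWeight I e c v s q (p / (2 * m)) U y l = fun r =>
        if r < s then ENNReal.ofReal (Real.exp (-(res I U l / m)))
        else ENNReal.ofReal (Real.exp (p / (2 * m) * res I y.1 l)) := by
      funext r; unfold greedyWeight; rw [if_pos hgood]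
    rw [e1, expect_unif_ite hs (Real.exp_pos _).le (Real.exp_pos _).le, ← ENNReal.ofReal_one]
    refine ENNReal.ofReal_le_ofReal ?_
    have hy1 : (res I U l : ℝ) / m ≤ 1 := by
      rw [div_le_one hm0]; exact_mod_cast res_le U l
    refine le_trans ?_ (mix_le_one hp0 hp1 (by positivity) hy1)
    have h2 : p / (2 * m) * res I y.1 l ≤ p * (res I U l / m) / 2 := by
      have : (res I y.1 l : ℝ) ≤ res I U l := by exact_mod_cast hgood.2.1
      calc p / (2 * m) * res I y.1 l ≤ p / (2 * m) * res I U l := by gcongr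
        _ = _ := by field_simp
    have h3 := mul_le_mul_of_nonneg_left (Real.exp_le_exp.2 h2) (by linarith : 0 ≤ 1 - p)
    linarith
  · have e1 : greedyWeight I e c v s q (p / (2 * m)) U y l = fun _ => 1 := by
      funext r; unfold greedyWeight; rw [if_neg hgood]
    rw [e1, expect_const]

theorem sum_map_actRes {c : ℕ} {v : ℝ} {U : Finset (Fin m)} {L : List (Fin n)} (hL : ∀ l, l ∈ L)
    (hn : L.Nodup) : (L.map (actRes I e c v U)).sum = pot I e c v U := by
  unfold pot
  rw [← List.sum_toFinset _ hn]
  congr 1; ext l; simp [hL]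

/-- Markov's inequality for exponential weights. -/
theorem expect_indicator_le {α : Type*} {p : PMF α} {B : Set α} {f : α → ENNReal} {x : ℝ}
    (hf : expect p f ≤ 1) (h : ∀ y ∈ B, ENNReal.ofReal (Real.exp x) ≤ f y) :
    expect p (B.indicator 1) ≤ ENNReal.ofReal (Real.exp (-x)) := by
  calc expect p (B.indicator 1) ≤ expect p fun y => ENNReal.ofReal (Real.exp (-x)) * f y := by
        refine expect_mono fun y _ => ?_
        by_cases hy : y ∈ B
        · rw [Set.indicator_of_mem hy]
          refine le_trans (le_of_eq ?_) (mul_le_mul_right (h y hy) _)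
          rw [← ENNReal.ofReal_mul (Real.exp_pos _).le, ← Real.exp_add]
          simp
        · rw [Set.indicator_of_notMem hy]; exact zero_le
    _ ≤ _ := by
        rw [expect_mul_left]
        exact (mul_le_mul_right hf _).trans (mul_one _).le

theorem expect_indicator_union_le {α : Type*} (p : PMF α) (A B : Set α) :
    expect p ((A ∪ B).indicator 1) ≤ expect p (A.indicator 1) + expect p (B.indicator 1) := by
  rw [← expect_add]
  refine expect_mono fun ω _ => ?_
  by_cases hA : ω ∈ A
  · rw [Set.indicator_of_mem (Set.mem_union_left _ hA), Set.indicator_of_mem hA]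
    exact le_self_add
  · by_cases hB : ω ∈ B
    · rw [Set.indicator_of_mem (Set.mem_union_right _ hB), Set.indicator_of_mem hB]
      exact le_add_self
    · rw [Set.indicator_of_notMem fun h => h.elim hA hB]
      exact zero_le

theorem list_sum_map_sub {α : Type*} (f g : α → ℝ) (L : List α) :
    (L.map fun x => f x - g x).sum = (L.map f).sum - (L.map g).sum := by
  induction L with
  | nil => simp
  | cons l L ih => simp only [List.map_cons, List.sum_cons, ih]; ring

variable {L : List (Fin n)}

/-- If the final potential exceeds `2 pot / q`, then it exceeds `pot / q` by at least `pot / q`.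
With `p = s / pot` the exponent gains at least `(p / (2 m)) (pot / q) = s / (2 m q)`, and it loses
at most `q` for the covered elements. -/
theorem greedy_tail (loc : Fin n → Fin M) {c : ℕ} {v : ℝ} {s q k : ℕ} (he : 0 < e) (hv : 0 < v)
    (hq : 1 ≤ q) (hm : 1 ≤ m) (hL : ∀ l, l ∈ L) (hn : L.Nodup) (U : Finset (Fin m))
    (X : List (Fin n)) (hk : pot I e c v U = k + 1) (hs : s ≤ k + 1) :
    expect (allCoins loc k)
      ({ω | 2 * pot I e c v U < q * pot I e c v (process (sampleStep I e c v s) ω (U, X) L).1}.indicator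
        1) ≤ ENNReal.ofReal (Real.exp (-(s / (2 * m * q) - q))) := by
  have hm0 : (0 : ℝ) < m := by exact_mod_cast hm
  have hq0 : (0 : ℝ) < q := by exact_mod_cast hq
  have hk0 : (0 : ℝ) < (k + 1 : ℕ) := by positivity
  refine expect_indicator_le (expect_weightOf_le loc k _ (sampleStep I e c v s)
    (expect_greedyWeight_le (I := I) (e := e) (c := c) (v := v) (q := q) hs hm U) L (U, X) hn)
    fun ω hω => ?_
  refine le_trans (ENNReal.ofReal_le_ofReal (Real.exp_le_exp.2 ?_))
    (le_weightOf he hv hq hm (by positivity) U L (U, X) le_rfl)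
  set z := (process (sampleStep I e c v s) ω (U, X) L).1 with hz
  have e1 : (L.map fun l => (actRes I e c v z l : ℝ) - actRes I e c v U l / q).sum =
      pot I e c v z - pot I e c v U / q := by
    have h1 : ∀ V : Finset (Fin m), (L.map fun l => (actRes I e c v V l : ℝ)).sum =
        pot I e c v V := by
      intro V
      rw [← sum_map_actRes hL hn, Nat.cast_list_sum, List.map_map]; rfl
    have h2 : (L.map fun l => (actRes I e c v U l : ℝ) / q).sum = pot I e c v U / q := by
      rw [← h1 U]
      simp only [div_eq_mul_inv]
      rw [List.sum_map_mul_right]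
    rw [← h1 z, ← h2]
    exact list_sum_map_sub _ _ L
  rw [e1]
  have h3 : (2 * pot I e c v U : ℝ) < q * pot I e c v z := by exact_mod_cast hω
  have h4 : (pot I e c v U : ℝ) / q ≤ pot I e c v z - pot I e c v U / q := by
    rw [le_sub_iff_add_le, ← add_div, div_le_iff₀ hq0]
    linarith
  have h5 : (s : ℝ) / (2 * m * q) ≤ s / (k + 1 : ℕ) / (2 * m) *
      (pot I e c v z - pot I e c v U / q) := by
    refine le_trans (le_of_eq ?_) (mul_le_mul_of_nonneg_left h4 (by positivity))
    rw [hk]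
    field_simp
  -- At most `m` elements can be covered altogether.
  have h6 : q * ((z.card : ℝ) - U.card) / m ≤ q := by
    rw [div_le_iff₀ hm0]
    have : (z.card : ℝ) ≤ m := by
      exact_mod_cast (Finset.card_le_univ z).trans (by simp)
    have : (0 : ℝ) ≤ U.card := by positivity
    gcongr
    linarith
  linarith

-- A Chernoff bound for the total size of the sample in units of `m`. The compensator `2 p y` of
-- each set adds up to `2 s / m`, so a sample larger than `3 s` leaves at least `s / m` in the
-- exponent. Activity refers to the fixed `U` here, hence the trivial state space `Unit`.
open Classical in
theorem overflow_tail (loc : Fin n → Fin M) {c : ℕ} {v : ℝ} {s k : ℕ} (hm : 1 ≤ m)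
    (hL : ∀ l, l ∈ L) (hn : L.Nodup) (U : Finset (Fin m)) (hk : pot I e c v U = k + 1)
    (hs : s ≤ k + 1) :
    expect (allCoins loc k)
      ({ω | 3 * s < ((L.filter (Smp I e s c v (k + 1) U ω)).map (res I U)).sum}.indicator 1) ≤
      ENNReal.ofReal (Real.exp (-(s / m))) := by
  have hm0 : (0 : ℝ) < m := by exact_mod_cast hm
  have hk0 : (0 : ℝ) < (k + 1 : ℕ) := by positivity
  set p : ℝ := s / (k + 1 : ℕ) with hp
  have hp0 : 0 ≤ p := by positivity
  have hp1 : p ≤ 1 := by rw [hp, div_le_one hk0]; exact_mod_cast hs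
  set y : Fin n → ℝ := fun l => (actRes I e c v U l : ℝ) / m with hy
  have hy0 : ∀ l, 0 ≤ y l := fun l => by positivity
  have hy1 : ∀ l, y l ≤ 1 := fun l => by
    rw [hy]; simp only
    rw [div_le_one hm0]
    exact_mod_cast (actRes_le_res c v U l).trans (res_le U l)
  set f : Unit → Fin n → ℕ → ENNReal := fun _ l r =>
    if r < s then ENNReal.ofReal (Real.exp (y l - 2 * p * y l))
    else ENNReal.ofReal (Real.exp (-(2 * p * y l))) with hf
  have hf1 : ∀ u l, expect (unif k) (f u l) ≤ 1 := by
    intro u l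
    rw [hf]; simp only
    rw [expect_unif_ite hs (Real.exp_pos _).le (Real.exp_pos _).le, ← ENNReal.ofReal_one]
    refine ENNReal.ofReal_le_ofReal ?_
    have h1 := exp_le_one_add_two_mul (hy0 l) (hy1 l)
    have h2 : p * Real.exp (y l - 2 * p * y l) + (1 - p) * Real.exp (-(2 * p * y l)) =
        (p * Real.exp (y l) + (1 - p)) * Real.exp (-(2 * p * y l)) := by
      rw [sub_eq_add_neg, Real.exp_add]; ring
    rw [← hp, h2]
    have h3 : p * Real.exp (y l) + (1 - p) ≤ Real.exp (2 * p * y l) := by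
      have := Real.add_one_le_exp (2 * p * y l)
      have := mul_le_mul_of_nonneg_left h1 hp0
      linarith
    calc _ ≤ Real.exp (2 * p * y l) * Real.exp (-(2 * p * y l)) := by gcongr
      _ = 1 := by rw [← Real.exp_add]; simp
  have hprod : ∀ (ω : Fin n → ℕ) (L : List (Fin n)),
      weightOf f (fun u _ _ => u) ω () L =
        ENNReal.ofReal (Real.exp ((((L.filter (Smp I e s c v (k + 1) U ω)).map (res I U)).sum : ℝ) / m -
          2 * p * (L.map y).sum)) := by
    intro ω L
    induction L with
    | nil => simp [weightOf]
    | cons l L ih =>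
      rw [weightOf, ih, hf, List.filter_cons, List.map_cons, List.sum_cons]
      simp only
      by_cases ha : Act I e c v U l
      · have hyl : y l = (res I U l : ℝ) / m := by rw [hy]; simp only [actRes_eq_res ha]
        by_cases hr : ω l < s
        · have hS : Smp I e s c v (k + 1) U ω l := ⟨ha, by omega, hr⟩
          rw [if_pos hr, ← ENNReal.ofReal_mul (Real.exp_pos _).le, ← Real.exp_add]
          simp only [hS, decide_true, if_true, List.map_cons, List.sum_cons, Nat.cast_add]
          congr 2
          rw [hyl]; ring
        · have hS : ¬ Smp I e s c v (k + 1) U ω l := fun h => hr h.2.2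
          rw [if_neg hr, ← ENNReal.ofReal_mul (Real.exp_pos _).le, ← Real.exp_add]
          simp only [hS, decide_false, Bool.false_eq_true, if_false]
          congr 2
          ring
      · have hyl : y l = 0 := by rw [hy]; simp only [actRes_eq_zero ha]; simp
        have hS : ¬ Smp I e s c v (k + 1) U ω l := fun h => ha h.1
        simp only [hyl, hS, decide_false, Bool.false_eq_true, if_false]
        simp
  have h := expect_indicator_le (x := s / m) (B := {ω | 3 * s <
    ((L.filter (Smp I e s c v (k + 1) U ω)).map (res I U)).sum})
    (expect_weightOf_le loc k f (fun u _ _ => u) hf1 L () hn) fun ω hω => ?_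
  · exact h
  · rw [hprod]
    refine ENNReal.ofReal_le_ofReal (Real.exp_le_exp.2 ?_)
    have e1 : (L.map y).sum = (k + 1 : ℕ) / m := by
      rw [hy]
      simp only [div_eq_mul_inv]
      rw [List.sum_map_mul_right, ← hk, ← sum_map_actRes hL hn, Nat.cast_list_sum, List.map_map]
      rfl
    have h2 : (3 * s : ℝ) ≤ (((L.filter (Smp I e s c v (k + 1) U ω)).map (res I U)).sum : ℕ) := by
      exact_mod_cast le_of_lt hω
    rw [e1]
    have e2 : 2 * p * ((k + 1 : ℕ) / m : ℝ) = 2 * (s / m) := by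
      rw [hp]; field_simp
    rw [e2]
    have h3 : 3 * (s / m : ℝ) ≤
        ((((L.filter (Smp I e s c v (k + 1) U ω)).map (res I U)).sum : ℕ) : ℝ) / m := by
      rw [← mul_div_assoc]; gcongr
    linarith

theorem actRes_process_eq_zero {c : ℕ} {v : ℝ} {s : ℕ} {ω : Fin n → ℕ} (he : 0 < e) (hv : 0 < v)
    {l : Fin n} (hl : ω l < s) : ∀ (L : List (Fin n)) (y : Finset (Fin m) × List (Fin n)), l ∈ L →
      actRes I e c v (process (sampleStep I e c v s) ω y L).1 l = 0
  | [], _, h => by simp at h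
  | l' :: L, y, h => by
      rw [process]
      by_cases hll : l = l'
      · subst hll
        have hs : sampleStep I e c v s y l (ω l) = gstep I e c v y l := by
          unfold sampleStep; rw [if_pos hl]
        have hz : actRes I e c v (gstep I e c v y l).1 l = 0 := by
          by_cases ha : Act I e c v y.1 l
          · have := actRes_le_res (I := I) (e := e) c v (gstep I e c v y l).1 l
            rw [gstep_of_act ha] at this ⊢
            rw [res_eq_zero_of_subset Finset.subset_union_right] at this
            omega
          · rw [gstep_of_not_act ha, actRes_eq_zero ha]
        rw [hs]
        have := actRes_anti (I := I) (c := c) he hv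
          (subset_process (I := I) (e := e) (c := c) (v := v) (s := s) (ω := ω) L
            (gstep I e c v y l)) l
        omega
      · exact actRes_process_eq_zero he hv hl L _ (by simpa [hll] using h)

/-- Except with a small probability, an epoch with sampling reduces the potential by the factor
`q / 2`. -/
theorem exists_exceptional_set (loc : Fin n → Fin M) {σ : AState m n} {s q lam : ℕ} (he : 0 < e)
    (hσ : AInv I e σ) (hq : 1 ≤ q) (hlam : 1 ≤ lam) (hm : 1 ≤ m) (hL : ∀ l, l ∈ L) (hn : L.Nodup)
    (hs : s = 4 * (q * q) * (lam * m)) (hk : σ.k = pot I e σ.c σ.v σ.U) (hk1 : 1 ≤ σ.k) :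
    ∃ B : Set (Fin n → ℕ), expect (allCoins loc (σ.k - 1)) (B.indicator 1) ≤
        ENNReal.ofReal (2 * Real.exp (-(q * lam : ℝ))) ∧
      ∀ ω ∈ (allCoins loc (σ.k - 1)).support, ω ∉ B → ∀ τ, Next I e s L ω σ τ →
        q * pot I e τ.c τ.v τ.U ≤ 2 * pot I e σ.c σ.v σ.U := by
  classical
  obtain ⟨k, hk2⟩ : ∃ k, σ.k = k + 1 := ⟨σ.k - 1, by omega⟩
  have hpot : pot I e σ.c σ.v σ.U = k + 1 := by omega
  have hkey : ∀ ω τ, Next I e s L ω σ τ →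
      ((L.filter (Smp I e s σ.c σ.v (k + 1) σ.U ω)).map (res I σ.U)).sum ≤ 3 * s →
      pot I e τ.c τ.v τ.U = pot I e σ.c σ.v
        (process (sampleStep I e σ.c σ.v s) ω (σ.U, σ.X) L).1 := by
    intro ω τ hN hfull
    obtain ⟨e1, e2, -⟩ := hN.same (by omega)
    obtain ⟨L', -, h2, -, h4⟩ := hN.picked
    rw [hk2] at h2
    have h5 := h2 hfull
    rw [e1, e2, process_eq_foldl he hσ.pos (by omega : 1 ≤ k + 1) σ.U L (σ.U, σ.X) le_rfl, ← h5,
      ← h4]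
  rw [hk2, Nat.add_sub_cancel]
  by_cases hsk : s ≤ k + 1
  · refine ⟨{ω | 2 * pot I e σ.c σ.v σ.U < q * pot I e σ.c σ.v
      (process (sampleStep I e σ.c σ.v s) ω (σ.U, σ.X) L).1} ∪
      {ω | 3 * s < ((L.filter (Smp I e s σ.c σ.v (k + 1) σ.U ω)).map (res I σ.U)).sum}, ?_, ?_⟩
    · have h1 := greedy_tail loc he hσ.pos hq hm hL hn σ.U σ.X hpot hsk
      have h2 := overflow_tail (I := I) (e := e) loc hm hL hn σ.U hpot hsk
      have hm0 : (0 : ℝ) < m := by exact_mod_cast hm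
      have hq0 : (1 : ℝ) ≤ q := by exact_mod_cast hq
      have hl0 : (1 : ℝ) ≤ lam := by exact_mod_cast hlam
      have hql : (q : ℝ) ≤ q * lam := le_mul_of_one_le_right (by linarith) hl0
      have e1 : (s : ℝ) / (2 * m * q) = 2 * (q * lam) := by
        rw [hs]; push_cast; field_simp; ring
      have e2 : (s : ℝ) / m = 4 * (q * (q * lam)) := by
        rw [hs]; push_cast; field_simp
      have e3 : (q * lam : ℝ) ≤ q * (q * lam) := le_mul_of_one_le_left (by positivity) hq0
      rw [two_mul (Real.exp _), ENNReal.ofReal_add (Real.exp_pos _).le (Real.exp_pos _).le]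
      exact (expect_indicator_union_le _ _ _).trans (add_le_add
        (h1.trans (ENNReal.ofReal_le_ofReal (Real.exp_le_exp.2 (by rw [e1]; linarith))))
        (h2.trans (ENNReal.ofReal_le_ofReal (Real.exp_le_exp.2 (by
          have : (0 : ℝ) ≤ q * lam := by positivity
          rw [e2]; linarith)))))
    · intro ω _ hω τ hN
      have h1 := fun h => hω (Or.inl h)
      have h2 := fun h => hω (Or.inr h)
      rw [hkey ω τ hN (not_lt.1 h2)]
      exact not_lt.1 h1
  · refine ⟨∅, ?_, fun ω hω _ τ hN => ?_⟩
    · simp only [Set.indicator_empty]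
      exact (expect_const _ 0).le.trans zero_le
    -- If the threshold exceeds all coins, every active set is sampled. Their total size is the
    -- potential, which is below `s`, so nothing is truncated and afterwards no set is active.
    · have hlt : ∀ l, ω l < s := fun l => by
        have := allCoins_le hω l
        omega
      rw [hkey ω τ hN]
      · have : pot I e σ.c σ.v (process (sampleStep I e σ.c σ.v s) ω (σ.U, σ.X) L).1 = 0 :=
          Finset.sum_eq_zero fun l _ => actRes_process_eq_zero he hσ.pos (hlt l) L _ (hL l)
        rw [this]; omega
      · have e1 : (L.filter (Smp I e s σ.c σ.v (k + 1) σ.U ω)).map (res I σ.U) =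
            (L.filter (Smp I e s σ.c σ.v (k + 1) σ.U ω)).map (actRes I e σ.c σ.v σ.U) :=
          List.map_congr_left fun l hl =>
            (actRes_eq_res (by simpa using (List.mem_filter.1 hl).2 : Smp I e s σ.c σ.v (k + 1) σ.U ω l).1).symm
        rw [e1]
        have h1 := List.Sublist.sum_le_sum
          ((List.filter_sublist (p := fun l => decide (Smp I e s σ.c σ.v (k + 1) σ.U ω l)) (l := L)).map
            (actRes I e σ.c σ.v σ.U)) (fun _ _ => Nat.zero_le _)
        rw [sum_map_actRes hL hn] at h1
        omega

end tails

/-! ### The probability that the computation goes on -/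

section survive

variable {M : ℕ} [NeZero M] (A : Algorithm) (W : ℕ)

open Classical in
/-- The probability that a computation does not end within `r` rounds. -/
noncomputable def survive : ℕ → A.Config M → ENNReal
  | 0, c => if A.Halted c then 0 else 1
  | r + 1, c => expect (A.round W c) (survive r)

variable {A W}

theorem survive_of_halted {c : A.Config M} (h : A.Halted c) : ∀ r, survive A W r c = 0
  | 0 => by rw [survive, if_pos h]
  | r + 1 => by rw [survive, round_of_halted h, expect_pure, survive_of_halted h r]

theorem survive_le_one : ∀ (r : ℕ) (c : A.Config M), survive A W r c ≤ 1
  | 0, c => by rw [survive]; split_ifs <;> simp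
  | r + 1, c => expect_le fun c' _ => survive_le_one r c'

theorem survive_succ_le : ∀ (r : ℕ) (c : A.Config M), survive A W (r + 1) c ≤ survive A W r c
  | 0, c => by
      by_cases h : A.Halted c
      · rw [survive_of_halted h, survive_of_halted h]
      · rw [survive.eq_1 A W c, if_neg h]; exact survive_le_one _ _
  | r + 1, c => expect_mono fun c' _ => survive_succ_le r c'

theorem survive_antitone (c : A.Config M) : Antitone fun r => survive A W r c :=
  antitone_nat_of_succ_le fun r => survive_succ_le r c

/-- Moves rounds from the run into `survive`. After this only recursions that start from a given
configuration are needed. -/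
theorem expect_runRounds (x : Fin M → inputTy.Val) : ∀ r k : ℕ,
    expect (A.runRounds W x r) (survive A W k) = expect (A.runRounds W x 0) (survive A W (k + r))
  | 0, k => rfl
  | r + 1, k => by
      have h : A.runRounds W x (r + 1) = (A.runRounds W x r).bind (A.round W) := rfl
      rw [h, expect_bind]
      exact (expect_runRounds x r (k + 1)).trans (by rw [add_right_comm, add_assoc])

theorem haltProb_eq (x : Fin M → inputTy.Val) (r : ℕ) :
    A.haltProb W x r = 1 - (expect (A.runRounds W x 0) (survive A W r)).toReal := by
  classical
  have h := expect_runRounds (A := A) (W := W) x r 0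
  rw [zero_add] at h
  rw [← h]
  have h1 : (A.runRounds W x r).toOuterMeasure {c | A.Halted c} =
      expect (A.runRounds W x r) ({c | A.Halted c}.indicator 1) := by
    rw [PMF.toOuterMeasure_apply]
    refine tsum_congr fun c => ?_
    by_cases hc : c ∈ {c | A.Halted c}
    · rw [Set.indicator_of_mem hc, Set.indicator_of_mem hc]; simp
    · rw [Set.indicator_of_notMem hc, Set.indicator_of_notMem hc]; simp
  have h2 : expect (A.runRounds W x r) ({c | A.Halted c}.indicator 1) +
      expect (A.runRounds W x r) (survive A W 0) = 1 := by
    rw [← expect_add, ← expect_const (A.runRounds W x r) 1]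
    congr 1
    funext c
    by_cases hc : A.Halted c
    · rw [Set.indicator_of_mem (show c ∈ {c | A.Halted c} from hc), survive_of_halted hc]; simp
    · rw [Set.indicator_of_notMem (show c ∉ {c | A.Halted c} from hc), survive, if_neg hc]; simp
  unfold Algorithm.haltProb
  rw [h1]
  have h3 : expect (A.runRounds W x r) (survive A W 0) ≠ ⊤ :=
    ne_top_of_le_ne_top ENNReal.one_ne_top (h2 ▸ le_add_self)
  have h4 : expect (A.runRounds W x r) ({c | A.Halted c}.indicator 1) ≠ ⊤ :=
    ne_top_of_le_ne_top ENNReal.one_ne_top (h2 ▸ le_self_add)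
  rw [eq_sub_iff_add_eq, ← ENNReal.toReal_add h4 h3, h2, ENNReal.toReal_one]

end survive

/-! ### Epochs -/

section epochs

variable {m n M : ℕ} [NeZero M] {I : SetCover m n} {loc : Fin n → Fin M} {e : ℝ} {W a T s : ℕ}

theorem survive_of_round_eq_pure {A : Algorithm} {c c' : A.Config M}
    (h : A.round W c = PMF.pure c') (r : ℕ) : survive A W (r + 1) c = survive A W r c' := by
  rw [survive, h, expect_pure]

theorem DownInv.steps (hA : Admissible I M W a T s) {σ : AState m n} {C : List ℕ}
    {c : coverAlgorithm.Config M} (h : DownInv I loc e a T s σ C 0 c)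
    (hc : ¬ coverAlgorithm.Halted c) : ∀ t, t ≤ T →
    ∃ c', DownInv I loc e a T s σ C t c' ∧ ¬ coverAlgorithm.Halted c' ∧
      ∀ r, survive coverAlgorithm W (r + t) c = survive coverAlgorithm W r c'
  | 0, _ => ⟨c, h, hc, fun _ => rfl⟩
  | t + 1, ht => by
      obtain ⟨c₁, h1, h2, h3⟩ := DownInv.steps hA h hc t (by omega)
      obtain ⟨c₂, h4, h5, h6⟩ := h1.step hA (by omega) h2
      refine ⟨c₂, h5, h6, fun r => ?_⟩
      rw [← survive_of_round_eq_pure h4, ← h3]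
      congr 1; omega

theorem UpInv.steps (hA : Admissible I M W a T s) {σ : AState m n} {C : List ℕ}
    (hC : Repr C σ.U) {ω : Fin n → ℕ} {c : coverAlgorithm.Config M}
    (h : UpInv I loc e a T s σ C ω 0 c) (hc : ¬ coverAlgorithm.Halted c) : ∀ t, t < T →
    ∃ c', UpInv I loc e a T s σ C ω t c' ∧ ¬ coverAlgorithm.Halted c' ∧
      ∀ r, survive coverAlgorithm W (r + t) c = survive coverAlgorithm W r c'
  | 0, _ => ⟨c, h, hc, fun _ => rfl⟩
  | t + 1, ht => by
      obtain ⟨c₁, h1, h2, h3⟩ := UpInv.steps hA hC h hc t (by omega)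
      obtain ⟨c₂, h4, h5, h6⟩ := h1.step hA hC (by omega) h2
      refine ⟨c₂, h5, h6, fun r => ?_⟩
      rw [← survive_of_round_eq_pure h4, ← h3]
      congr 1; omega

/-- The effect of one epoch. -/
theorem DownInv.epoch (hA : Admissible I M W a T s) {σ : AState m n} {C : List ℕ}
    (hC : Repr C σ.U) {c : coverAlgorithm.Config M} (h : DownInv I loc e a T s σ C 0 c)
    (hc : ¬ coverAlgorithm.Halted c) :
    ∃ F : (Fin n → ℕ) → coverAlgorithm.Config M,
      (∀ r, survive coverAlgorithm W (r + (2 * T + 1)) c =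
        expect (allCoins loc (σ.k - 1)) fun ω => survive coverAlgorithm W r (F ω)) ∧
      ∀ ω, ∃ τ C', DownInv I loc e a T s τ C' 0 (F ω) ∧ Next I e s (tree loc a T 0) ω σ τ ∧
        Repr C' τ.U ∧ (coverAlgorithm.Halted (F ω) ↔ σ.U = Finset.univ) := by
  have hT := hA.one_le_depth
  obtain ⟨c₁, h1, h2, h3⟩ := h.steps hA hc T le_rfl
  obtain ⟨F, h4, h5⟩ := h1.sample hA hC h2
  choose c₂ h6 h7 h8 using fun ω => (h5 ω).1.steps hA hC (h5 ω).2 (T - 1) (by omega)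
  choose F' τ C' h9 h10 h11 h12 h13 using fun ω => (h6 ω).finish hA hC (by omega) (h7 ω)
  refine ⟨F', fun r => ?_, fun ω => ⟨τ ω, C' ω, h10 ω, h11 ω, h12 ω, h13 ω⟩⟩
  -- `T` rounds downwards, one round of sampling, `T - 1` rounds upwards and the final round of the
  -- root.
  have e1 : r + (2 * T + 1) = (r + 1 + (T - 1)) + 1 + T := by omega
  rw [e1, h3, survive, h4, expect_map]
  congr 1
  funext ω
  rw [h8, survive_of_round_eq_pure (h9 ω)]

end epochs

/-! ### Progress -/

section progress

variable {m n : ℕ} {I : SetCover m n} {e : ℝ} {s : ℕ} {L : List (Fin n)} {ω : Fin n → ℕ}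
  {σ τ : AState m n}

theorem exists_res_pos {U : Finset (Fin m)} (hU : U ≠ Finset.univ) : ∃ l, 1 ≤ res I U l := by
  obtain ⟨j, hj⟩ := not_forall.1 fun h => hU (Finset.eq_univ_iff_forall.2 h)
  obtain ⟨l, hl⟩ := I.exists_mem j
  exact ⟨l, Finset.card_pos.2 ⟨j, Finset.mem_sdiff.2 ⟨hl, hj⟩⟩⟩

theorem ne_univ_of_pot_ne_zero {c : ℕ} {v : ℝ} {U : Finset (Fin m)} (h : pot I e c v U ≠ 0) :
    U ≠ Finset.univ := by
  rintro rfl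
  refine h (pot_eq_zero_iff.2 fun l hl => ?_)
  have := hl.res_pos
  rw [res_eq_zero_of_subset (Finset.subset_univ _)] at this
  omega

/-- The set that attains the new reference ratio is itself active, since `1 ≤ e`. So two successive
epochs cannot both find an empty level unless everything is covered. -/
theorem Next.pot_ne_zero (he : 1 ≤ e) (h : Next I e s L ω σ τ) (h0 : pot I e σ.c σ.v σ.U = 0)
    (hU : σ.U ≠ Finset.univ) : τ.k = 0 ∧ τ.U = σ.U ∧ pot I e τ.c τ.v τ.U ≠ 0 ∧
      ∃ l, τ.c = res I σ.U l ∧ τ.v = I.weight l ∧ 1 ≤ τ.c := by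
  obtain ⟨a1, a2, a3, a4⟩ := h.level h0
  have hUU := (h.eq_of_pot_eq_zero (Or.inl h0)).1
  obtain ⟨l₀, hl₀⟩ := exists_res_pos (I := I) hU
  have hc : 1 ≤ τ.c := by
    by_contra hc
    have hc : τ.c = 0 := by omega
    have := a1 l₀
    rw [hc] at this
    have h1 : (1 : ℝ) ≤ res I σ.U l₀ := by exact_mod_cast hl₀
    have : 0 < (res I σ.U l₀ : ℝ) * τ.v := by positivity
    simp at *; linarith
  obtain ⟨l, hl1, hl2⟩ := a4.resolve_left (by omega)
  refine ⟨a3, hUU, fun hp => ?_, l, hl1, hl2, hc⟩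
  refine pot_eq_zero_iff.1 hp l ⟨hc, ?_⟩
  rw [hUU, ← hl1, ← hl2]
  have : (0 : ℝ) ≤ τ.c := by positivity
  have : τ.v ≤ e * τ.v := le_mul_of_one_le_left a2.le he
  gcongr

/-- If one of the active sets is sampled, then progress is made. -/
theorem Next.ne_of_sampled (h : Next I e s L ω σ τ) {l : Fin n} (hl : l ∈ L)
    (hS : Smp I e s σ.c σ.v σ.k σ.U ω l) : τ.U ≠ σ.U := by
  obtain ⟨L', h1, -, h3, h4⟩ := h.picked
  obtain ⟨l', L'', rfl⟩ := List.exists_cons_of_ne_nil (h3 ⟨l, hl, hS⟩)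
  have ha := (h1 l' (by simp)).1
  intro hU
  have h5 : (gstep I e σ.c σ.v (σ.U, σ.X) l').1 ⊆ τ.U := by
    have h6 := subset_foldl_gstep (I := I) (e := e) σ.c σ.v L'' (gstep I e σ.c σ.v (σ.U, σ.X) l')
    have h7 : τ.U = (L''.foldl (gstep I e σ.c σ.v) (gstep I e σ.c σ.v (σ.U, σ.X) l')).1 :=
      congrArg Prod.fst h4
    rw [h7]; exact h6
  rw [gstep_of_act (y := (σ.U, σ.X)) ha] at h5
  have h6 := ha.res_pos
  have h7 : I.sets l' ⊆ σ.U := (Finset.subset_union_right.trans h5).trans (le_of_eq hU)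
  rw [res_eq_zero_of_subset h7] at h6
  omega

/-- The number of uncovered elements. -/
def AState.unc (σ : AState m n) : ℕ := m - σ.U.card

theorem AState.unc_pos (h : σ.U ≠ Finset.univ) : 1 ≤ σ.unc := by
  have := Finset.card_lt_card (Finset.ssubset_univ_iff.2 h)
  simp only [Finset.card_univ, Fintype.card_fin] at this
  unfold AState.unc; omega

theorem Next.unc_le (h : Next I e s L ω σ τ) : τ.unc ≤ σ.unc := by
  have := Finset.card_le_card h.subset
  unfold AState.unc; omega

theorem Next.unc_lt (h : Next I e s L ω σ τ) (hU : τ.U ≠ σ.U) : τ.unc + 1 ≤ σ.unc := by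
  have h1 := Finset.card_lt_card (h.subset.ssubset_of_ne (Ne.symm hU))
  have h2 : τ.U.card ≤ m := (Finset.card_le_univ _).trans (by simp)
  unfold AState.unc; omega

/-! #### A measure of progress that is sure to decrease with positive probability -/

open Classical in
/-- The number of epochs that suffice if each of them makes progress. -/
noncomputable def fuel (I : SetCover m n) (e : ℝ) (σ : AState m n) : ℕ :=
  if pot I e σ.c σ.v σ.U = 0 then 3 * σ.unc + 1 else if σ.k = 0 then 3 * σ.unc else 3 * σ.unc - 1

/-- The phases of a level run from changing the ratio through measuring to sampling, and they lower
the fuel by one each. A sampling epoch that covers something releases three units through `unc`,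
which pays for a return to the first phase. -/
theorem Next.fuel_lt (he : 1 ≤ e) (h : Next I e s L ω σ τ) (hU : σ.U ≠ Finset.univ)
    (hp : pot I e σ.c σ.v σ.U = 0 ∨ σ.k = 0 ∨ τ.U ≠ σ.U) : fuel I e τ + 1 ≤ fuel I e σ := by
  have hu := AState.unc_pos hU
  by_cases h0 : pot I e σ.c σ.v σ.U = 0
  · obtain ⟨a1, a2, a3, -⟩ := h.pot_ne_zero he h0 hU
    have : τ.unc = σ.unc := by unfold AState.unc; rw [a2]
    unfold fuel
    rw [if_pos h0, if_neg a3, if_pos a1, this]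
  · obtain ⟨a1, a2, a3⟩ := h.same h0
    by_cases hk : σ.k = 0
    · have hUU := (h.eq_of_pot_eq_zero (Or.inr hk)).1
      have : τ.unc = σ.unc := by unfold AState.unc; rw [hUU]
      unfold fuel
      rw [if_neg h0, if_pos hk, a1, a2, hUU, if_neg h0, if_neg (by omega), this]
      omega
    · have := h.unc_lt ((hp.resolve_left h0).resolve_left hk)
      unfold fuel
      rw [if_neg h0, if_neg hk]
      split_ifs <;> omega

end progress

/-! ### Termination -/

section termination

variable {m n M : ℕ} {I : SetCover m n} {loc : Fin n → Fin M} {e : ℝ} {W a T s : ℕ}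

/-- It is enough that the coin `0` lies below any positive threshold. -/
theorem expect_coin_ge_le (loc : Fin n → Fin M) {k N : ℕ} (hs : 1 ≤ s) (hk : k + 1 ≤ N)
    (l : Fin n) :
    expect (allCoins loc k) ({ω | s ≤ ω l}.indicator 1) ≤ ENNReal.ofReal (1 - 1 / N) := by
  rw [expect_allCoins loc k l]
  refine expect_le fun ω _ => ?_
  have h : expect (unif k) (fun r => if r < 1 then ENNReal.ofReal 0 else ENNReal.ofReal 1) =
      ENNReal.ofReal (((1 : ℕ) / (k + 1 : ℕ) : ℝ) * 0 + (1 - (1 : ℕ) / (k + 1 : ℕ)) * 1) :=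
    expect_unif_ite (by omega) le_rfl zero_le_one
  calc expect (unif k) (fun r => ({ω | s ≤ ω l} : Set (Fin n → ℕ)).indicator 1 (Function.update ω l r))
      ≤ expect (unif k) (fun r => if r < 1 then ENNReal.ofReal 0 else ENNReal.ofReal 1) := by
        refine expect_mono fun r _ => ?_
        by_cases hr : r < 1
        · rw [Set.indicator_of_notMem]
          · exact zero_le
          · simp; omega
        · rw [if_neg hr, ENNReal.ofReal_one]
          exact Set.indicator_le_self' (fun _ _ => zero_le) _
    _ ≤ _ := by
        rw [h]
        refine ENNReal.ofReal_le_ofReal ?_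
        have hk' : (0 : ℝ) < (k + 1 : ℕ) := by positivity
        have hN : ((k + 1 : ℕ) : ℝ) ≤ N := by exact_mod_cast hk
        have := one_div_le_one_div_of_le hk' hN
        push_cast at *
        linarith

variable (I loc e a T s) in
/-- The configuration `c`, which belongs to the abstract state `σ`, may occur at the start of an
epoch. -/
structure Start (σ : AState m n) (C : List ℕ) (c : coverAlgorithm.Config M) : Prop where
  inv : AInv I e σ
  repr : Repr C σ.U
  down : DownInv I loc e a T s σ C 0 c

variable [NeZero M]

theorem mem_tree_root (hA : Admissible I M W a T s) (l : Fin n) : l ∈ tree loc a T (0 : Fin M) := by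
  rw [mem_tree, Nat.div_eq_of_lt ((loc l).2.trans_le hA.le_pow)]; simp

theorem Start.epoch (hA : Admissible I M W a T s) (he : 0 < e) {σ : AState m n} {C : List ℕ}
    {c : coverAlgorithm.Config M} (h : Start I loc e a T s σ C c)
    (hc : ¬ coverAlgorithm.Halted c) :
    ∃ F : (Fin n → ℕ) → coverAlgorithm.Config M,
      (∀ r, survive coverAlgorithm W (r + (2 * T + 1)) c =
        expect (allCoins loc (σ.k - 1)) fun ω => survive coverAlgorithm W r (F ω)) ∧
      ∀ ω, ∃ τ C', Start I loc e a T s τ C' (F ω) ∧ Next I e s (tree loc a T 0) ω σ τ ∧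
        (coverAlgorithm.Halted (F ω) ↔ σ.U = Finset.univ) := by
  obtain ⟨F, h1, h2⟩ := h.down.epoch hA h.repr hc
  refine ⟨F, h1, fun ω => ?_⟩
  obtain ⟨τ, C', h3, h4, h5, h6⟩ := h2 ω
  exact ⟨τ, C', ⟨h4.inv he h.inv, h5, h3⟩, h4, h6⟩

theorem one_le_fuel (σ : AState m n) : 1 ≤ fuel I e σ := by
  unfold fuel
  split_ifs with h1
  · omega
  · have := AState.unc_pos (ne_univ_of_pot_ne_zero h1); omega
  · have := AState.unc_pos (ne_univ_of_pot_ne_zero h1); omega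

theorem fuel_le (σ : AState m n) : fuel I e σ ≤ 3 * m + 1 := by
  unfold fuel AState.unc
  split_ifs <;> omega

/-- Fix one active set. Its coin lies below the threshold with probability at least `γ = 1 / Φ`,
because `k` is at most `Φ`, and then the epoch covers a new element even if the sample was
truncated. So with probability at least `γ ^ j` the fuel is used up within `j` epochs; after a
failure only the bound `S` for the remaining rounds is used. -/
theorem survive_le_of_fuel_le (hA : Admissible I M W a T s) (he : 1 ≤ e) (hs : 1 ≤ s) {r : ℕ}
    {S : ENNReal} (hS : ∀ σ C c, Start I loc e a T s σ C c → survive coverAlgorithm W r c ≤ S)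
    {γ : ℝ} (hγ : γ = 1 / I.totalCard) : ∀ (j : ℕ) (σ : AState m n) (C : List ℕ)
      (c : coverAlgorithm.Config M), Start I loc e a T s σ C c → fuel I e σ ≤ j →
      survive coverAlgorithm W (r + j * (2 * T + 1)) c ≤ S * ENNReal.ofReal (1 - γ ^ j)
  | 0, σ, C, c, _, hf => by have := one_le_fuel (I := I) (e := e) σ; omega
  | j + 1, σ, C, c, h, hf => by
      have he0 : 0 < e := by linarith
      have hγ0 : 0 ≤ γ := by rw [hγ]; positivity
      have hγ1 : γ ≤ 1 := by
        rw [hγ]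
        rcases Nat.eq_zero_or_pos I.totalCard with h0 | h0
        · rw [h0]; simp
        · rw [div_le_one (by exact_mod_cast h0)]; exact_mod_cast h0
      have hpow : γ ^ (j + 1) ≤ γ ^ j := pow_le_pow_of_le_one hγ0 hγ1 (by omega)
      have hmono : S * ENNReal.ofReal (1 - γ ^ j) ≤ S * ENNReal.ofReal (1 - γ ^ (j + 1)) :=
        mul_le_mul_right (ENNReal.ofReal_le_ofReal (by linarith)) _
      by_cases hc : coverAlgorithm.Halted c
      · rw [survive_of_halted hc]; exact zero_le
      obtain ⟨F, h1, h2⟩ := h.epoch hA he0 hc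
      rw [show r + (j + 1) * (2 * T + 1) = (r + j * (2 * T + 1)) + (2 * T + 1) by ring, h1]
      by_cases hU : σ.U = Finset.univ
      · refine expect_le fun ω _ => ?_
        obtain ⟨τ, C', -, -, h5⟩ := h2 ω
        rw [survive_of_halted (h5.2 hU)]; exact zero_le
      by_cases hp : pot I e σ.c σ.v σ.U = 0 ∨ σ.k = 0
      · refine expect_le fun ω _ => le_trans ?_ hmono
        obtain ⟨τ, C', h3, h4, -⟩ := h2 ω
        have := h4.fuel_lt he hU (by tauto)
        exact survive_le_of_fuel_le hA he hs hS hγ j τ C' _ h3 (by omega)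
      · rw [not_or] at hp
        obtain ⟨l, hl⟩ : ∃ l, Act I e σ.c σ.v σ.U l := by
          by_contra hn
          exact hp.1 (pot_eq_zero_iff.2 (not_exists.1 hn))
        have hk : σ.k - 1 + 1 ≤ I.totalCard := by
          have := h.inv.den.resolve_left hp.2
          have := pot_le_totalCard (I := I) (e := e) σ.c σ.v σ.U
          omega
        have hone : ENNReal.ofReal (1 - γ ^ j) + ENNReal.ofReal (γ ^ j) = 1 := by
          rw [← ENNReal.ofReal_add (by linarith [pow_le_one₀ hγ0 hγ1 (n := j)]) (by positivity)]
          simp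
        calc expect (allCoins loc (σ.k - 1)) (fun ω =>
              survive coverAlgorithm W (r + j * (2 * T + 1)) (F ω))
            ≤ expect (allCoins loc (σ.k - 1)) (fun ω => S * ENNReal.ofReal (1 - γ ^ j) +
                S * ENNReal.ofReal (γ ^ j) * ({ω | s ≤ ω l} : Set (Fin n → ℕ)).indicator 1 ω) := by
              refine expect_mono fun ω _ => ?_
              obtain ⟨τ, C', h3, h4, -⟩ := h2 ω
              by_cases hω : s ≤ ω l
              · rw [Set.indicator_of_mem (show ω ∈ {ω : Fin n → ℕ | s ≤ ω l} from hω),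
                  Pi.one_apply, mul_one, ← mul_add, hone, mul_one]
                exact (survive_antitone (W := W) (F ω) (Nat.le_add_right r _)).trans (hS τ C' _ h3)
              · refine le_trans ?_ le_self_add
                have hne := h4.ne_of_sampled (mem_tree_root hA l)
                  ⟨hl, by omega, not_le.1 hω⟩
                have := h4.fuel_lt he hU (by tauto)
                exact survive_le_of_fuel_le hA he hs hS hγ j τ C' _ h3 (by omega)
          _ ≤ S * ENNReal.ofReal (1 - γ ^ j) +
                S * ENNReal.ofReal (γ ^ j) * ENNReal.ofReal (1 - γ) := by
              rw [expect_add, expect_const, expect_mul_left]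
              gcongr
              rw [hγ]
              exact expect_coin_ge_le loc hs hk l
          _ = S * ENNReal.ofReal (1 - γ ^ (j + 1)) := by
              rw [mul_assoc, ← mul_add, ← ENNReal.ofReal_mul (by positivity),
                ← ENNReal.ofReal_add (by linarith [pow_le_one₀ hγ0 hγ1 (n := j)])
                  (mul_nonneg (by positivity) (by linarith))]
              congr 2
              ring

/-- The computation ends almost surely. -/
theorem tendsto_survive (hA : Admissible I M W a T s) (he : 1 ≤ e) (hs : 1 ≤ s)
    (hN : 1 ≤ I.totalCard) {σ : AState m n} {C : List ℕ} {c : coverAlgorithm.Config M}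
    (h : Start I loc e a T s σ C c) :
    Tendsto (fun r => (survive coverAlgorithm W r c).toReal) atTop (𝓝 0) := by
  set γ : ℝ := 1 / I.totalCard with hγ
  have hN' : (1 : ℝ) ≤ I.totalCard := by exact_mod_cast hN
  have hγ0 : 0 < γ := by positivity
  have hγ1 : γ ≤ 1 := by rw [hγ, div_le_one (by linarith)]; exact hN'
  -- The fuel is at most `3 m + 1` in every state. Each block of `3 m + 1` epochs therefore
  -- multiplies the probability of survival by at most the same `θ < 1`.
  set θ : ℝ := 1 - γ ^ (3 * m + 1) with hθ
  have hθ0 : 0 ≤ θ := by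
    have := pow_le_one₀ hγ0.le hγ1 (n := 3 * m + 1); linarith
  have hθ1 : θ < 1 := by
    have : 0 < γ ^ (3 * m + 1) := by positivity
    linarith
  set R := (3 * m + 1) * (2 * T + 1) with hR
  have hR0 : 0 < R := by positivity
  have hle : ∀ (i : ℕ) σ C c, Start I loc e a T s σ C c →
      survive coverAlgorithm W (i * R) c ≤ ENNReal.ofReal (θ ^ i) := by
    intro i
    induction i with
    | zero => intro σ C c _; simpa using survive_le_one _ _
    | succ i ih =>
      intro σ C c hst
      rw [Nat.succ_mul, pow_succ, ENNReal.ofReal_mul (by positivity)]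
      exact survive_le_of_fuel_le hA he hs ih hγ _ σ C c hst (fuel_le σ)
  have hbound : ∀ r, (survive coverAlgorithm W r c).toReal ≤ θ ^ (r / R) := by
    intro r
    have h1 := (survive_antitone (W := W) c (Nat.div_mul_le_self r R)).trans (hle (r / R) σ C c h)
    exact ENNReal.toReal_le_of_le_ofReal (by positivity) h1
  refine squeeze_zero (fun _ => ENNReal.toReal_nonneg) hbound ?_
  exact (tendsto_pow_atTop_nhds_zero_of_lt_one hθ0 hθ1).comp (Nat.tendsto_div_const_atTop hR0.ne')

end termination

/-! ### The number of epochs -/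

section epochcount

variable {m n : ℕ} {I : SetCover m n} {e : ℝ} {s q : ℕ} {L : List (Fin n)} {ω : Fin n → ℕ}
  {σ τ : AState m n}

/-- The number of reductions by the factor `q / 2` that bring `p` down to `0`. -/
noncomputable def iterations (q p : ℕ) : ℕ :=
  if p = 0 then 0 else ⌊Real.logb (q / 2) p⌋₊ + 1

theorem iterations_zero : iterations q 0 = 0 := if_pos rfl

theorem one_le_iterations {p : ℕ} (h : p ≠ 0) : 1 ≤ iterations q p := by
  unfold iterations; rw [if_neg h]; omega

theorem one_lt_half (hq : 3 ≤ q) : (1 : ℝ) < q / 2 := by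
  have : (3 : ℝ) ≤ q := by exact_mod_cast hq
  linarith

theorem iterations_mono (hq : 3 ≤ q) {p p' : ℕ} (h : p ≤ p') : iterations q p ≤ iterations q p' := by
  have hq' := one_lt_half hq
  unfold iterations
  split_ifs with h1 h2
  · exact le_rfl
  · omega
  · omega
  · have h3 : (0 : ℝ) < p := by exact_mod_cast Nat.pos_of_ne_zero h1
    have h4 : (p : ℝ) ≤ p' := by exact_mod_cast h
    exact Nat.succ_le_succ (Nat.floor_le_floor (Real.logb_le_logb_of_le hq' h3 h4))

theorem iterations_lt (hq : 3 ≤ q) {p p' : ℕ} (hp : p ≠ 0) (h : q * p' ≤ 2 * p) :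
    iterations q p' + 1 ≤ iterations q p := by
  have hq' := one_lt_half hq
  by_cases h1 : p' = 0
  · rw [h1, iterations_zero, zero_add]; exact one_le_iterations hp
  · unfold iterations
    rw [if_neg h1, if_neg hp]
    have h3 : (1 : ℝ) ≤ p' := by exact_mod_cast Nat.pos_of_ne_zero h1
    have h4 : (q : ℝ) / 2 * p' ≤ p := by
      have : (q * p' : ℝ) ≤ 2 * p := by exact_mod_cast h
      linarith
    have h5 := Real.logb_le_logb_of_le hq' (by positivity) h4
    rw [Real.logb_mul (by linarith) (by linarith), Real.logb_self_eq_one hq'] at h5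
    have h6 : 0 ≤ Real.logb ((q : ℝ) / 2) p' := Real.logb_nonneg hq' h3
    have h7 : ⌊Real.logb ((q : ℝ) / 2) p'⌋₊ + 1 ≤ ⌊Real.logb ((q : ℝ) / 2) p⌋₊ := by
      rw [← Nat.floor_add_one h6]
      exact Nat.floor_le_floor (by linarith)
    omega

/-- The logarithm of the ratio between the largest and the smallest possible ratio. -/
noncomputable def spread (I : SetCover m n) (e : ℝ) : ℕ :=
  ⌊Real.logb e (I.maxCard * I.maxWeight / I.minWeight)⌋₊

open Classical in
/-- The number of times that the reference ratio can change. -/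
noncomputable def levels (I : SetCover m n) (e : ℝ) (σ : AState m n) : ℕ :=
  if σ.c = 0 then spread I e + 1 else ⌊Real.logb e (σ.c / σ.v * I.maxWeight)⌋₊

theorem weight_le_maxWeight (l : Fin n) : I.weight l ≤ I.maxWeight :=
  le_ciSup (Set.finite_range I.weight).bddAbove l

theorem minWeight_le_weight (l : Fin n) : I.minWeight ≤ I.weight l :=
  ciInf_le (Set.finite_range I.weight).bddBelow l

theorem minWeight_pos [NeZero n] : 0 < I.minWeight := by
  obtain ⟨l, hl⟩ := exists_eq_ciInf_of_finite (f := I.weight)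
  exact (I.weight_pos l).trans_eq hl

/-- No set is active for the old ratio, in particular not the one that attains the new ratio, so the
ratio drops by more than the factor `e`. It stays at least `1 / w_max`, since an uncovered element
remains, so the logarithm decreases by at least `1` and remains nonnegative. The first ratio is at
most `Δ / w_min`. -/
theorem Next.levels_lt (he : 1 < e) (hσ : AInv I e σ) (h : Next I e s L ω σ τ)
    (h0 : pot I e σ.c σ.v σ.U = 0) (hU : σ.U ≠ Finset.univ) : levels I e τ + 1 ≤ levels I e σ := by
  obtain ⟨-, -, -, l, hl1, hl2, hc⟩ := h.pot_ne_zero he.le h0 hU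
  have : NeZero n := ⟨by rintro rfl; exact l.elim0⟩
  have hw := I.weight_pos l
  have hc' : (1 : ℝ) ≤ τ.c := by exact_mod_cast hc
  have hwmax := weight_le_maxWeight (I := I) l
  have hwmin := minWeight_le_weight (I := I) l
  have hmin := minWeight_pos (I := I)
  have hmaxpos : 0 < I.maxWeight := hw.trans_le hwmax
  have hx1 : (1 : ℝ) ≤ τ.c / τ.v * I.maxWeight := by
    rw [hl2, div_mul_eq_mul_div, le_div_iff₀ hw, one_mul]
    nlinarith
  unfold levels
  rw [if_neg (by omega : τ.c ≠ 0)]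
  split_ifs with hσc
  · refine Nat.succ_le_succ (Nat.floor_le_floor (Real.logb_le_logb_of_le he (by linarith) ?_))
    rw [hl2, div_mul_eq_mul_div]
    have h1 : (τ.c : ℝ) ≤ I.maxCard := by
      have : τ.c ≤ I.maxCard := by
        rw [hl1]
        exact (res_le_card _ _).trans
          (Finset.le_sup (f := fun l => (I.sets l).card) (Finset.mem_univ l))
      exact_mod_cast this
    gcongr
  · have hna := pot_eq_zero_iff.1 h0 l
    have hσc' : (1 : ℝ) ≤ σ.c := by exact_mod_cast Nat.pos_of_ne_zero hσc
    have hlt : (τ.c : ℝ) * (e * σ.v) < σ.c * τ.v := by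
      rw [hl1, hl2]
      by_contra hh
      exact hna ⟨Nat.pos_of_ne_zero hσc, not_lt.1 hh⟩
    have hτv : 0 < τ.v := hl2 ▸ hw
    have hσv := hσ.pos
    have h2 : e * (τ.c / τ.v * I.maxWeight) ≤ σ.c / σ.v * I.maxWeight := by
      rw [← mul_assoc]
      refine mul_le_mul_of_nonneg_right ?_ hmaxpos.le
      rw [← mul_div_assoc, div_le_div_iff₀ hτv hσv]
      nlinarith
    have h5 := Real.logb_le_logb_of_le he (by positivity) h2
    rw [Real.logb_mul (by linarith) (by linarith), Real.logb_self_eq_one he] at h5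
    have h6 := Real.logb_nonneg he hx1
    rw [← Nat.floor_add_one h6]
    exact Nat.floor_le_floor (by linarith)

open Classical in
/-- The number of epochs that suffice if no exceptional event occurs. -/
noncomputable def horizon (I : SetCover m n) (e : ℝ) (q : ℕ) (σ : AState m n) : ℕ :=
  levels I e σ * (2 * iterations q I.totalCard + 2) + 2 * iterations q (pot I e σ.c σ.v σ.U) +
    (if σ.k = 0 ∧ pot I e σ.c σ.v σ.U ≠ 0 then 1 else 0) + 1

open Classical in
/-- The number of epochs with sampling that suffice if no exceptional event occurs. -/
noncomputable def risk (I : SetCover m n) (e : ℝ) (q : ℕ) (σ : AState m n) : ℕ :=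
  if pot I e σ.c σ.v σ.U = 0 then σ.unc * iterations q I.totalCard
  else (σ.unc - 1) * iterations q I.totalCard + iterations q (pot I e σ.c σ.v σ.U)

/-- A new level is paid for by `2 iterations Φ + 2` units: two epochs for every reduction, one first
measurement and the change of the ratio itself. The final `+ 1` in `horizon` is the epoch in which
the completed cover is noticed. -/
theorem Next.horizon_lt (he : 1 < e) (hq : 3 ≤ q) (hσ : AInv I e σ) (h : Next I e s L ω σ τ)
    (hU : σ.U ≠ Finset.univ) (hp : pot I e σ.c σ.v σ.U = 0 ∨ σ.k = 0) :
    horizon I e q τ + 1 ≤ horizon I e q σ ∧ risk I e q τ ≤ risk I e q σ := by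
  have hu := AState.unc_pos hU
  by_cases h0 : pot I e σ.c σ.v σ.U = 0
  · obtain ⟨a1, a2, a3, -⟩ := h.pot_ne_zero he.le h0 hU
    have hlv := h.levels_lt he hσ h0 hU
    have hun : τ.unc = σ.unc := by unfold AState.unc; rw [a2]
    have hit : iterations q (pot I e τ.c τ.v τ.U) ≤ iterations q I.totalCard :=
      iterations_mono hq (pot_le_totalCard _ _ _)
    constructor
    · unfold horizon
      rw [h0, iterations_zero, if_pos ⟨a1, a3⟩, if_neg (by simp)]
      have := Nat.mul_le_mul_right (2 * iterations q I.totalCard + 2) hlv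
      rw [Nat.add_mul] at this
      omega
    · unfold risk
      rw [if_pos h0, if_neg a3, hun]
      obtain ⟨u, hu'⟩ : ∃ u, σ.unc = u + 1 := ⟨σ.unc - 1, by omega⟩
      rw [hu', Nat.add_sub_cancel, Nat.add_mul, one_mul]
      omega
  · obtain ⟨a1, a2, a3⟩ := h.same h0
    have hk := hp.resolve_left h0
    have hUU := (h.eq_of_pot_eq_zero (Or.inr hk)).1
    have hun : τ.unc = σ.unc := by unfold AState.unc; rw [hUU]
    have hlv : levels I e τ = levels I e σ := by unfold levels; rw [a1, a2]
    constructor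
    · unfold horizon
      rw [a1, a2, hUU, hlv, if_pos (⟨hk, h0⟩ : σ.k = 0 ∧ pot I e σ.c σ.v σ.U ≠ 0),
        if_neg (fun hh => by omega : ¬ (τ.k = 0 ∧ pot I e σ.c σ.v σ.U ≠ 0))]
    · unfold risk
      rw [a1, a2, hUU, hun]

/-- If the potential becomes `0`, the covered set must have grown, so `unc` falls and releases
`iterations Φ` units of `risk` for the next level. Hence `risk` involves the number of elements and
not the number of levels. -/
theorem Next.horizon_lt_of_le (hq : 3 ≤ q) (h : Next I e s L ω σ τ)
    (h0 : pot I e σ.c σ.v σ.U ≠ 0) (hk : σ.k ≠ 0)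
    (hp : q * pot I e τ.c τ.v τ.U ≤ 2 * pot I e σ.c σ.v σ.U) :
    horizon I e q τ + 1 ≤ horizon I e q σ ∧ risk I e q τ + 1 ≤ risk I e q σ := by
  have hu := AState.unc_pos (ne_univ_of_pot_ne_zero h0)
  obtain ⟨a1, a2, a3⟩ := h.same h0
  have hlv : levels I e τ = levels I e σ := by unfold levels; rw [a1, a2]
  have hit := iterations_lt hq h0 hp
  constructor
  · unfold horizon
    rw [hlv, if_neg (fun hh => hk hh.1 : ¬ (σ.k = 0 ∧ pot I e σ.c σ.v σ.U ≠ 0))]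
    split_ifs <;> omega
  · unfold risk
    rw [if_neg h0]
    by_cases hτ : pot I e τ.c τ.v τ.U = 0
    · rw [if_pos hτ]
      have hne : τ.U ≠ σ.U := by
        intro hUU
        rw [a1, a2, hUU] at hτ
        exact h0 hτ
      have h1 := h.unc_lt hne
      have h2 := one_le_iterations (q := q) h0
      have h3 := Nat.mul_le_mul_right (iterations q I.totalCard) (by omega : τ.unc ≤ σ.unc - 1)
      omega
    · rw [if_neg hτ]
      have h1 := h.unc_le
      have h3 := Nat.mul_le_mul_right (iterations q I.totalCard)
        (by omega : τ.unc - 1 ≤ σ.unc - 1)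
      omega

variable {M : ℕ} [NeZero M] {loc : Fin n → Fin M} {W a T lam : ℕ}

/-- The computation ends within a certain number of epochs with high probability. -/
theorem survive_le_of_horizon_le (hA : Admissible I M W a T s) (he : 1 < e) (hq : 3 ≤ q)
    (hlam : 1 ≤ lam) (hm : 1 ≤ m) (hs : s = 4 * (q * q) * (lam * m)) : ∀ (j : ℕ) (σ : AState m n)
      (C : List ℕ) (c : coverAlgorithm.Config M), Start I loc e a T s σ C c →
      horizon I e q σ ≤ j → survive coverAlgorithm W (j * (2 * T + 1)) c ≤
        ENNReal.ofReal (2 * Real.exp (-(q * lam : ℝ)) * risk I e q σ)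
  | 0, σ, C, c, _, hf => by unfold horizon at hf; omega
  | j + 1, σ, C, c, h, hf => by
      have he0 : 0 < e := by linarith
      by_cases hc : coverAlgorithm.Halted c
      · rw [survive_of_halted hc]; exact zero_le
      obtain ⟨F, h1, h2⟩ := h.epoch hA he0 hc
      rw [Nat.succ_mul, h1]
      by_cases hU : σ.U = Finset.univ
      · refine expect_le fun ω _ => ?_
        obtain ⟨τ, C', -, -, h5⟩ := h2 ω
        rw [survive_of_halted (h5.2 hU)]; exact zero_le
      by_cases hp : pot I e σ.c σ.v σ.U = 0 ∨ σ.k = 0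
      · refine expect_le fun ω _ => ?_
        obtain ⟨τ, C', h3, h4, -⟩ := h2 ω
        obtain ⟨h5, h6⟩ := h4.horizon_lt he hq h.inv hU hp
        refine (survive_le_of_horizon_le hA he hq hlam hm hs j τ C' _ h3 (by omega)).trans
          (ENNReal.ofReal_le_ofReal ?_)
        gcongr
      · rw [not_or] at hp
        have hk := h.inv.den.resolve_left hp.2
        obtain ⟨B, hB, hB'⟩ := exists_exceptional_set loc he0 h.inv (by omega) hlam hm
          (mem_tree_root (loc := loc) hA) (nodup_tree loc a T 0) hs hk (Nat.pos_of_ne_zero hp.2)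
        have hrisk : 1 ≤ risk I e q σ := by
          unfold risk
          rw [if_neg hp.1]
          have := one_le_iterations (q := q) hp.1
          omega
        -- A union bound in recursive form: this epoch fails with probability at most `δ`, and
        -- otherwise the risk has decreased by at least one.
        set δ := 2 * Real.exp (-(q * lam : ℝ)) with hδ
        have hδ0 : 0 ≤ δ := by positivity
        have hrisk' : (0 : ℝ) ≤ (risk I e q σ : ℝ) - 1 := by
          have : (1 : ℝ) ≤ risk I e q σ := by exact_mod_cast hrisk
          linarith
        calc expect (allCoins loc (σ.k - 1)) (fun ω =>
              survive coverAlgorithm W (j * (2 * T + 1)) (F ω))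
            ≤ expect (allCoins loc (σ.k - 1)) (fun ω => B.indicator 1 ω +
                ENNReal.ofReal (δ * ((risk I e q σ : ℝ) - 1))) := by
              refine expect_mono fun ω hω => ?_
              obtain ⟨τ, C', h3, h4, -⟩ := h2 ω
              by_cases hωB : ω ∈ B
              · rw [Set.indicator_of_mem hωB]
                exact (survive_le_one _ _).trans le_self_add
              · refine le_trans ?_ le_add_self
                obtain ⟨h5, h6⟩ := h4.horizon_lt_of_le hq hp.1 hp.2 (hB' ω hω hωB τ h4)
                refine (survive_le_of_horizon_le hA he hq hlam hm hs j τ C' _ h3 (by omega)).trans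
                  (ENNReal.ofReal_le_ofReal ?_)
                have : (risk I e q τ : ℝ) + 1 ≤ risk I e q σ := by exact_mod_cast h6
                gcongr
                linarith
          _ ≤ ENNReal.ofReal δ + ENNReal.ofReal (δ * ((risk I e q σ : ℝ) - 1)) := by
              rw [expect_add, expect_const]
              gcongr
          _ = ENNReal.ofReal (δ * risk I e q σ) := by
              rw [← ENNReal.ofReal_add hδ0 (by positivity)]
              congr 1; ring

end epochcount

/-! ### Invariants of executions -/

section invariants

variable {m n M : ℕ} {I : SetCover m n} {loc : Fin n → Fin M} {e : ℝ} {W a T s : ℕ}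

theorem Ty.words_list_nat (l : List ℕ) : (Ty.list .nat).words l = 1 + l.length := by
  induction l with
  | nil => rfl
  | cons x l ih =>
    have : (Ty.list .nat).words (x :: l) = 1 + (Ty.list .nat).words l := Ty.words_cons _ _
    rw [this, ih, List.length_cons]; omega

theorem words_cell (p : Ty.cell.Val) : Ty.cell.words p = 4 + p.2.2.2.length := by
  have h := Ty.words_list_nat p.2.2.2
  change 1 + (1 + (1 + (Ty.list .nat).words p.2.2.2)) = _
  omega

/-- A sampled set is active and so has `D ≥ 1` uncovered elements. Its cell occupies `4 + D ≤ 5 D`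
words, so the truncation by total size also bounds the memory. -/
theorem words_samples {σ : AState m n} {C : List ℕ} {ω : Fin n → ℕ} (hC : Repr C σ.U) :
    ∀ l : List Ty.cell.Val, (∀ z ∈ l, ∃ i, z = cellOf I C i ∧ Smp I e s σ.c σ.v σ.k σ.U ω i) →
      (Ty.list .cell).words l ≤ 1 + 5 * total l
  | [], _ => (Ty.words_nil (a := .cell)).le.trans (by omega)
  | z :: l, h => by
      have ih := words_samples hC l fun y hy => h y (by simp [hy])
      obtain ⟨i, rfl, hi⟩ := h z (by simp)
      have h1 := hi.1.res_pos
      have h2 : Ty.cell.words (cellOf I C i) = 4 + res I σ.U i := by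
        rw [words_cell, ← hC.length_uncovered_els i]; rfl
      have h3 : total (cellOf I C i :: l) = res I σ.U i + total l := by
        have h4 : total (cellOf I C i :: l) = cellSize (cellOf I C i) + total l := by simp [total]
        rw [h4, ← hC.length_uncovered_els i]; rfl
      rw [Ty.words_cons, h2, h3]
      omega

theorem Summ.words_le {σ : AState m n} {C : List ℕ} {ω : Fin n → ℕ} (hC : Repr C σ.U)
    {x : Ty.msg.Val} {L : List (Fin n)} (h : Summ I e s σ.c σ.v σ.k σ.U C ω x L) :
    Ty.msg.words x ≤ 15 * s + 5 := by
  have h1 := words_samples hC x.2 h.mem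
  have h2 := h.tot
  have h3 : Ty.msg.words x = Ty.cell.words x.1 + (Ty.list .cell).words x.2 := rfl
  rw [h3, words_cell, h.nil]
  simp only [List.length_nil]
  omega

theorem words_le_of_length_le {b : Ty} {k : ℕ} : ∀ l : List b.Val, (∀ x ∈ l, b.words x ≤ k) →
    (Ty.list b).words l ≤ 1 + l.length * k
  | [], _ => (Ty.words_nil (a := b)).le.trans (by omega)
  | x :: l, h => by
      have ih := words_le_of_length_le l fun y hy => h y (by simp [hy])
      have := h x (by simp)
      rw [Ty.words_cons, List.length_cons, Nat.add_mul, one_mul]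
      omega

/-- Every picked set covers a new element, so at most `m` sets are ever chosen. -/
theorem length_outputOf {σ : AState m n} (h : AInv I e σ) (i : Fin M) :
    (outputOf σ i).length ≤ m := by
  have h1 : σ.X.length ≤ σ.U.card := h.charged.2.1
  have h2 : σ.U.card ≤ m := (Finset.card_le_univ _).trans (by simp)
  unfold outputOf
  split_ifs
  · rw [List.length_map]; omega
  · simp

/-- A bound for the memory that is needed on a machine, if `P` is a bound for its input. -/
def memoryBound (m a s P : ℕ) : ℕ := P + 4 * m + 20 + a * (15 * s + m + 6)

variable [NeZero M]

variable (I loc e a T s) in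
/-- Invariant of the executions. -/
def Sound (c : coverAlgorithm.Config M) : Prop :=
  (∃ σ C t, AInv I e σ ∧ Repr C σ.U ∧ t ≤ T ∧ DownInv I loc e a T s σ C t c ∧
    (coverAlgorithm.Halted c → σ.U = Finset.univ)) ∨
  ∃ σ C ω r, AInv I e σ ∧ Repr C σ.U ∧ r < T ∧ UpInv I loc e a T s σ C ω r c ∧
    ¬ coverAlgorithm.Halted c

theorem Sound.round (hA : Admissible I M W a T s) (he : 0 < e) {c c' : coverAlgorithm.Config M}
    (h : Sound I loc e a T s c) (hc' : c' ∈ (coverAlgorithm.round W c).support) :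
    Sound I loc e a T s c' := by
  by_cases hc : coverAlgorithm.Halted c
  · rw [round_of_halted hc, PMF.support_pure, Set.mem_singleton_iff] at hc'
    rw [hc']; exact h
  rcases h with ⟨σ, C, t, h1, h2, h3, h4, -⟩ | ⟨σ, C, ω, r, h1, h2, h3, h4, -⟩
  · rcases Nat.lt_or_ge t T with ht | ht
    · obtain ⟨c₁, h5, h6, h7⟩ := h4.step hA ht hc
      rw [h5, PMF.support_pure, Set.mem_singleton_iff] at hc'
      rw [hc']
      exact Or.inl ⟨σ, C, t + 1, h1, h2, ht, h6, fun h => absurd h h7⟩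
    · obtain rfl : t = T := le_antisymm h3 ht
      obtain ⟨F, h5, h6⟩ := h4.sample hA h2 hc
      rw [h5, PMF.mem_support_map_iff] at hc'
      obtain ⟨ω, -, rfl⟩ := hc'
      exact Or.inr ⟨σ, C, ω, 0, h1, h2, hA.one_le_depth, (h6 ω).1, (h6 ω).2⟩
  · rcases Nat.lt_or_ge (r + 1) T with hr | hr
    · obtain ⟨c₁, h5, h6, h7⟩ := h4.step hA h2 hr hc
      rw [h5, PMF.support_pure, Set.mem_singleton_iff] at hc'
      rw [hc']
      exact Or.inr ⟨σ, C, ω, r + 1, h1, h2, hr, h6, h7⟩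
    · obtain ⟨c₁, τ, C', h5, h6, h7, h8, h9⟩ := h4.finish hA h2 (by omega) hc
      rw [h5, PMF.support_pure, Set.mem_singleton_iff] at hc'
      rw [hc']
      refine Or.inl ⟨τ, C', 0, h7.inv he h1, h8, Nat.zero_le _, h6, fun h => ?_⟩
      have := h7.subset
      rw [h9.1 h] at this
      exact Finset.univ_subset_iff.1 this

theorem Sound.runRounds (hA : Admissible I M W a T s) (he : 0 < e) {x : Fin M → inputTy.Val}
    (h0 : ∀ c ∈ (coverAlgorithm.runRounds W x 0).support, Sound I loc e a T s c) :
    ∀ r, ∀ c ∈ (coverAlgorithm.runRounds W x r).support, Sound I loc e a T s c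
  | 0 => h0
  | r + 1 => fun c hc => by
      have h : coverAlgorithm.runRounds W x (r + 1) =
        (coverAlgorithm.runRounds W x r).bind (coverAlgorithm.round W) := rfl
      rw [h, PMF.mem_support_bind_iff] at hc
      obtain ⟨c₁, h1, h2⟩ := hc
      exact (Sound.runRounds hA he h0 r c₁ h1).round hA he h2

theorem Sound.output (he : 0 < e) {c : coverAlgorithm.Config M} (h : Sound I loc e a T s c)
    (hc : coverAlgorithm.Halted c) : (∀ k ∈ coverAlgorithm.output c, k < n) ∧
      I.IsApproxMinCover (e * (harmonic I.maxCard : ℝ))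
        (Finset.univ.filter fun l : Fin n => l.val ∈ coverAlgorithm.output c) := by
  rcases h with ⟨σ, C, t, h1, h2, h3, h4, h5⟩ | ⟨_, _, _, _, _, _, _, _, h5⟩
  · have ho : coverAlgorithm.output c = σ.X.map Fin.val := by
      obtain ⟨f, p, ms, h6, -⟩ := h4 0
      unfold Algorithm.output
      rw [h6]
      change outputOf σ (0 : Fin M) = _
      unfold outputOf
      exact if_pos rfl
    rw [ho]
    refine ⟨fun k hk => ?_, h1.charged.isApproxMinCover he (h5 hc)⟩
    obtain ⟨l, -, rfl⟩ := List.mem_map.1 hk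
    exact l.2
  · exact absurd hc h5

omit [NeZero M] in
theorem words_state {f : ℕ} {X : List ℕ} {i : Fin M} {t : ℕ} {p : Ty.cell.Val}
    {ms : List Ty.msg.Val} {d P : ℕ} {ε : ℝ}
    (hP : inputTy.words (input I loc d ε i) ≤ P) (hX : X.length ≤ m) (hp : p.2.2.2.length ≤ m) :
    Ty.stepIn.words (mkState f X (fixed I loc e a T s i) t p, ms) ≤
      P + 2 * m + 7 + (Ty.list .msg).words ms := by
  have h1 : inputTy.words (input I loc d ε i) =
      6 + (Ty.list .wset).words ((storedOn loc i).map (triple I)) := by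
    change (1 + (1 + (1 + (1 + 1)))) +
      (1 + (Ty.list .wset).words ((storedOn loc i).map (triple I))) = _
    omega
  have h2 : Ty.stepIn.words (mkState f X (fixed I loc e a T s i) t p, ms) =
      ((1 + (Ty.list .nat).words X) + (((1 + (1 + (1 + 1))) +
        (1 + (Ty.list .wset).words ((storedOn loc i).map (triple I)))) +
          (1 + Ty.cell.words p))) + (Ty.list .msg).words ms := rfl
  have h3 := Ty.words_list_nat X
  have h4 := words_cell p
  omega

/-- On the way down a machine receives at most one message and on the way up at most `a` messages of
`15 s + 5` words. The term `a (15 s + m + 6)` in `memoryBound` leaves room for these and for the `a`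
copies of the parameters that are sent. -/
theorem Sound.bound (hA : Admissible I M W a T s) {d P : ℕ} {ε : ℝ}
    (hP : ∀ i, inputTy.words (input I loc d ε i) ≤ P) {c : coverAlgorithm.Config M}
    (h : Sound I loc e a T s c) (i : Fin M) :
    Ty.stepIn.words (c i) ≤ memoryBound m a s P ∧ Prog.arity.ev W (c i) = a ∧
      Ty.cell.words (recvP.ev W (c i)) ≤ m + 4 := by
  unfold memoryBound
  rcases h with ⟨σ, C, t, h1, h2, h3, h4, h5⟩ | ⟨σ, C, ω, r, h1, h2, h3, ⟨g, hg, h4⟩, -⟩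
  · obtain ⟨f, p, ms, h6, h7, h8, -⟩ := h4 i
    have hms : (Ty.list .msg).words ms ≤ m + 6 := by
      rcases h8 with rfl | ⟨p', rfl, hp'⟩
      · exact (Ty.words_nil (a := .msg)).le.trans (by omega)
      · have h9 : (Ty.list .msg).words [((p', []) : Ty.msg.Val)] = (Ty.cell.words p' + 1) + 1 :=
          Ty.words_cons _ _
        rw [h9, words_cell]; omega
    have hw := words_state (e := e) (a := a) (T := T) (s := s) (f := f) (t := t) (ms := ms) (hP i)
      (length_outputOf h1 i) h7
    rw [h6]
    refine ⟨hw.trans (by omega), rfl, ?_⟩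
    rw [recvP_ev, words_cell]
    have := length_received h7 h8
    omega
  · obtain ⟨f, h6⟩ := h4 i
    have hC : C.length ≤ m := h2.length_le.le.trans ((Finset.card_le_univ _).trans (by simp))
    have hms : (Ty.list .msg).words ((children M a i).map g) ≤ 1 + a * (15 * s + 5) := by
      refine (words_le_of_length_le _ fun x hx => ?_).trans
        (Nat.add_le_add_left (Nat.mul_le_mul_right (15 * s + 5) ?_) 1)
      · obtain ⟨j, -, rfl⟩ := List.mem_map.1 hx
        exact (hg j).words_le h2
      · rw [List.length_map]
        exact length_filter_div hA.one_le_arity _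
    have hw := words_state (a := a) (T := T) (s := s) (f := f) (t := T + 1 + r)
      (ms := (children M a i).map g) (e := e) (p := par σ C) (hP i) (length_outputOf h1 i) hC
    rw [h6]
    have hmul : a * (15 * s + 5) ≤ a * (15 * s + m + 6) := Nat.mul_le_mul_left _ (by omega)
    refine ⟨hw.trans (by omega), rfl, ?_⟩
    rw [recvP_ev, words_cell]
    rcases hl : (children M a i).map g with _ | ⟨x, l⟩
    · change 4 + C.length ≤ _
      omega
    · obtain ⟨j, -, rfl⟩ := List.mem_map.1 (hl ▸ List.mem_cons_self : x ∈ (children M a i).map g)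
      have : (received (par σ C) (g j :: l)).2.2.2 = [] := (hg j).nil
      rw [this]; simp

/-- Memory and time in terms of the parameters of the tree. -/
theorem exists_runsWithin : ∃ k : ℕ, ∀ (m n M : ℕ) [NeZero M] (I : SetCover m n)
    (loc : Fin n → Fin M) (ε : ℝ) (W a T s d P V : ℕ), 0 < 1 + ε → Admissible I M W a T s →
    (∀ i, inputTy.words (input I loc d ε i) ≤ P) → a ≤ V → M ≤ V → n ≤ V → d ≤ V →
    (∀ c ∈ (coverAlgorithm.runRounds W (input I loc d ε) 0).support,
      Sound I loc (1 + ε) a T s c) →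
    coverAlgorithm.RunsWithin W (input I loc d ε) ((k * memoryBound m a s P : ℕ) : ℝ)
      (k * (memoryBound m a s P + V) ^ k) := by
  obtain ⟨k₁, h1⟩ := linOn_initP
  obtain ⟨k₂, h2⟩ := linOn_stepP
  refine ⟨k₁ + k₂ + 1, fun m n M _ I loc ε W a T s d P V he hA hP haV hMV hnV hdV h0 => ?_⟩
  have hB1 : 1 ≤ memoryBound m a s P := by unfold memoryBound; omega
  have hPB : P ≤ memoryBound m a s P := by unfold memoryBound; omega
  refine ⟨fun i o ho => ?_, fun r c hc i => ?_⟩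
  · have := (h1 W _ V _ ((hP i).trans hPB) ⟨hMV, hnV, hdV⟩ o ho).mono
      (show k₁ ≤ k₁ + k₂ + 1 by omega) le_rfl le_rfl hB1
    exact ⟨by exact_mod_cast this.2.1, this.2.2⟩
  · obtain ⟨h3, h4, h5⟩ := (Sound.runRounds hA he h0 r c hc).bound hA hP i
    refine ⟨?_, fun _ o ho => ?_⟩
    · have : memoryBound m a s P ≤ (k₁ + k₂ + 1) * memoryBound m a s P :=
        Nat.le_mul_of_pos_left _ (by omega)
      exact_mod_cast h3.trans this
    · have h6 : Prog.arity.ev W (c i) * (Ty.cell.words (recvP.ev W (c i)) + 2) ≤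
          memoryBound m a s P := by
        rw [h4]
        refine (Nat.mul_le_mul_left a (show _ ≤ 15 * s + m + 6 by omega)).trans ?_
        unfold memoryBound; omega
      have := (h2 W _ V _ h3 ⟨h4 ▸ haV, h6⟩ o ho).mono
        (show k₂ ≤ k₁ + k₂ + 1 by omega) le_rfl le_rfl hB1
      exact ⟨by exact_mod_cast this.2.1, this.2.2⟩

variable (m n) in
/-- The abstract state at the beginning. -/
def AState.initial : AState m n := ⟨∅, [], 0, 1, 0⟩

theorem pot_initial : pot I e (AState.initial m n).c (AState.initial m n).v
    (AState.initial m n).U = 0 :=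
  pot_eq_zero_iff.2 fun _ h => absurd h.1 (by simp [AState.initial])

theorem horizon_initial (q : ℕ) : horizon I e q (AState.initial m n) =
    (spread I e + 1) * (2 * iterations q I.totalCard + 2) + 1 := by
  unfold horizon levels
  rw [pot_initial, iterations_zero]
  simp [AState.initial]

theorem risk_initial (q : ℕ) : risk I e q (AState.initial m n) = m * iterations q I.totalCard := by
  unfold risk
  rw [if_pos pot_initial]
  simp [AState.initial, AState.unc]

/-- The configuration at the beginning. -/
theorem exists_start {d : ℕ} {ε : ℝ} (hn : 1 ≤ n) (hd : 1 ≤ d) (h1 : (d + 1) ^ 4 < W)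
    (h2 : M * (d + 1) < W) (h3 : n * 2 < W) (h4 : 4 * d * (n * m) < W) (h5 : M + 1 < W) :
    ∃ c, coverAlgorithm.runRounds W (input I loc d ε) 0 = PMF.pure c ∧
      Start I loc (1 + ε) (root4 d + 1) (Nat.clog (root4 d + 1) M + 1)
        (4 * (root4 d * root4 d) * (Nat.clog 2 n * m)) (AState.initial m n) [] c ∧
      ¬ coverAlgorithm.Halted c := by
  set a := root4 d + 1 with ha
  set T := Nat.clog a M + 1 with hT
  set s := 4 * (root4 d * root4 d) * (Nat.clog 2 n * m) with hs
  set c : coverAlgorithm.Config M := fun i =>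
    (mkState 0 [] (fixed I loc (1 + ε) a T s i) 0 (0, (0, ((1 : ℝ), []))), []) with hc
  have hM : 1 ≤ M := Nat.pos_of_ne_zero (NeZero.ne M)
  refine ⟨c, ?_, ⟨⟨charged_empty, zero_lt_one, Or.inl rfl, Or.inl rfl, Or.inl rfl⟩, repr_empty,
    fun i => ⟨0, (0, (0, ((1 : ℝ), []))), [], ?_, Nat.zero_le _, Or.inl rfl, fun _ => rfl⟩⟩, ?_⟩
  · have e1 : (fun i => (coverAlgorithm.init.run W (input I loc d ε i)).map Outcome.val) =
        fun i => PMF.pure (mkState 0 [] (fixed I loc (1 + ε) a T s i) 0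
          (0, (0, ((1 : ℝ), [])))) := by
      funext i
      refine (Prog.vals_det W initP rfl _).trans ?_
      congr 1
      exact initP_ev (1 + ε) _ hM hn hd h1 h2 h3 h4 h5
    have e2 : coverAlgorithm.runRounds W (input I loc d ε) 0 =
        (independent fun i => (coverAlgorithm.init.run W (input I loc d ε i)).map
          Outcome.val).map fun s i => (s i, []) := rfl
    rw [e2, e1, independent_pure, PMF.pure_map]
  · have : outputOf (AState.initial m n) i = [] := by
      unfold outputOf AState.initial; split_ifs <;> rfl
    rw [this]
  · rw [halted_iff rfl]; simp

end invariants

/-! ### Parameters -/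

section parameters

variable {m n M : ℕ} {I : SetCover m n}

theorem Algorithm.RunsWithin.mono {A : Algorithm} [NeZero M] {W : ℕ} {x : Fin M → inputTy.Val}
    {s s' : ℝ} {t t' : ℕ} (h : A.RunsWithin W x s t) (hs : s ≤ s') (ht : t ≤ t') :
    A.RunsWithin W x s' t' :=
  ⟨fun i o ho => ⟨(h.1 i o ho).1.trans hs, (h.1 i o ho).2.trans ht⟩, fun r c hc i =>
    ⟨(h.2 r c hc i).1.trans hs, fun hh o ho =>
      ⟨((h.2 r c hc i).2 hh o ho).1.trans hs, ((h.2 r c hc i).2 hh o ho).2.trans ht⟩⟩⟩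

theorem inputSize_eq : I.inputSize = I.totalCard + n * 2 := by
  unfold SetCover.inputSize SetCover.totalCard
  rw [Finset.sum_add_distrib]
  simp

theorem totalCard_le : I.totalCard ≤ n * m := by
  unfold SetCover.totalCard
  refine (Finset.sum_le_card_nsmul _ _ m fun l _ => ?_).trans (by simp)
  exact (Finset.card_le_univ _).trans (by simp)

theorem root4_sq_le (d : ℕ) : root4 d * root4 d ≤ d := by
  refine le_trans ?_ (root4_pow_le d)
  rw [← pow_two]
  rcases Nat.eq_zero_or_pos (root4 d) with h | h
  · simp [h]
  · exact Nat.pow_le_pow_right h (by omega)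

theorem one_le_root4 {d : ℕ} (hd : 1 ≤ d) : 1 ≤ root4 d := by
  have := lt_root4_pow d
  by_contra h
  have h0 : root4 d = 0 := by omega
  rw [h0] at this; simp at this; omega

theorem one_le_clog {n : ℕ} (hn : 2 ≤ n) : 1 ≤ Nat.clog 2 n := Nat.clog_pos (by omega) hn

theorem clog_le_self (b n : ℕ) (hb : 2 ≤ b) : Nat.clog b n ≤ n :=
  Nat.clog_le_of_le_pow (Nat.lt_pow_self (by omega)).le

/-- The sampling threshold of the algorithm. -/
abbrev threshold (m n d : ℕ) : ℕ := 4 * (root4 d * root4 d) * (Nat.clog 2 n * m)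

theorem threshold_le (m n d : ℕ) : threshold m n d ≤ 4 * d * (n * m) :=
  Nat.mul_le_mul (Nat.mul_le_mul_left 4 (root4_sq_le d))
    (Nat.mul_le_mul_right m (clog_le_self 2 n le_rfl))

/-- The word size suffices. -/
theorem admissible_tree {d N b K : ℕ} (hm : 1 ≤ m) (hn : 2 ≤ n) (hM : 1 ≤ M) (hd : 1 ≤ d)
    (hdn : d ≤ n) (hnN : n * 2 ≤ N) (hmN : m ≤ N) (hΦ : I.totalCard ≤ N) (hMb : M ≤ b * n)
    (hK : b + 5 ≤ K) :
    Admissible I M (N ^ K) (root4 d + 1) (Nat.clog (root4 d + 1) M + 1) (threshold m n d) ∧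
      (d + 1) ^ 4 < N ^ K ∧ M * (d + 1) < N ^ K ∧ n * 2 < N ^ K ∧ 4 * d * (n * m) < N ^ K ∧
      M + 1 < N ^ K := by
  have hN : 4 ≤ N := by omega
  have hq := one_le_root4 hd
  have hqd : root4 d ≤ d := (Nat.le_mul_of_pos_left _ hq).trans (root4_sq_le d)
  set Q := N ^ b with hQ
  have hQ1 : 1 ≤ Q := Nat.one_le_pow _ _ (by omega)
  -- The constant factor in `M ≤ b n` is absorbed by a power of `N` whose exponent depends on `b`
  -- alone.
  have hbQ : b ≤ Q := (Nat.lt_pow_self (by omega : 1 < N)).le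
  have hMQ : M ≤ Q * N := hMb.trans (Nat.mul_le_mul hbQ (by omega))
  have hlt : Q * N ^ 4 < N ^ K := by
    rw [hQ, ← pow_add]
    exact Nat.pow_lt_pow_right (by omega) (by omega)
  have h4 : N ^ 4 ≤ Q * N ^ 4 := Nat.le_mul_of_pos_left _ hQ1
  have hN1 : N ≤ N ^ 4 := Nat.le_self_pow (by omega) N
  have hd1 : d + 1 ≤ N := by omega
  have c1 : (d + 1) ^ 4 < N ^ K := (Nat.pow_le_pow_left hd1 4).trans_lt (h4.trans_lt hlt)
  have c2 : M * (d + 1) ≤ Q * N ^ 2 :=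
    (Nat.mul_le_mul hMQ hd1).trans (le_of_eq (by ring))
  have hQ2 : 4 * (Q * N ^ 2) ≤ Q * N ^ 4 := by
    calc 4 * (Q * N ^ 2) ≤ (N * N) * (Q * N ^ 2) := Nat.mul_le_mul_right _ (by nlinarith)
      _ = Q * N ^ 4 := by ring
  have hQN2 : N ≤ Q * N ^ 2 :=
    (Nat.le_self_pow (by omega) N).trans (Nat.le_mul_of_pos_left _ hQ1)
  have hMN2 : M ≤ Q * N ^ 2 := (Nat.le_mul_of_pos_right M (by omega : 0 < d + 1)).trans c2
  have hdnN : 4 * d * n ≤ N ^ 2 := by nlinarith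
  have c4 : 4 * d * (n * m) ≤ N ^ 3 := by
    calc 4 * d * (n * m) = 4 * d * n * m := by ring
      _ ≤ N ^ 2 * N := Nat.mul_le_mul hdnN hmN
      _ = N ^ 3 := by ring
  have hN3 : 4 * N ^ 3 ≤ N ^ 4 := by
    rw [pow_succ N 3, mul_comm]; exact Nat.mul_le_mul_left _ hN
  have hNN3 : N ≤ N ^ 3 := Nat.le_self_pow (by omega) N
  have hs : threshold m n d ≤ N ^ 3 := (threshold_le m n d).trans c4
  have hT := clog_le_self (root4 d + 1) M (by omega)
  refine ⟨⟨by omega, by omega, ?_, ?_, by omega, by omega, by omega, ?_, by omega⟩, c1, by omega,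
    by omega, by omega, by omega⟩
  · exact (Nat.le_pow_clog (by omega) M).trans (Nat.pow_le_pow_right (by omega) (by omega))
  · have h1 : 1 ≤ 4 * (root4 d * root4 d) * Nat.clog 2 n :=
      Nat.mul_pos (Nat.mul_pos (by omega) (Nat.mul_pos hq hq)) (one_le_clog hn)
    have : m ≤ threshold m n d := by
      unfold threshold
      rw [← mul_assoc]
      exact Nat.le_mul_of_pos_left _ h1
    omega
  · have : (root4 d + 1) * M ≤ M * (d + 1) := by
      rw [mul_comm]; exact Nat.mul_le_mul_left _ (by omega)
    omega

end parameters

/-! ### Estimates -/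

section estimates

theorem half_le_log_two : (1 : ℝ) / 2 ≤ Real.log 2 := by
  have := Real.log_two_gt_d9; linarith

theorem half_le_log {n : ℕ} (hn : 2 ≤ n) : (1 : ℝ) / 2 ≤ Real.log n :=
  half_le_log_two.trans (Real.log_le_log (by norm_num) (by exact_mod_cast hn))

theorem log_le_clog {n : ℕ} (hn : 2 ≤ n) : Real.log n ≤ Nat.clog 2 n := by
  have h1 : (n : ℝ) ≤ 2 ^ Nat.clog 2 n := by exact_mod_cast Nat.le_pow_clog (by norm_num) n
  have h2 := Real.log_le_log (by positivity) h1
  rw [Real.log_pow] at h2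
  have h3 : Real.log 2 ≤ 1 := by have := Real.log_two_lt_d9; linarith
  have h4 : (0 : ℝ) ≤ Nat.clog 2 n := by positivity
  nlinarith

theorem clog_le_log_div {b n : ℕ} (hb : 2 ≤ b) (hn : 1 ≤ n) :
    (Nat.clog b n : ℝ) ≤ Real.log n / Real.log b + 1 := by
  have hb0 : 0 < Real.log b := Real.log_pos (by exact_mod_cast hb)
  rcases Nat.eq_zero_or_pos (Nat.clog b n) with h | h
  · rw [h]
    have : 0 ≤ Real.log n := Real.log_nonneg (by exact_mod_cast hn)
    simp only [Nat.cast_zero]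
    positivity
  · have h1 : b ^ (Nat.clog b n - 1) < n :=
      (Nat.lt_clog_iff_pow_lt (by omega)).1 (by omega)
    have h2 : ((b : ℝ)) ^ (Nat.clog b n - 1) ≤ n := by exact_mod_cast h1.le
    have h3 := Real.log_le_log (by positivity) h2
    rw [Real.log_pow, Nat.cast_sub h, Nat.cast_one] at h3
    rw [← sub_le_iff_le_add, le_div_iff₀ hb0]
    exact h3

theorem clog_two_le {n : ℕ} (hn : 2 ≤ n) : (Nat.clog 2 n : ℝ) ≤ 4 * Real.log n := by
  have h1 := clog_le_log_div (le_refl 2) (by omega : 1 ≤ n)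
  have h2 := half_le_log hn
  have h3 : Real.log n / Real.log (2 : ℕ) ≤ Real.log n / (1 / 2) := by
    have := half_le_log_two
    push_cast
    gcongr
  linarith

/-- The memory that the algorithm needs. -/
theorem memoryBound_le {m n d b : ℕ} {μ x : ℝ} (hm : 2 ≤ m) (hn : 2 ≤ n) (hμ : 0 < μ) (hd : 1 ≤ d)
    (hdμ : (d : ℝ) ≤ 2 * (m : ℝ) ^ μ) (hx : x = (m : ℝ) ^ (1 + μ) * Real.log n) :
    (memoryBound m (root4 d + 1) (threshold m n d) ⌊b * x⌋₊ : ℝ) ≤ (b + 1052 : ℕ) * x := by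
  have hm1 : (1 : ℝ) ≤ m := by exact_mod_cast (by omega : 1 ≤ m)
  have hm0 : (0 : ℝ) < m := by linarith
  have hl := half_le_log hn
  have hlc := clog_two_le hn
  have hmμ : (m : ℝ) ^ (1 + μ) = m * (m : ℝ) ^ μ := by
    rw [Real.rpow_add hm0, Real.rpow_one]
  have hμ1 : (1 : ℝ) ≤ (m : ℝ) ^ μ := Real.one_le_rpow hm1 hμ.le
  have hx0 : 0 ≤ x := by rw [hx]; positivity
  have h1 : (⌊b * x⌋₊ : ℝ) ≤ b * x := Nat.floor_le (by positivity)
  have hmx : (m : ℝ) ≤ 2 * x := by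
    rw [hx, hmμ]
    have : (m : ℝ) ≤ m * (m : ℝ) ^ μ := le_mul_of_one_le_right hm0.le hμ1
    nlinarith
  have hq := one_le_root4 hd
  have hc := one_le_clog hn
  -- The arity and the threshold contribute `q · q²`; this is where the fourth root leaves room,
  -- since `q³ ≤ q⁴ ≤ d`.
  have h2 : (root4 d + 1) * (15 * threshold m n d + m + 6) ≤ 128 * (d * (Nat.clog 2 n * m)) := by
    set q := root4 d with hqd
    set z := Nat.clog 2 n * m with hz
    have hmz : m ≤ z := Nat.le_mul_of_pos_left _ hc
    have hzq : z ≤ q * q * z := Nat.le_mul_of_pos_left _ (Nat.mul_pos hq hq)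
    have e1 : 15 * threshold m n d + m + 6 ≤ 64 * (q * q * z) := by
      have : threshold m n d = 4 * (q * q * z) := by simp only [threshold, ← hqd, ← hz]; ring
      omega
    calc (q + 1) * (15 * threshold m n d + m + 6) ≤ (2 * q) * (64 * (q * q * z)) :=
          Nat.mul_le_mul (by omega) e1
      _ = 128 * (q ^ 3 * z) := by ring
      _ ≤ 128 * (d * z) := by
          refine Nat.mul_le_mul_left _ (Nat.mul_le_mul_right _ ?_)
          exact (Nat.pow_le_pow_right hq (by omega)).trans (root4_pow_le d)
  have h3 : ((d * (Nat.clog 2 n * m) : ℕ) : ℝ) ≤ 8 * x := by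
    push_cast
    calc (d : ℝ) * (Nat.clog 2 n * m) ≤ (2 * (m : ℝ) ^ μ) * (4 * Real.log n * m) := by gcongr
      _ = 8 * x := by rw [hx, hmμ]; ring
  have h4 : (((root4 d + 1) * (15 * threshold m n d + m + 6) : ℕ) : ℝ) ≤
      128 * ((d * (Nat.clog 2 n * m) : ℕ) : ℝ) := by exact_mod_cast h2
  have h20 : (20 : ℝ) ≤ 10 * m := by
    have : (2 : ℝ) ≤ m := by exact_mod_cast hm
    linarith
  have e1 : (memoryBound m (root4 d + 1) (threshold m n d) ⌊b * x⌋₊ : ℝ) =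
      ⌊b * x⌋₊ + 4 * m + 20 + (((root4 d + 1) * (15 * threshold m n d + m + 6) : ℕ) : ℝ) := by
    unfold memoryBound; push_cast; ring
  rw [e1]
  push_cast at *
  linarith

end estimates

/-! ### Time, number of rounds and failure probability -/

section estimates

theorem time_le {N B V b k K : ℕ} (hN : 4 ≤ N) (hB : B ≤ (b + 1052) * N ^ 2)
    (hV : V ≤ N ^ (b + 2)) (hK : (b + 1056) * k ≤ K) : k * (B + V) ^ k ≤ N ^ K := by
  have h1 : b + 1052 ≤ N ^ (b + 1052) := (Nat.lt_pow_self (by omega)).le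
  have h2 : B ≤ N ^ (b + 1054) := by
    refine hB.trans ((Nat.mul_le_mul_right _ h1).trans (le_of_eq ?_))
    rw [← pow_add]
  have h3 : V ≤ N ^ (b + 1054) := hV.trans (Nat.pow_le_pow_right (by omega) (by omega))
  have h4 : B + V ≤ N ^ (b + 1055) := by
    rw [show b + 1055 = (b + 1054) + 1 by omega, pow_succ]
    nlinarith [Nat.zero_le (N ^ (b + 1054))]
  have h5 : k ≤ N ^ k := (Nat.lt_pow_self (by omega)).le
  calc k * (B + V) ^ k ≤ N ^ k * (N ^ (b + 1055)) ^ k :=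
        Nat.mul_le_mul h5 (Nat.pow_le_pow_left h4 k)
    _ = N ^ ((b + 1056) * k) := by rw [← pow_mul, ← pow_add]; congr 1; ring
    _ ≤ N ^ K := Nat.pow_le_pow_right (by omega) hK

variable {m n M d b : ℕ} {μ : ℝ}

theorem log_rpow_quarter (hm : 2 ≤ m) : Real.log ((m : ℝ) ^ (μ / 4)) = μ * Real.log m / 4 := by
  have : (0 : ℝ) < m := by exact_mod_cast (by omega : 0 < m)
  rw [Real.log_rpow this]; ring

/-- The number of rounds of an epoch. -/
theorem epoch_le {y : ℝ} (hn : 2 ≤ n) (hM : 1 ≤ M) (hMb : M ≤ b * n)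
    (hy : 1 < y) (hyq : y < root4 d + 1) (hyn : 4 * Real.log y ≤ Real.log n) :
    ((2 * (Nat.clog (root4 d + 1) M + 1) + 1 : ℕ) : ℝ) ≤
      4 * (b + 1) * (Real.log n / Real.log y) := by
  have hb : 1 ≤ b := by
    by_contra h
    have : b = 0 := by omega
    rw [this] at hMb; omega
  have hn0 : (0 : ℝ) < n := by exact_mod_cast (by omega : 0 < n)
  have hb0 : (0 : ℝ) < b := by exact_mod_cast hb
  have hly : 0 < Real.log y := Real.log_pos hy
  have hln := half_le_log hn
  have hq : 1 ≤ root4 d := by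
    by_contra h
    have : root4 d = 0 := by omega
    rw [this] at hyq; norm_num at hyq; linarith
  have h1 := clog_le_log_div (b := root4 d + 1) (by omega) hM
  have h2 : Real.log y ≤ Real.log (root4 d + 1 : ℕ) :=
    Real.log_le_log (by linarith) (by push_cast; exact hyq.le)
  have h3 : Real.log M ≤ Real.log b + Real.log n := by
    rw [← Real.log_mul hb0.ne' hn0.ne']
    exact Real.log_le_log (by exact_mod_cast hM) (by exact_mod_cast hMb)
  -- Since `log n ≥ 1 / 2`, the additive term `log b` turns into a multiple of `log n`. In the same
  -- way, `4 ≤ log n / log y` absorbs additive constants below.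
  have h4 : Real.log b ≤ (b - 1) * (2 * Real.log n) := by
    have h5 := Real.log_le_sub_one_of_pos hb0
    have h6 : (1 : ℝ) ≤ b := by exact_mod_cast hb
    nlinarith
  have hM0 : 0 ≤ Real.log M := Real.log_nonneg (by exact_mod_cast hM)
  have h7 : Real.log M / Real.log (root4 d + 1 : ℕ) ≤ (2 * b - 1) * (Real.log n / Real.log y) := by
    calc Real.log M / Real.log (root4 d + 1 : ℕ) ≤ Real.log M / Real.log y := by gcongr
      _ ≤ ((2 * b - 1) * Real.log n) / Real.log y := by gcongr; linarith
      _ = _ := by ring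
  have h8 : 4 ≤ Real.log n / Real.log y := by rw [le_div_iff₀ hly]; exact hyn
  push_cast
  have h9 : (Nat.clog (root4 d + 1) M : ℝ) ≤ (2 * b - 1) * (Real.log n / Real.log y) + 1 :=
    h1.trans (by linarith)
  nlinarith

/-- The number of iterations. -/
theorem iterations_le {y : ℝ} {p : ℕ} (hq : 5 ≤ root4 d) (hy : 1 < y) (hyq : y < root4 d + 1)
    (hp : 1 ≤ p) (hyp : Real.log y ≤ Real.log p) :
    (iterations (root4 d) p : ℝ) ≤ 3 * (Real.log p / Real.log y) := by
  have hly : 0 < Real.log y := Real.log_pos hy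
  have hq' : (5 : ℝ) ≤ root4 d := by exact_mod_cast hq
  -- For `q ≥ 5` one has `q + 1 ≤ q² / 4`. So reducing by `q / 2` instead of `y` costs only a factor
  -- `2` in the number of iterations.
  have h1 : y ≤ ((root4 d : ℝ) / 2) ^ 2 := by nlinarith
  have h2 : Real.log y ≤ 2 * Real.log ((root4 d : ℝ) / 2) := by
    have := Real.log_le_log (by linarith) h1
    rw [Real.log_pow] at this
    exact_mod_cast this
  have hlp : 0 ≤ Real.log p := Real.log_nonneg (by exact_mod_cast hp)
  have h3 : 1 ≤ Real.log p / Real.log y := by rwa [le_div_iff₀ hly, one_mul]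
  have h4 : Real.logb ((root4 d : ℝ) / 2) p ≤ 2 * (Real.log p / Real.log y) := by
    unfold Real.logb
    calc Real.log p / Real.log ((root4 d : ℝ) / 2) ≤ Real.log p / (Real.log y / 2) := by
          gcongr; linarith
      _ = _ := by field_simp
  have h5 : 0 ≤ Real.logb ((root4 d : ℝ) / 2) p :=
    Real.logb_nonneg (by linarith) (by exact_mod_cast hp)
  have h6 := Nat.floor_le h5
  unfold iterations
  rw [if_neg (by omega)]
  push_cast
  linarith

/-- The total number of rounds. -/
theorem rounds_le {ν t g S : ℝ} {h it sp : ℕ} (hsp : (sp : ℝ) ≤ S)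
    (hit : (it : ℝ) ≤ 3 * t) (ht : 1 ≤ t) (hE : ν ≤ 4 * (b + 1) * g) (hν : 0 ≤ ν)
    (hh : h = (sp + 1) * (2 * it + 2) + 1) : h * ν ≤ 36 * (b + 1) * (t * (1 + S) * g) := by
  have hS : 0 ≤ S := le_trans (Nat.cast_nonneg _) hsp
  have h1 : (h : ℝ) ≤ 9 * (t * (1 + S)) := by
    rw [hh]; push_cast
    have h2 : ((sp : ℝ) + 1) * (2 * it + 2) ≤ (1 + S) * (8 * t) :=
      mul_le_mul (by linarith) (by linarith) (by positivity) (by linarith)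
    nlinarith
  calc h * ν ≤ (9 * (t * (1 + S))) * (4 * (b + 1) * g) := by
        refine mul_le_mul h1 hE hν ?_
        positivity
    _ = _ := by ring

/-- The failure probability. -/
theorem failure_le {y : ℝ} {q lam it : ℕ} (hm : 2 ≤ m) (hn : 2 ≤ n) (hμ : 0 < μ) {p : ℕ}
    (hp1 : 1 ≤ p) (hp : p ≤ n * m) (hy : y = (m : ℝ) ^ (μ / 4)) (hy5 : 5 < y) (hyq : y < q + 1)
    (hlam : lam = Nat.clog 2 n) (hit : (it : ℝ) ≤ 3 * (Real.log p / Real.log y)) :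
    2 * Real.exp (-(q * lam : ℝ)) * (m * it : ℕ) ≤ 72 * (m / μ) * Real.exp (-y / 2) := by
  have hm0 : (0 : ℝ) < m := by exact_mod_cast (by omega : 0 < m)
  have hn0 : (0 : ℝ) < n := by exact_mod_cast (by omega : 0 < n)
  have hlm := half_le_log hm
  have hln := half_le_log hn
  have hlc := log_le_clog hn
  have hlam1 : 1 ≤ lam := hlam ▸ one_le_clog hn
  have hlam1' : (1 : ℝ) ≤ lam := by exact_mod_cast hlam1
  rw [← hlam] at hlc
  have h1 : Real.log p ≤ Real.log n + Real.log m := by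
    rw [← Real.log_mul hn0.ne' hm0.ne']
    exact Real.log_le_log (by exact_mod_cast hp1) (by exact_mod_cast hp)
  have h2 : (it : ℝ) ≤ 36 * lam / μ := by
    refine hit.trans ?_
    rw [hy, log_rpow_quarter hm, div_div_eq_mul_div, mul_div_assoc', div_le_div_iff₀ (by positivity) hμ]
    have h3 : Real.log p ≤ 3 * lam * Real.log m := by nlinarith
    nlinarith [mul_le_mul_of_nonneg_left h3 hμ.le]
  have h4 : (lam : ℝ) ≤ Real.exp lam := (by linarith : (lam : ℝ) ≤ lam + 1).trans (Real.add_one_le_exp _)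
  -- The number of iterations contains a factor of order `log n`, hence `lam`; lowering `q` by one
  -- in the exponent absorbs it. Then `q - 1 ≥ y / 2`, because `5 < y < q + 1`.
  have h5 : Real.exp (-(q * lam : ℝ)) * lam ≤ Real.exp (-y / 2) := by
    calc Real.exp (-(q * lam : ℝ)) * lam ≤ Real.exp (-(q * lam : ℝ)) * Real.exp lam := by gcongr
      _ = Real.exp (-((q - 1) * lam : ℝ)) := by rw [← Real.exp_add]; congr 1; ring
      _ ≤ Real.exp (-y / 2) := by
          refine Real.exp_le_exp.2 ?_
          have : (q : ℝ) - 1 ≤ (q - 1) * lam := le_mul_of_one_le_right (by linarith) hlam1'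
          linarith
  push_cast
  calc 2 * Real.exp (-(q * lam : ℝ)) * (m * it) ≤
        2 * Real.exp (-(q * lam : ℝ)) * (m * (36 * lam / μ)) := by gcongr
    _ = 72 * (m / μ) * (Real.exp (-(q * lam : ℝ)) * lam) := by ring
    _ ≤ _ := by gcongr

/-- If `m ^ (μ / 4)` is small, then the bound for the failure probability is trivial. -/
theorem one_le_of_small {y K : ℝ} (hm : 2 ≤ m) (hμ : 0 < μ) (hy : y = (m : ℝ) ^ (μ / 4))
    (hy5 : y ≤ 5) (hK : 216 ≤ K) : 1 ≤ K * (m / μ) * Real.exp (-y / 2) := by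
  have hm0 : (2 : ℝ) ≤ m := by exact_mod_cast hm
  have hlm := half_le_log hm
  have hy0 : 0 < y := by rw [hy]; positivity
  have he := Real.exp_one_gt_d9
  have hl5 : Real.log y ≤ 2 := by
    rw [Real.log_le_iff_le_exp hy0]
    have : Real.exp 2 = Real.exp 1 * Real.exp 1 := by rw [← Real.exp_add]; norm_num
    rw [this]; nlinarith
  rw [hy, log_rpow_quarter hm] at hl5
  -- From `μ log m ≤ 8` and `log m ≥ 1 / 2` it follows that `μ ≤ 16`, and `m ≥ 2`.
  have h1 : (1 : ℝ) / 8 ≤ m / μ := by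
    rw [div_le_div_iff₀ (by norm_num) hμ]
    nlinarith
  have h2 : (1 : ℝ) / 27 ≤ Real.exp (-y / 2) := by
    have h3 : Real.exp (-3) ≤ Real.exp (-y / 2) := Real.exp_le_exp.2 (by linarith)
    refine le_trans ?_ h3
    rw [Real.exp_neg, one_div]
    refine inv_anti₀ (Real.exp_pos _) ?_
    have h4 := Real.exp_one_lt_d9
    have : Real.exp 3 = Real.exp 1 * Real.exp 1 * Real.exp 1 := by
      rw [← Real.exp_add, ← Real.exp_add]; norm_num
    rw [this]
    have h5 : Real.exp 1 ≤ 3 := by linarith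
    calc Real.exp 1 * Real.exp 1 * Real.exp 1 ≤ 3 * 3 * 3 := by gcongr
      _ = 27 := by norm_num
  calc (1 : ℝ) = 216 * (1 / 8) * (1 / 27) := by norm_num
    _ ≤ K * (m / μ) * Real.exp (-y / 2) := by gcongr

end estimates

end MapReduce

/-! ### Assembly of the main theorem -/

set_option maxHeartbeats 1600000 in
theorem mainTheorem5 :
    ∃ A : MapReduce.Algorithm, ∀ κ : ℝ, ∃ K : ℕ,
      ∀ (m n M : ℕ) [NeZero M] (I : MapReduce.SetCover m n) (loc : Fin n → Fin M) (ε μ : ℝ),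
        2 ≤ m → 0 < ε → 0 < μ →
        (m : ℝ) ^ (1 + μ) ≤ (I.totalCard : ℝ) →
        (M : ℝ) ≤ κ * n →
        (∀ i : Fin M,
          (MapReduce.inputTy.words (MapReduce.input I loc ⌈(m : ℝ) ^ μ⌉₊ ε i) : ℝ)
            ≤ κ * ((m : ℝ) ^ (1 + μ) * Real.log n)) →
        -- the initial data, and the word size: words of `O(log N)` bits for input size `N`
        let x : Fin M → MapReduce.inputTy.Val := MapReduce.input I loc ⌈(m : ℝ) ^ μ⌉₊ ε
        let W : ℕ := I.inputSize ^ K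
        -- memory per machine, and polynomial-time local computation
        A.RunsWithin W x (K * ((m : ℝ) ^ (1 + μ) * Real.log n)) (I.inputSize ^ K) ∧
        -- whenever the computation has ended, the output is an approximate minimum set cover
        (∀ r, ∀ c ∈ (A.runRounds W x r).support, A.Halted c →
          (∀ k ∈ A.output c, k < n) ∧
          I.IsApproxMinCover ((1 + ε) * (harmonic I.maxCard : ℝ))
            (Finset.univ.filter fun l : Fin n => l.val ∈ A.output c)) ∧
        -- the computation ends almost surely
        Tendsto (A.haltProb W x) atTop (𝓝 1) ∧
        -- the number of rounds
        ∀ R : ℕ,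
          K * (Real.log I.totalCard
              * (1 + Real.logb (1 + ε) (I.maxCard * I.maxWeight / I.minWeight))
              * Real.log n / (μ ^ 2 * Real.log m ^ 2)) ≤ (R : ℝ) →
          1 - K * (m / μ) * Real.exp (-((m : ℝ) ^ (μ / 4)) / 2) ≤ A.haltProb W x R := by
  obtain ⟨k, hk⟩ := MapReduce.exists_runsWithin
  refine ⟨MapReduce.coverAlgorithm, fun κ => ?_⟩
  obtain ⟨b, hκb⟩ : ∃ b : ℕ, κ ≤ b := ⟨_, Nat.le_ceil κ⟩
  -- A common bound for all that is required of `K`: `(b + 1056) k` for the time, `576 (b + 1)` for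
  -- the rounds, `216` for the failure probability and `b + 5` for the word size.
  obtain ⟨K, hK⟩ : ∃ K : ℕ, K = b * k + 1056 * k + 577 * b + 1632 := ⟨_, rfl⟩
  refine ⟨K, ?_⟩
  intro m n M _ I loc ε μ hm hε hμ hΦ hMκ hin x W
  set d : ℕ := ⌈(m : ℝ) ^ μ⌉₊ with hd
  -- consequences of the assumptions
  have hm0 : (0 : ℝ) < m := by exact_mod_cast (by omega : 0 < m)
  have hm1 : (1 : ℝ) ≤ m := by exact_mod_cast (by omega : 1 ≤ m)
  have hM : 1 ≤ M := Nat.pos_of_ne_zero (NeZero.ne M)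
  have hM0 : (0 : ℝ) < M := by exact_mod_cast hM
  -- For `n ≤ 1` the assumed memory bound would be `0`, but the input of a machine is never empty.
  have hn : 2 ≤ n := by
    by_contra hlt
    have h0 : Real.log n = 0 := by
      have : n = 0 ∨ n = 1 := by omega
      rcases this with h | h <;> simp [h]
    have h1 := hin 0
    rw [h0, mul_zero, mul_zero] at h1
    have h2 : 0 < MapReduce.inputTy.words (MapReduce.input I loc d ε 0) := by
      change 0 < (1 + (1 + (1 + (1 + 1)))) + _
      omega
    have h3 : (0 : ℝ) < MapReduce.inputTy.words (MapReduce.input I loc d ε 0) := by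
      exact_mod_cast h2
    linarith
  have hn0 : (0 : ℝ) < n := by exact_mod_cast (by omega : 0 < n)
  have hln := MapReduce.half_le_log hn
  have hlm := MapReduce.half_le_log hm
  have hmμ1 : (1 : ℝ) ≤ (m : ℝ) ^ μ := Real.one_le_rpow hm1 hμ.le
  have hmμ : (m : ℝ) ^ (1 + μ) = m * (m : ℝ) ^ μ := by rw [Real.rpow_add hm0, Real.rpow_one]
  -- From `m ^ (1 + μ) ≤ Φ ≤ n m`. It bounds `d` by `n`, and later makes `log y` small compared with
  -- `log n`.
  have hnμ : (m : ℝ) ^ μ ≤ n := by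
    have h1 : (I.totalCard : ℝ) ≤ n * m := by exact_mod_cast MapReduce.totalCard_le
    rw [hmμ] at hΦ
    have h2 : m * (m : ℝ) ^ μ ≤ m * n := by linarith
    exact le_of_mul_le_mul_left h2 hm0
  have hd1 : 1 ≤ d := Nat.one_le_ceil_iff.2 (by linarith)
  have hdn : d ≤ n := Nat.ceil_le.2 hnμ
  have hdμ : (d : ℝ) ≤ 2 * (m : ℝ) ^ μ := by
    have := Nat.ceil_lt_add_one (show 0 ≤ (m : ℝ) ^ μ by linarith)
    linarith
  have hMb : M ≤ b * n := by
    have : (M : ℝ) ≤ b * n := hMκ.trans (by gcongr)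
    exact_mod_cast this
  set N := I.inputSize with hN
  have hNeq : N = I.totalCard + n * 2 := MapReduce.inputSize_eq
  have hmΦ : m ≤ I.totalCard := by
    have : (m : ℝ) ≤ I.totalCard :=
      (by rw [hmμ]; exact le_mul_of_one_le_right hm0.le hmμ1 : (m : ℝ) ≤ (m : ℝ) ^ (1 + μ)).trans hΦ
    exact_mod_cast this
  have hbK : b + 5 ≤ K := by omega
  obtain ⟨hA, c1, c2, c3, c4, c5⟩ := MapReduce.admissible_tree (I := I) (d := d) (N := N) (b := b)
    (K := K) (by omega) hn hM hd1 hdn (by omega) (by omega) (by omega) hMb hbK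
  obtain ⟨c₀, hrun, hstart, hc₀⟩ := MapReduce.exists_start (I := I) (loc := loc) (ε := ε)
    (by omega) hd1 c1 c2 c3 c4 c5
  have he : 1 < 1 + ε := by linarith
  have he0 : 0 < 1 + ε := by linarith
  have hsound : ∀ c ∈ (MapReduce.coverAlgorithm.runRounds W x 0).support,
      MapReduce.Sound I loc (1 + ε) (MapReduce.root4 d + 1)
        (Nat.clog (MapReduce.root4 d + 1) M + 1) (MapReduce.threshold m n d) c := by
    intro c hc
    have hc' : c = c₀ := by
      have h := hrun
      change MapReduce.coverAlgorithm.runRounds W x 0 = _ at h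
      rw [h, PMF.support_pure] at hc
      exact hc
    rw [hc']
    exact Or.inl ⟨_, _, 0, hstart.inv, hstart.repr, Nat.zero_le _, hstart.down,
      fun h => absurd h hc₀⟩
  have hhalt : ∀ r, MapReduce.coverAlgorithm.haltProb W x r =
      1 - (MapReduce.survive MapReduce.coverAlgorithm W r c₀).toReal := by
    intro r
    rw [MapReduce.haltProb_eq, show MapReduce.coverAlgorithm.runRounds W x 0 = _ from hrun,
      MapReduce.expect_pure]
  set z : ℝ := (m : ℝ) ^ (1 + μ) * Real.log n with hz
  have hz0 : 0 ≤ z := by positivity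
  have hs1 : 1 ≤ MapReduce.threshold m n d := by
    have := hA.le_size
    omega
  refine ⟨?_, fun r c hc hh => ?_, ?_, fun R hR => ?_⟩
  · -- memory and time
    have hP : ∀ i, MapReduce.inputTy.words (MapReduce.input I loc d ε i) ≤ ⌊b * z⌋₊ := fun i =>
      Nat.le_floor ((hin i).trans (by gcongr))
    have hmem := MapReduce.memoryBound_le (b := b) hm hn hμ hd1 hdμ hz
    have hr := hk m n M I loc ε W _ _ _ d _ (N + M) he0 hA hP
      (by
        have := MapReduce.root4_sq_le d
        have : MapReduce.root4 d ≤ d :=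
          (Nat.le_mul_of_pos_left _ (MapReduce.one_le_root4 hd1)).trans this
        omega) (by omega) (by omega) (by omega) hsound
    refine hr.mono ?_ (MapReduce.time_le (b := b) (by omega) ?_ ?_ ?_)
    · push_cast at hmem ⊢
      calc (k : ℝ) * MapReduce.memoryBound m (MapReduce.root4 d + 1) (MapReduce.threshold m n d)
            ⌊b * z⌋₊ ≤ k * ((b + 1052) * z) := by gcongr
        _ = (k * (b + 1052)) * z := by ring
        _ ≤ K * z := by
            refine mul_le_mul_of_nonneg_right ?_ hz0
            have : k * (b + 1052) ≤ K := by rw [hK]; ring_nf; omega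
            exact_mod_cast this
    · have hzN : z ≤ (N : ℝ) ^ 2 := by
        have h1 : (m : ℝ) ^ (1 + μ) ≤ N := hΦ.trans (by exact_mod_cast (by omega : I.totalCard ≤ N))
        have h2 : Real.log n ≤ N := by
          have h3 := Real.log_le_sub_one_of_pos hn0
          have h4 : (n : ℝ) ≤ N := by exact_mod_cast (by omega : n ≤ N)
          linarith
        rw [hz, pow_two]
        gcongr
      have h3 : (MapReduce.memoryBound m (MapReduce.root4 d + 1) (MapReduce.threshold m n d)
          ⌊b * z⌋₊ : ℝ) ≤ ((b + 1052) * N ^ 2 : ℕ) := by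
        push_cast at hmem ⊢
        exact hmem.trans (by gcongr)
      exact_mod_cast h3
    · have hbN : b ≤ N ^ b := (Nat.lt_pow_self (by omega : 1 < N)).le
      have h1 : M ≤ N ^ (b + 1) := by
        rw [pow_succ]
        exact hMb.trans (Nat.mul_le_mul hbN (by omega))
      have h2 : N ≤ N ^ (b + 1) := Nat.le_self_pow (by omega) N
      rw [show b + 2 = (b + 1) + 1 by omega, pow_succ]
      nlinarith [Nat.zero_le (N ^ (b + 1))]
    · rw [hK]; ring_nf; omega
  · -- the output
    exact (MapReduce.Sound.runRounds hA he0 hsound r c hc).output he0 hh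
  · -- termination
    have h := (MapReduce.tendsto_survive hA he.le hs1 (by omega) hstart).const_sub 1
    rw [sub_zero] at h
    exact h.congr fun r => (hhalt r).symm
  · -- the number of rounds
    rw [hhalt]
    set y : ℝ := (m : ℝ) ^ (μ / 4) with hy
    have hK216 : 216 ≤ K := by omega
    -- For `y ≤ 5` the number `q / 2` need not exceed `1`, so the potential argument is not
    -- available, but then the claimed lower bound for the probability is at most `0`.
    rcases le_or_gt y 5 with hy5 | hy5
    · have h1 := MapReduce.one_le_of_small (K := K) hm hμ hy hy5 (by exact_mod_cast hK216)
      have h2 : (MapReduce.survive MapReduce.coverAlgorithm W R c₀).toReal ≤ 1 :=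
        ENNReal.toReal_le_of_le_ofReal zero_le_one (by
          rw [ENNReal.ofReal_one]; exact MapReduce.survive_le_one _ _)
      linarith
    have hy4 : y ^ 4 = (m : ℝ) ^ μ := by
      rw [hy, ← Real.rpow_natCast, ← Real.rpow_mul hm0.le]
      congr 1; push_cast; ring
    have hyq : y < MapReduce.root4 d + 1 := by
      have h1 : y ^ 4 < ((MapReduce.root4 d : ℝ) + 1) ^ 4 := by
        rw [hy4]
        refine (Nat.le_ceil _).trans_lt ?_
        exact_mod_cast MapReduce.lt_root4_pow d
      exact lt_of_pow_lt_pow_left₀ 4 (by positivity) h1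
    have hq5 : 5 ≤ MapReduce.root4 d := by
      have : (5 : ℝ) < (MapReduce.root4 d + 1 : ℕ) := by push_cast; linarith
      have : 5 < MapReduce.root4 d + 1 := by exact_mod_cast this
      omega
    have hy1 : 1 < y := by linarith
    have hly : Real.log y = μ * Real.log m / 4 := MapReduce.log_rpow_quarter hm
    have hly0 : 0 < Real.log y := Real.log_pos hy1
    have hyn : 4 * Real.log y ≤ Real.log n := by
      have h1 := Real.log_le_log (by linarith) hnμ
      rw [Real.log_rpow hm0] at h1
      rw [hly]; linarith
    have hΦ1 : 1 ≤ I.totalCard := by omega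
    have hyΦ : Real.log y ≤ Real.log I.totalCard := by
      have h1 := Real.log_le_log (by positivity) hΦ
      rw [Real.log_rpow hm0] at h1
      have : 0 < μ * Real.log m := by positivity
      rw [hly]; nlinarith
    have hit := MapReduce.iterations_le hq5 hy1 hyq hΦ1 hyΦ
    have hE := MapReduce.epoch_le hn hM hMb hy1 hyq hyn
    have hratio : (1 : ℝ) ≤ I.maxCard * I.maxWeight / I.minWeight := by
      have : NeZero n := ⟨by omega⟩
      have hmin := MapReduce.minWeight_pos (I := I)
      have hmm : I.minWeight ≤ I.maxWeight :=
        (MapReduce.minWeight_le_weight 0).trans (MapReduce.weight_le_maxWeight 0)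
      have hmc : 1 ≤ I.maxCard := by
        obtain ⟨l, hl⟩ := I.exists_mem ⟨0, by omega⟩
        exact (Finset.card_pos.2 ⟨_, hl⟩).trans_le
          (Finset.le_sup (f := fun l => (I.sets l).card) (Finset.mem_univ l))
      have hmc' : (1 : ℝ) ≤ I.maxCard := by exact_mod_cast hmc
      rw [le_div_iff₀ hmin]
      nlinarith
    set S := Real.logb (1 + ε) (I.maxCard * I.maxWeight / I.minWeight) with hS
    have hS0 : 0 ≤ S := Real.logb_nonneg he hratio
    have hsp : (MapReduce.spread I (1 + ε) : ℝ) ≤ S := Nat.floor_le hS0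
    have hrounds := MapReduce.rounds_le hsp hit (by rwa [le_div_iff₀ hly0, one_mul]) hE
      (Nat.cast_nonneg _)
      (MapReduce.horizon_initial (I := I) (e := 1 + ε) (MapReduce.root4 d))
    have hle : MapReduce.horizon I (1 + ε) (MapReduce.root4 d) (MapReduce.AState.initial m n) *
        (2 * (Nat.clog (MapReduce.root4 d + 1) M + 1) + 1) ≤ R := by
      have h1 : 36 * ((b : ℝ) + 1) * (Real.log I.totalCard / Real.log y * (1 + S) *
          (Real.log n / Real.log y)) ≤ R := by
        refine le_trans ?_ hR
        -- The factor is `576 = 36 · 4²`, as both denominators are `log y = μ log m / 4`.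
        have h2 : 36 * ((b : ℝ) + 1) * (Real.log I.totalCard / Real.log y * (1 + S) *
            (Real.log n / Real.log y)) = (576 * (b + 1)) * (Real.log I.totalCard * (1 + S) *
              Real.log n / (μ ^ 2 * Real.log m ^ 2)) := by
          rw [hly]; field_simp; ring
        rw [h2]
        have h3 : ((576 * (b + 1) : ℕ) : ℝ) ≤ K := by exact_mod_cast (by omega)
        push_cast at h3
        have h4 : 0 ≤ Real.log I.totalCard := hly0.le.trans hyΦ
        gcongr
      exact_mod_cast hrounds.trans h1
    have hsurv := MapReduce.survive_le_of_horizon_le hA he (by omega) (MapReduce.one_le_clog hn)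
      (by omega) rfl _ _ _ _ hstart le_rfl
    rw [MapReduce.risk_initial] at hsurv
    have hfail := MapReduce.failure_le hm hn hμ hΦ1 MapReduce.totalCard_le hy hy5 hyq rfl hit
    have h1 := ENNReal.toReal_le_of_le_ofReal (by positivity)
      ((MapReduce.survive_antitone (W := W) c₀ hle).trans hsurv)
    have h2 : 72 * ((m : ℝ) / μ) * Real.exp (-y / 2) ≤ K * (m / μ) * Real.exp (-y / 2) := by
      have : (72 : ℝ) ≤ K := by exact_mod_cast (by omega : 72 ≤ K)
      gcongr
    linarith
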